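/- Let $n,m\ge 1$ and $\lambda\ge 1$ be integers with $mn\ge 9$, and assume that it is not the case that $\lambda=1$ and $\{m,n\}=\{2,8\}$. Let $K_n\times K_m$ be the tensor product of complete graphs: its vertex set is $V(K_n)\times V(K_m)$, and $(g_1,h_1)$, $(g_2,h_2)$ are adjacent exactly when $g_1\ne g_2$ and $h_1\ne h_2$. Let $G=(K_n\times K_m)(\lambda)$ be the multigraph obtained from it by replacing every edge by $\lambda$ parallel edges. For $p,q\ge 0$, an $(8;p,q)$-decomposition of $G$ is a family of $p+q$ pairwise edge-disjoint subgraphs of $G$ that together contain all edges of $G$, where $p$ of them are paths with $8$ edges and $q$ of them are cycles with $8$ edges. Then $G$ admits an $(8;p,q)$-decomposition for some $p,q\ge 0$ if and only if $8 \mid \frac{\lambda mn(m-1)(n-1)}{2}$. Moreover, all pairs that are not ruled out by counting edges and vertices of odd degree occur: for all $p,q\ge 0$, $G$ admits an $(8;p,q)$-decomposition if and only if 1. $8(p+q)=\frac{\lambda mn(m-1)(n-1)}{2}$; 2. if $\lambda(m-1)(n-1)$ is odd, then $p\ge \frac{mn}{2}$; and 3. if $\lambda(m-1)(n-1)$ is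 even, then $p\neq 1$. -/

import Mathlib

/-- The tensor (direct) product `G × H` of two simple graphs: `(g₁, h₁)` and `(g₂, h₂)` are adjacent
when `g₁ g₂` is an edge of `G` and `h₁ h₂` is an edge of `H`. -/
def SimpleGraph.tensorProduct {V W : Type*} (G : SimpleGraph V) (H : SimpleGraph W) :
    SimpleGraph (V × W) where
  Adj x y := G.Adj x.1 y.1 ∧ H.Adj x.2 y.2
  symm := ⟨fun _ _ h => ⟨h.1.symm, h.2.symm⟩⟩
  loopless := ⟨fun _ h => G.irrefl h.1⟩

/-- The multigraph `G(l)`: every edge of the simple graph `G` is replaced by `l` parallel edges.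
The edges are the pairs `(s(x, y), i)` with `x y` an edge of `G` and `i < l`. -/
def SimpleGraph.parallelFold {V : Type*} (G : SimpleGraph V) (l : ℕ) :
    Graph V (Sym2 V × Fin l) where
  vertexSet := Set.univ
  IsLink e x y := G.Adj x y ∧ e.1 = s(x, y)
  isLink_symm := fun _ _ => ⟨fun _ _ h => ⟨h.1.symm, h.2.trans Sym2.eq_swap⟩⟩
  eq_or_eq_of_isLink_of_isLink := by
    rintro e x y v w ⟨_, h⟩ ⟨_, h'⟩
    rw [h, Sym2.eq_iff] at h'
    tauto
  left_mem_of_isLink := fun _ _ _ _ => Set.mem_univ _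

/-- The multigraph `P` is a path with `k` edges, hence with `k + 1` distinct vertices
`v 0, …, v k`; its edges are `e 0, …, e (k - 1)`, where `e i` joins `v i` and `v (i + 1)`. -/
def Graph.IsPathOfLength {α β : Type*} (P : Graph α β) (k : ℕ) : Prop :=
  ∃ (v : Fin (k + 1) → α) (e : Fin k → β), Function.Injective v ∧ Function.Injective e ∧
    P.vertexSet = Set.range v ∧
    ∀ f x y, P.IsLink f x y ↔ ∃ i : Fin k, f = e i ∧ s(x, y) = s(v i.castSucc, v i.succ)

/-- The multigraph `C` is a cycle with `k ≥ 3` distinct vertices `v 0, …, v (k - 1)`; its edges are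
`e 0, …, e (k - 1)`, where `e i` joins `v i` and `v (i + 1)`, indices being read modulo `k`. -/
def Graph.IsCycleOfLength {α β : Type*} (C : Graph α β) (k : ℕ) : Prop :=
  3 ≤ k ∧ ∃ (v : Fin k → α) (e : Fin k → β), Function.Injective v ∧ Function.Injective e ∧
    C.vertexSet = Set.range v ∧
    ∀ f x y, C.IsLink f x y ↔ ∃ i : Fin k, f = e i ∧ s(x, y) = s(v i, v (finRotate k i))

/-- `G` has a `(k; p, q)`-decomposition: there are `p + q` pairwise edge-disjoint subgraphs of `G`
whose edge sets have union `E(G)`, such that `p` of them are paths of length `k` and the other `q`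
are cycles of length `k`. -/
def Graph.HasPathCycleDecomposition {α β : Type*} (G : Graph α β) (k p q : ℕ) : Prop :=
  ∃ H : Fin p ⊕ Fin q → Graph α β,
    (∀ t, H t ≤ G) ∧
    (∀ i : Fin p, (H (Sum.inl i)).IsPathOfLength k) ∧
    (∀ j : Fin q, (H (Sum.inr j)).IsCycleOfLength k) ∧
    (Pairwise fun s t => Disjoint (H s).edgeSet (H t).edgeSet) ∧
    (⋃ t, (H t).edgeSet) = G.edgeSet

/-!
The conditions on `p` and `q` are necessary because the parts of a decomposition together have
`8 * (p + q)` edges, and because the degree of a vertex is odd exactly if an odd number of paths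
end there: `exists_ends_of_hasPathCycleDecomposition`.

For sufficiency, let `K_n ⊠ K_m` be the tensor product. Paths and cycles may be exchanged locally: a
set of `k ≥ 3` cycles is a *swap* if its edges also decompose into `p` paths and `k - p` cycles for
`p = 2, 3, …, k`. If the `l`-fold multigraph of a graph decomposes into swaps, then it has
decompositions with any number `p ≠ 1` of paths; such graphs are called `Full`. If all degrees are
odd, a path has to end at every vertex; `FullFrom` says that `a` paths and further cycles suffice
and that any larger number of paths is possible as well. Both properties pass to edge-disjoint
unions (`Full.sup`, `FullFrom.sup_full`, `FullFrom.sup`), so it is enough to cut `K_n ⊠ K_m` into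
small tensor products, for which explicit decompositions are given and verified by evaluation.

The graph `G ⊠ K_m` is the edge-disjoint union of copies of `G ⊠ K_2`, one for each edge of `K_m`.
Therefore most cases of even degree reduce to `m = 2`. The step from `n` to `n + 8` splits `K_{n+8}`
into `K_n`, a `K_9` sharing one vertex with it, and a complete bipartite graph between `8` and
`n - 1` vertices, or else into `K_n`, `K_8` and a complete bipartite graph between `8` and `n`
vertices; complete bipartite graphs split into copies of `K_{8,4}`. This leaves a few initial values
of `n` for each of the multiplicities `l = 1, 2, 4` (`edgeFull_of_mod_eight_eq_one`, `edgeFull_two`,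
`edgeFull_four`). Where `K_n ⊠ K_2` is not `Full`, `K_m` is cut into larger parts: into paths with
two edges if `l = 1`, `n % 4 = 1` and `m % 4 ≤ 1` (`full_of_mod_four_eq_one`), into triangles and
cycles of length `4` if `l = 1`, `8 ∣ n` and `m` is odd (`full_of_eight_dvd`), and into paths with
two edges and at most one triangle if `l = 2` and `n = 4` (`full_four_two`). The last of the cases
that suffice for all others is `n = m = 3` with `l = 4`.

If all degrees are odd, then `l` is odd, `n` and `m` are even and `16 ∣ n * m`. An even part of the
multiplicity can be split off, since the double multigraph is `Full`. For `l = 1`, vertices are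
added `8` or `2` at a time; the edges inside the new set give every new vertex an odd degree, and if
they are too few for the paths which end at these vertices, then part of the edges to the old
vertices is used together with them (`FullFrom.clique_union_join`). The graph `K_8 ⊠ K_2` itself
has too few edges, and for it one starts with `l = 3`.
-/

namespace OctaDecomp

variable {V W : Type*}

/-! ### Decomposing a multiset of edges -/

/-- The edges of the path `v 0, …, v 8`. -/
def pathEdges (v : Fin 9 → V) : Multiset (Sym2 V) :=
  Finset.univ.val.map fun i : Fin 8 => s(v i.castSucc, v i.succ)

/-- The edges of the closed walk `v 0, …, v 7, v 0`. -/
def cycleEdges (v : Fin 8 → V) : Multiset (Sym2 V) :=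
  Finset.univ.val.map fun i : Fin 8 => s(v i, v (finRotate 8 i))

/-- `Decomposes w p q`: the multiset `w` of unordered pairs is the sum of the edge sets of `p` paths
and `q` cycles, all of length `8`. -/
inductive Decomposes : Multiset (Sym2 V) → ℕ → ℕ → Prop
  | zero : Decomposes 0 0 0
  | path {w : Multiset (Sym2 V)} {p q : ℕ} (v : Fin 9 → V) (hv : Function.Injective v)
      (h : Decomposes w p q) : Decomposes (pathEdges v + w) (p + 1) q
  | cycle {w : Multiset (Sym2 V)} {p q : ℕ} (v : Fin 8 → V) (hv : Function.Injective v)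
      (h : Decomposes w p q) : Decomposes (cycleEdges v + w) p (q + 1)

theorem Decomposes.add {w w' : Multiset (Sym2 V)} {p q p' q' : ℕ} (h : Decomposes w p q)
    (h' : Decomposes w' p' q') : Decomposes (w + w') (p + p') (q + q') := by
  induction h with
  | zero => simpa using h'
  | path v hv _ ih => simpa only [add_assoc, add_comm, add_left_comm] using ih.path v hv
  | cycle v hv _ ih => simpa only [add_assoc, add_comm, add_left_comm] using ih.cycle v hv

theorem Decomposes.map {w : Multiset (Sym2 V)} {p q : ℕ} (h : Decomposes w p q) (f : V ↪ W) :
    Decomposes (w.map (Sym2.map f)) p q := by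
  induction h with
  | zero => exact .zero
  | path v hv _ ih =>
    simpa [pathEdges, Function.comp_def] using ih.path (f ∘ v) (f.injective.comp hv)
  | cycle v hv _ ih =>
    simpa [cycleEdges, Function.comp_def] using ih.cycle (f ∘ v) (f.injective.comp hv)

/-- For some `k`, the multiset `w` decomposes into `p` paths and `k - p` cycles for all `p ≤ k`
except `p = 1`. The values `k = 1, 2` are left out: without them the property passes to sums, as
every number other than `1` up to `k + k'` is a sum of two such numbers. -/
def Swappable (w : Multiset (Sym2 V)) : Prop :=
  ∃ k, (k = 0 ∨ 3 ≤ k) ∧ ∀ p ≤ k, p ≠ 1 → Decomposes w p (k - p)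

/-- For some `r ≥ 1`, the multiset `w` decomposes into `p` paths and `a + r - p` cycles whenever
`a ≤ p ≤ a + r`. -/
def Shiftable (w : Multiset (Sym2 V)) (a : ℕ) : Prop :=
  ∃ r, 1 ≤ r ∧ ∀ p, a ≤ p → p ≤ a + r → Decomposes w p (a + r - p)

theorem Swappable.zero : Swappable (0 : Multiset (Sym2 V)) :=
  ⟨0, .inl rfl, fun p hp _ => by obtain rfl : p = 0 := by omega
                                 exact .zero⟩

theorem Swappable.add {w w' : Multiset (Sym2 V)} (h : Swappable w) (h' : Swappable w') :
    Swappable (w + w') := by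
  obtain ⟨k, hk, h⟩ := h
  obtain ⟨k', hk', h'⟩ := h'
  refine ⟨k + k', by omega, fun p hp hp1 => ?_⟩
  obtain ⟨i, j, rfl, hi, hj, hi1, hj1⟩ :
      ∃ i j, p = i + j ∧ i ≤ k ∧ j ≤ k' ∧ i ≠ 1 ∧ j ≠ 1 := by
    by_cases h1 : p ≤ k
    · exact ⟨p, 0, by omega⟩
    by_cases h2 : p = k + 1
    · exact ⟨k - 1, 2, by omega⟩
    · exact ⟨k, p - k, by omega⟩
  have := (h i hi hi1).add (h' j hj hj1)
  rwa [show k - i + (k' - j) = k + k' - (i + j) by omega] at this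

theorem Shiftable.add_swappable {w w' : Multiset (Sym2 V)} {a : ℕ} (h : Shiftable w a)
    (h' : Swappable w') : Shiftable (w + w') a := by
  obtain ⟨r, hr, h⟩ := h
  obtain ⟨k, hk, h'⟩ := h'
  refine ⟨r + k, by omega, fun p hp hp1 => ?_⟩
  obtain ⟨i, j, rfl, hi, hi', hj, hj1⟩ :
      ∃ i j, p = i + j ∧ a ≤ i ∧ i ≤ a + r ∧ j ≤ k ∧ j ≠ 1 := by
    by_cases h1 : p ≤ a + r
    · exact ⟨p, 0, by omega⟩
    by_cases h2 : p ≤ a + k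
    · exact ⟨a, p - a, by omega⟩
    · exact ⟨p - k, k, by omega⟩
  have := (h i hi hi').add (h' j hj hj1)
  rwa [show a + r - i + (k - j) = a + (r + k) - (i + j) by omega] at this

theorem Shiftable.add {w w' : Multiset (Sym2 V)} {a a' : ℕ} (h : Shiftable w a)
    (h' : Shiftable w' a') : Shiftable (w + w') (a + a') := by
  obtain ⟨r, hr, h⟩ := h
  obtain ⟨r', hr', h'⟩ := h'
  refine ⟨r + r', by omega, fun p hp hp1 => ?_⟩
  obtain ⟨i, j, rfl, hi, hi', hj, hj'⟩ :
      ∃ i j, p = i + j ∧ a ≤ i ∧ i ≤ a + r ∧ a' ≤ j ∧ j ≤ a' + r' := by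
    by_cases h1 : p ≤ a + r + a'
    · exact ⟨p - a', a', by omega⟩
    · exact ⟨a + r, p - (a + r), by omega⟩
  have := (h i hi hi').add (h' j hj hj')
  rwa [show a + r - i + (a' + r' - j) = a + a' + (r + r') - (i + j) by omega] at this

theorem Swappable.map {w : Multiset (Sym2 V)} (h : Swappable w) (f : V ↪ W) :
    Swappable (w.map (Sym2.map f)) :=
  let ⟨k, hk, h⟩ := h
  ⟨k, hk, fun p hp hp1 => (h p hp hp1).map f⟩

theorem Shiftable.map {w : Multiset (Sym2 V)} {a : ℕ} (h : Shiftable w a) (f : V ↪ W) :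
    Shiftable (w.map (Sym2.map f)) a :=
  let ⟨r, hr, h⟩ := h
  ⟨r, hr, fun p hp hp1 => (h p hp hp1).map f⟩

/-! ### Decomposing the `l`-fold multigraph of a graph -/

open Classical in
/-- `w` is the multiset of the edges of `G`, each with multiplicity `l`. -/
def IsFold (G : SimpleGraph V) (l : ℕ) (w : Multiset (Sym2 V)) : Prop :=
  ∀ e, w.count e = if e ∈ G.edgeSet then l else 0

theorem IsFold.of_count [DecidableEq (Sym2 V)] {G : SimpleGraph V} {l : ℕ} {w : Multiset (Sym2 V)}
    (h : ∀ e, (e ∈ G.edgeSet → w.count e = l) ∧ (e ∉ G.edgeSet → w.count e = 0)) :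
    IsFold G l w := fun e => by
  split_ifs with he
  · convert (h e).1 he
  · convert (h e).2 he

/-- For some `k` other than `1` and `2`, the `l`-fold multigraph of `G` decomposes into `p` paths
and `k - p` cycles of length `8`, for every `p ≤ k` except `p = 1`. -/
def Full (G : SimpleGraph V) (l : ℕ) : Prop :=
  ∃ w, IsFold G l w ∧ Swappable w

/-- The `l`-fold multigraph of `G` decomposes into `p` paths and `a + r - p` cycles of length `8`,
for some `r ≥ 1` and every `p` from `a` to `a + r`. -/
def FullFrom (G : SimpleGraph V) (l a : ℕ) : Prop :=
  ∃ w, IsFold G l w ∧ Shiftable w a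

theorem IsFold.sup {G G₁ G₂ : SimpleGraph V} {l : ℕ} {w₁ w₂ : Multiset (Sym2 V)}
    (h₁ : IsFold G₁ l w₁) (h₂ : IsFold G₂ l w₂)
    (hG : ∀ x y, G.Adj x y ↔ G₁.Adj x y ∨ G₂.Adj x y)
    (hd : ∀ x y, G₁.Adj x y → ¬ G₂.Adj x y) : IsFold G l (w₁ + w₂) := by
  classical
  intro e
  rw [Multiset.count_add, h₁ e, h₂ e]
  induction e with
  | h x y =>
    simp only [SimpleGraph.mem_edgeSet, hG]
    have := hd x y
    by_cases hx : G₁.Adj x y <;> by_cases hy : G₂.Adj x y <;> simp_all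

theorem IsFold.add {G : SimpleGraph V} {l l' : ℕ} {w w' : Multiset (Sym2 V)}
    (h : IsFold G l w) (h' : IsFold G l' w') : IsFold G (l + l') (w + w') := by
  classical
  intro e
  rw [Multiset.count_add, h e, h' e]
  split_ifs <;> simp

theorem IsFold.map {G : SimpleGraph V} {l : ℕ} {w : Multiset (Sym2 V)} (h : IsFold G l w)
    (f : V ↪ W) : IsFold (G.map f) l (w.map (Sym2.map f)) := by
  classical
  have hinj : Function.Injective (Sym2.map f) := Sym2.map.injective f.injective
  intro e
  by_cases he : e ∈ Set.range (Sym2.map f)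
  · obtain ⟨e, rfl⟩ := he
    rw [Multiset.count_map_eq_count' _ _ hinj, h e]
    have : (Sym2.map f e ∈ (G.map f).edgeSet) ↔ e ∈ G.edgeSet := by
      induction e with
      | h x y => simp [SimpleGraph.map_adj]
    simp [this]
  · have h1 : e ∉ (G.map f).edgeSet := by
      contrapose! he
      induction e with
      | h x y =>
        obtain ⟨a, b, -, rfl, rfl⟩ := (SimpleGraph.map_adj f G x y).1 he
        exact ⟨s(a, b), rfl⟩
    rw [if_neg h1, Multiset.count_eq_zero]
    intro h2
    obtain ⟨a, -, rfl⟩ := Multiset.mem_map.1 h2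
    exact he ⟨a, rfl⟩

theorem Full.sup {G G₁ G₂ : SimpleGraph V} {l : ℕ} (h₁ : Full G₁ l) (h₂ : Full G₂ l)
    (hG : ∀ x y, G.Adj x y ↔ G₁.Adj x y ∨ G₂.Adj x y)
    (hd : ∀ x y, G₁.Adj x y → ¬ G₂.Adj x y) : Full G l :=
  let ⟨_, hw₁, s₁⟩ := h₁
  let ⟨_, hw₂, s₂⟩ := h₂
  ⟨_, hw₁.sup hw₂ hG hd, s₁.add s₂⟩

theorem FullFrom.sup_full {G G₁ G₂ : SimpleGraph V} {l a : ℕ} (h₁ : FullFrom G₁ l a)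
    (h₂ : Full G₂ l) (hG : ∀ x y, G.Adj x y ↔ G₁.Adj x y ∨ G₂.Adj x y)
    (hd : ∀ x y, G₁.Adj x y → ¬ G₂.Adj x y) : FullFrom G l a :=
  let ⟨_, hw₁, s₁⟩ := h₁
  let ⟨_, hw₂, s₂⟩ := h₂
  ⟨_, hw₁.sup hw₂ hG hd, s₁.add_swappable s₂⟩

theorem FullFrom.sup {G G₁ G₂ : SimpleGraph V} {l a₁ a₂ : ℕ} (h₁ : FullFrom G₁ l a₁)
    (h₂ : FullFrom G₂ l a₂) (hG : ∀ x y, G.Adj x y ↔ G₁.Adj x y ∨ G₂.Adj x y)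
    (hd : ∀ x y, G₁.Adj x y → ¬ G₂.Adj x y) : FullFrom G l (a₁ + a₂) :=
  let ⟨_, hw₁, s₁⟩ := h₁
  let ⟨_, hw₂, s₂⟩ := h₂
  ⟨_, hw₁.sup hw₂ hG hd, s₁.add s₂⟩

theorem Full.of_forall_not_adj {G : SimpleGraph V} (h : ∀ x y, ¬ G.Adj x y) (l : ℕ) : Full G l := by
  classical
  refine ⟨0, fun e => ?_, .zero⟩
  induction e with
  | h x y => simp [h x y]

theorem Full.add {G : SimpleGraph V} {l l' : ℕ} (h : Full G l) (h' : Full G l') :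
    Full G (l + l') :=
  let ⟨_, hw, s⟩ := h
  let ⟨_, hw', s'⟩ := h'
  ⟨_, hw.add hw', s.add s'⟩

theorem FullFrom.add_full {G : SimpleGraph V} {l l' a : ℕ} (h : FullFrom G l a)
    (h' : Full G l') : FullFrom G (l + l') a :=
  let ⟨_, hw, s⟩ := h
  let ⟨_, hw', s'⟩ := h'
  ⟨_, hw.add hw', s.add_swappable s'⟩

theorem Full.zero_fold (G : SimpleGraph V) : Full G 0 := by
  classical
  exact ⟨0, fun e => by simp, .zero⟩

theorem Full.of_dvd {G : SimpleGraph V} {l l' : ℕ} (h : Full G l) (hl : l ∣ l') : Full G l' := by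
  obtain ⟨c, rfl⟩ := hl
  induction c with
  | zero => exact .zero_fold G
  | succ c ih => exact ih.add h

theorem Full.map {G : SimpleGraph V} {l : ℕ} (h : Full G l) (f : V ↪ W) : Full (G.map f) l :=
  let ⟨_, hw, s⟩ := h
  ⟨_, hw.map f, s.map f⟩

theorem FullFrom.map {G : SimpleGraph V} {l a : ℕ} (h : FullFrom G l a) (f : V ↪ W) :
    FullFrom (G.map f) l a :=
  let ⟨_, hw, s⟩ := h
  ⟨_, hw.map f, s.map f⟩

/-! ### Verifying explicit decompositions -/

/-- The edge `ab` of a graph on numbers below `64`, as a number. -/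
def edgeCode (a b : ℕ) : ℕ := if a < b then 64 * a + b else 64 * b + a

/-- The edges of the cycle or path of length `8` given by the list of its vertices: a list of `8`
vertices stands for a cycle, a list of `9` vertices for a path. -/
def pieceCodes : List ℕ → List ℕ
  | [a, b, c, d, e, f, g, h] => [edgeCode a b, edgeCode b c, edgeCode c d, edgeCode d e,
      edgeCode e f, edgeCode f g, edgeCode g h, edgeCode h a]
  | [a, b, c, d, e, f, g, h, i] => [edgeCode a b, edgeCode b c, edgeCode c d, edgeCode d e,
      edgeCode e f, edgeCode f g, edgeCode g h, edgeCode h i]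
  | _ => []

/-- The edges of all members of a list of paths and cycles. -/
def codes (v : List (List ℕ)) : List ℕ := v.flatMap pieceCodes

/-- Both lists contain each number equally often. This is tested by comparing single numbers whose
digits in base `1024` are the multiplicities of the members. -/
def SameCodes (L L' : List ℕ) : Bool :=
  decide (L.length < 1024) && decide (L'.length < 1024) &&
    (L.map (1024 ^ ·)).sum == (L'.map (1024 ^ ·)).sum

/-- The multiplicity of `c` is the digit in place `c`: the members less than `c` contribute less
than `1024 ^ c`, those greater than `c` a multiple of `1024 ^ (c + 1)`. -/
theorem exists_sum_pow_eq (L : List ℕ) (c : ℕ) : ∃ low high,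
    (L.map (1024 ^ ·)).sum = low + 1024 ^ c * (L.count c + 1024 * high) ∧
      1024 * low ≤ L.length * 1024 ^ c := by
  induction L with
  | nil => exact ⟨0, 0, by simp⟩
  | cons x L ih =>
    obtain ⟨low, high, h, hlow⟩ := ih
    simp only [List.map_cons, List.sum_cons, List.length_cons, List.count_cons, beq_iff_eq, h]
    rcases lt_trichotomy x c with hx | rfl | hx
    · refine ⟨1024 ^ x + low, high, by rw [if_neg hx.ne]; ring, ?_⟩
      have : 1024 * 1024 ^ x ≤ 1024 ^ c := by
        rw [← pow_succ']
        exact Nat.pow_le_pow_right (by norm_num) hx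
      linarith
    · exact ⟨low, high, by rw [if_pos rfl]; ring, by linarith [Nat.zero_le (1024 ^ x)]⟩
    · refine ⟨low, high + 1024 ^ (x - c - 1), ?_, by linarith [Nat.zero_le (1024 ^ c)]⟩
      have : 1024 ^ x = 1024 ^ c * (1024 * 1024 ^ (x - c - 1)) := by
        rw [← pow_succ', ← pow_add]
        congr 1
        omega
      rw [if_neg hx.ne', this]
      ring

theorem count_eq_digit {L : List ℕ} (hL : L.length < 1024) (c : ℕ) :
    L.count c = (L.map (1024 ^ ·)).sum / 1024 ^ c % 1024 := by
  obtain ⟨low, high, h, hlow⟩ := exists_sum_pow_eq L c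
  have hpos : 0 < 1024 ^ c := by positivity
  have hlt : low < 1024 ^ c := by
    have := Nat.mul_lt_mul_of_pos_right hL hpos
    linarith
  have hc : L.count c ≤ L.length := List.count_le_length
  rw [h, Nat.add_mul_div_left _ _ hpos, Nat.div_eq_of_lt hlt, zero_add, Nat.add_mul_mod_self_left,
    Nat.mod_eq_of_lt (by omega)]

theorem perm_of_sameCodes {L L' : List ℕ} (h : SameCodes L L' = true) : L.Perm L' := by
  simp only [SameCodes, Bool.and_eq_true, decide_eq_true_eq, beq_iff_eq] at h
  rw [List.perm_iff_count]
  intro c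
  rw [count_eq_digit h.1.1, count_eq_digit h.1.2, h.2]

/-- The number of paths in a list of paths and cycles. -/
def pathCount (v : List (List ℕ)) : ℕ := v.countP (·.length == 9)

/-- All members of `v` have `8` or `9` vertices, which are distinct and less than `N`. -/
def ValidPieces (N : ℕ) (v : List (List ℕ)) : Bool :=
  v.all fun l => (l.length == 8 || l.length == 9) && l.all (· < N) && decide l.Nodup

/-- The edge between the images under `ν` of the two numbers that `c` encodes. -/
def decodeEdge (ν : ℕ → V) (c : ℕ) : Sym2 V := s(ν (c / 64), ν (c % 64))

theorem decodeEdge_edgeCode (ν : ℕ → V) {a b : ℕ} (ha : a < 64) (hb : b < 64) :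
    decodeEdge ν (edgeCode a b) = s(ν a, ν b) := by
  unfold decodeEdge edgeCode
  split_ifs
  · rw [show (64 * a + b) / 64 = a by omega, show (64 * a + b) % 64 = b by omega]
  · rw [show (64 * b + a) / 64 = b by omega, show (64 * b + a) % 64 = a by omega, Sym2.eq_swap]

/-- The multiset of edges of `v`, once the numbers are replaced by vertices. -/
def edgesOf (ν : ℕ → V) (v : List (List ℕ)) : Multiset (Sym2 V) :=
  ((codes v).map (decodeEdge ν) : List (Sym2 V))

theorem edgesOf_cons (ν : ℕ → V) (l : List ℕ) (v : List (List ℕ)) :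
    edgesOf ν (l :: v) = ((pieceCodes l).map (decodeEdge ν) : List (Sym2 V)) + edgesOf ν v := by
  simp [edgesOf, codes]

theorem edgesOf_append (ν : ℕ → V) (v v' : List (List ℕ)) :
    edgesOf ν (v ++ v') = edgesOf ν v + edgesOf ν v' := by
  simp [edgesOf, codes]

theorem edgesOf_perm (ν : ℕ → V) {v v' : List (List ℕ)}
    (h : SameCodes (codes v) (codes v') = true) :
    edgesOf ν v = edgesOf ν v' :=
  Multiset.coe_eq_coe.2 ((perm_of_sameCodes h).map _)

theorem injective_get_of_injOn {ν : ℕ → V} {N k : ℕ} (hν : Set.InjOn ν (Set.Iio N)) {l : List ℕ}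
    (hl : ∀ x ∈ l, x < N) (hn : l.Nodup) (hk : k = l.length) :
    Function.Injective fun i : Fin k => ν (l.get (i.cast hk)) := by
  intro i j hij
  have := hν (hl _ (l.get_mem _)) (hl _ (l.get_mem _)) hij
  simpa using List.nodup_iff_injective_get.1 hn this

theorem decomposes_edgesOf {ν : ℕ → V} {N : ℕ} (hν : Set.InjOn ν (Set.Iio N)) (hN : N ≤ 64)
    (v : List (List ℕ)) (hv : ValidPieces N v = true) :
    Decomposes (edgesOf ν v) (pathCount v) (v.length - pathCount v) := by
  induction v with
  | nil => exact .zero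
  | cons l v ih =>
    simp only [ValidPieces, List.all_cons, Bool.and_eq_true, Bool.or_eq_true, beq_iff_eq,
      List.all_eq_true, decide_eq_true_eq] at hv ih
    obtain ⟨⟨⟨hlen, hlt⟩, hnd⟩, hv⟩ := hv
    have ih := ih hv
    have hle : pathCount v ≤ v.length := List.countP_le_length
    rw [edgesOf_cons]
    rcases hlen with hlen | hlen
    · have hc : pathCount (l :: v) = pathCount v := by simp [pathCount, hlen]
      have hi := injective_get_of_injOn hν hlt hnd hlen.symm
      have := ih.cycle _ hi
      rw [hc, List.length_cons, Nat.sub_add_comm hle]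
      convert this using 2
      match l, hlen with
      | [a, b, c, d, e, f, g, h], _ =>
        simp only [List.mem_cons, forall_eq_or_imp, List.not_mem_nil, false_imp_iff,
          implies_true, and_true] at hlt
        change _ = (([s(ν a, ν b), s(ν b, ν c), s(ν c, ν d), s(ν d, ν e), s(ν e, ν f), s(ν f, ν g),
          s(ν g, ν h), s(ν h, ν a)] : List (Sym2 V)) : Multiset (Sym2 V))
        simp only [pieceCodes, List.map_cons, List.map_nil]
        repeat rw [decodeEdge_edgeCode ν (by omega) (by omega)]
    · have hc : pathCount (l :: v) = pathCount v + 1 := by simp [pathCount, hlen]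
      have hi := injective_get_of_injOn hν hlt hnd hlen.symm
      have := ih.path _ hi
      rw [hc, List.length_cons, Nat.add_sub_add_right]
      convert this using 2
      match l, hlen with
      | [a, b, c, d, e, f, g, h, i], _ =>
        simp only [List.mem_cons, forall_eq_or_imp, List.not_mem_nil, false_imp_iff,
          implies_true, and_true] at hlt
        change _ = (([s(ν a, ν b), s(ν b, ν c), s(ν c, ν d), s(ν d, ν e), s(ν e, ν f), s(ν f, ν g),
          s(ν g, ν h), s(ν h, ν i)] : List (Sym2 V)) : Multiset (Sym2 V))
        simp only [pieceCodes, List.map_cons, List.map_nil]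
        repeat rw [decodeEdge_edgeCode ν (by omega) (by omega)]

/-- The members of `g` decompose the same multigraph, into as many parts as `g` has members; the
numbers of paths among these parts are `0, 2, 3, …, g.length`. -/
def IsSwap (N : ℕ) (g : List (List (List ℕ))) : Bool :=
  decide (3 ≤ g.length) && g.map pathCount == 0 :: List.range' 2 (g.length - 1) &&
    g.all fun v =>
      v.length == g.length && ValidPieces N v && SameCodes (codes v) (codes (g.headD []))

theorem IsSwap.swappable {ν : ℕ → V} {N : ℕ} (hν : Set.InjOn ν (Set.Iio N)) (hN : N ≤ 64)
    {g : List (List (List ℕ))} (hg : IsSwap N g = true) : Swappable (edgesOf ν (g.headD [])) := by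
  simp only [IsSwap, Bool.and_eq_true, decide_eq_true_eq, beq_iff_eq, List.all_eq_true] at hg
  obtain ⟨⟨h3, hm⟩, hall⟩ := hg
  refine ⟨g.length, .inr h3, fun p hp hp1 => ?_⟩
  obtain ⟨v, hv, rfl⟩ : ∃ v ∈ g, pathCount v = p := by
    rw [← List.mem_map, hm, List.mem_cons, List.mem_range'_1]
    omega
  obtain ⟨⟨hlen, hval⟩, hperm⟩ := hall v hv
  rw [← edgesOf_perm ν hperm, ← hlen]
  exact decomposes_edgesOf hν hN v hval

theorem swappable_of_forall_isSwap {ν : ℕ → V} {N : ℕ} (hν : Set.InjOn ν (Set.Iio N)) (hN : N ≤ 64)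
    {gs : List (List (List (List ℕ)))} (hg : gs.all (IsSwap N) = true) :
    Swappable (edgesOf ν (gs.flatMap fun g => g.headD [])) := by
  induction gs with
  | nil => exact .zero
  | cons g gs ih =>
    simp only [List.all_cons, Bool.and_eq_true] at hg
    rw [List.flatMap_cons, edgesOf_append]
    exact (IsSwap.swappable hν hN hg.1).add (ih hg.2)

/-- The edges of the `l`-fold multigraph of the tensor product of the graphs on the numbers less
than `a` and `b` with adjacency `f` and `h`. The vertex `(x, y)` is the number `x * b + y`. -/
def targetCodes (a b l : ℕ) (f h : ℕ → ℕ → Bool) : List ℕ :=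
  ((List.range (a * b)).flatMap fun i => ((List.range (a * b)).filter fun j =>
    decide (i < j) && f (i / b) (j / b) && h (i % b) (j % b)).map (64 * i + ·)).flatMap
      (List.replicate l)

/-- The vertex `(x, y)` with number `x * b + y`. -/
def vertexOf (a b : ℕ) [NeZero a] [NeZero b] (i : ℕ) : Fin a × Fin b :=
  (Fin.ofNat a (i / b), Fin.ofNat b (i % b))

theorem vertexOf_injOn (a b : ℕ) [NeZero a] [NeZero b] :
    Set.InjOn (vertexOf a b) (Set.Iio (a * b)) := by
  intro i hi j hj hij
  have hb : 0 < b := Nat.pos_of_neZero b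
  simp only [Set.mem_Iio] at hi hj
  have h1 : i / b < a := Nat.div_lt_of_lt_mul (by rwa [mul_comm] at hi)
  have h2 : j / b < a := Nat.div_lt_of_lt_mul (by rwa [mul_comm] at hj)
  simp only [vertexOf, Prod.mk.injEq, Fin.ext_iff, Fin.val_ofNat, Nat.mod_mod,
    Nat.mod_eq_of_lt h1, Nat.mod_eq_of_lt h2] at hij
  rw [← Nat.div_add_mod i b, ← Nat.div_add_mod j b, hij.1, hij.2]

theorem isFold_targetCodes {a b : ℕ} [NeZero a] [NeZero b] (hN : a * b ≤ 64) (l : ℕ)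
    {f h : ℕ → ℕ → Bool} {G : SimpleGraph (Fin a)} {H : SimpleGraph (Fin b)}
    (hG : ∀ x y, G.Adj x y ↔ f x y = true) (hH : ∀ x y, H.Adj x y ↔ h x y = true) :
    IsFold (G.tensorProduct H) l
      ((targetCodes a b l f h).map (decodeEdge (vertexOf a b)) : List (Sym2 _)) := by
  classical
  have hb : 0 < b := Nat.pos_of_neZero b
  set ν := vertexOf a b with hνdef
  set L : List ℕ := (List.range (a * b)).flatMap fun i => ((List.range (a * b)).filter fun j =>
    decide (i < j) && f (i / b) (j / b) && h (i % b) (j % b)).map (64 * i + ·) with hL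
  have hadj : ∀ i j, i < a * b → j < a * b → ((G.tensorProduct H).Adj (ν i) (ν j) ↔
      f (i / b) (j / b) = true ∧ h (i % b) (j % b) = true) := by
    intro i j hi hj
    have h1 : i / b < a := Nat.div_lt_of_lt_mul (by rwa [mul_comm] at hi)
    have h2 : j / b < a := Nat.div_lt_of_lt_mul (by rwa [mul_comm] at hj)
    simp [SimpleGraph.tensorProduct, hG, hH, hνdef, vertexOf, Nat.mod_eq_of_lt h1,
      Nat.mod_eq_of_lt h2]
  have hmem : ∀ c, c ∈ L ↔ ∃ i j, i < j ∧ j < a * b ∧ c = 64 * i + j ∧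
      f (i / b) (j / b) = true ∧ h (i % b) (j % b) = true := by
    intro c
    simp only [hL, List.mem_flatMap, List.mem_range, List.mem_map, List.mem_filter,
      Bool.and_eq_true, decide_eq_true_eq]
    constructor
    · rintro ⟨i, hi, j, ⟨hj, ⟨hij, hf⟩, hh⟩, rfl⟩
      exact ⟨i, j, hij, hj, rfl, hf, hh⟩
    · rintro ⟨i, j, hij, hj, rfl, hf, hh⟩
      exact ⟨i, hij.trans hj, j, ⟨hj, ⟨hij, hf⟩, hh⟩, rfl⟩
  have hdec : ∀ i j, j < a * b → decodeEdge ν (64 * i + j) = s(ν i, ν j) := by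
    intro i j hj
    rw [decodeEdge, show (64 * i + j) / 64 = i by omega, show (64 * i + j) % 64 = j by omega]
  have hinj := vertexOf_injOn a b
  have hnd : (L.map (decodeEdge ν)).Nodup := by
    refine List.Nodup.map_on ?_ ?_
    · intro c hc d hd hcd
      obtain ⟨i, j, hij, hj, rfl, -⟩ := (hmem c).1 hc
      obtain ⟨i', j', hij', hj', rfl, -⟩ := (hmem d).1 hd
      rw [hdec i j hj, hdec i' j' hj', Sym2.eq_iff] at hcd
      rcases hcd with ⟨h1, h2⟩ | ⟨h1, h2⟩
      · rw [hinj (hij.trans hj) (hij'.trans hj') h1, hinj hj hj' h2]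
      · have h1 := hinj (hij.trans hj) hj' h1
        have h2 := hinj hj (hij'.trans hj') h2
        omega
    · rw [hL, List.nodup_flatMap]
      refine ⟨fun i _ => (List.nodup_range.filter _).map fun x y hxy => by simpa using hxy, ?_⟩
      refine List.nodup_range.imp_of_mem fun {i i'} _ _ hii c hc hc' => ?_
      simp only [List.mem_map, List.mem_filter, List.mem_range] at hc hc'
      obtain ⟨j, ⟨hj, -⟩, rfl⟩ := hc
      obtain ⟨j', ⟨hj', -⟩, hc'⟩ := hc'
      omega
  have hedge : ∀ e, e ∈ L.map (decodeEdge ν) ↔ e ∈ (G.tensorProduct H).edgeSet := by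
    intro e
    constructor
    · intro he
      obtain ⟨c, hc, rfl⟩ := List.mem_map.1 he
      obtain ⟨i, j, hij, hj, rfl, hf⟩ := (hmem c).1 hc
      rw [hdec i j hj]
      exact (hadj i j (hij.trans hj) hj).2 hf
    · intro he
      induction e with
      | h x y =>
        have hν : ∀ z : Fin a × Fin b, ∃ i < a * b, ν i = z := by
          rintro ⟨⟨x, hx⟩, ⟨y, hy⟩⟩
          refine ⟨b * x + y, ?_, ?_⟩
          · calc b * x + y < b * x + b := by omega
              _ = b * (x + 1) := by ring
              _ ≤ b * a := Nat.mul_le_mul_left _ hx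
              _ = a * b := mul_comm _ _
          · simp [hνdef, vertexOf, Fin.ext_iff, Nat.mul_add_div hb, Nat.div_eq_of_lt hy,
              Nat.mod_eq_of_lt hy, Nat.mod_eq_of_lt hx]
        obtain ⟨i, hi, rfl⟩ := hν x
        obtain ⟨j, hj, rfl⟩ := hν y
        have he : (G.tensorProduct H).Adj (ν i) (ν j) := he
        rcases lt_trichotomy i j with hij | rfl | hij
        · exact List.mem_map.2 ⟨_, (hmem _).2 ⟨i, j, hij, hj, rfl, (hadj i j hi hj).1 he⟩,
            hdec i j hj⟩
        · exact absurd he ((G.tensorProduct H).irrefl)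
        · rw [Sym2.eq_swap]
          exact List.mem_map.2 ⟨_, (hmem _).2 ⟨j, i, hij, hi, rfl, (hadj j i hj hi).1 he.symm⟩,
            hdec j i hi⟩
  have hrep : ∀ (M : List ℕ) e, ((M.flatMap (List.replicate l)).map (decodeEdge ν)).count e =
      l * (M.map (decodeEdge ν)).count e := by
    intro M e
    induction M with
    | nil => simp
    | cons c M ih =>
      rw [List.flatMap_cons, List.map_append, List.count_append, ih, List.map_replicate,
        List.map_cons, List.count_cons, List.count_replicate]
      split_ifs <;> ring
  refine IsFold.of_count fun e => ?_
  rw [Multiset.coe_count, targetCodes, ← hL, hrep, List.Nodup.count hnd, ← hedge]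
  constructor <;> intro he <;> simp only [he, if_true, if_false, mul_one, mul_zero]

/-- `gs` consists of swaps, and the first members of these together decompose the `l`-fold
multigraph of the tensor product with adjacency `f` and `h`. -/
def CertifiesFull (a b l : ℕ) (f h : ℕ → ℕ → Bool) (gs : List (List (List (List ℕ)))) : Bool :=
  gs.all (IsSwap (a * b)) &&
    SameCodes (codes (gs.flatMap fun g => g.headD [])) (targetCodes a b l f h)

theorem full_of_certifiesFull {a b l : ℕ} [NeZero a] [NeZero b] {f h : ℕ → ℕ → Bool}
    {gs : List (List (List (List ℕ)))} (hgs : CertifiesFull a b l f h gs = true) (hN : a * b ≤ 64)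
    {G : SimpleGraph (Fin a)} {H : SimpleGraph (Fin b)} (hG : ∀ x y, G.Adj x y ↔ f x y = true)
    (hH : ∀ x y, H.Adj x y ↔ h x y = true) : Full (G.tensorProduct H) l := by
  simp only [CertifiesFull, Bool.and_eq_true] at hgs
  refine ⟨_, isFold_targetCodes hN l hG hH, ?_⟩
  rw [← Multiset.coe_eq_coe.2 ((perm_of_sameCodes hgs.2).map _)]
  exact swappable_of_forall_isSwap (vertexOf_injOn a b) hN hgs.1

/-- `ps` consists of `a₀ - 1` paths, `s` is a path and a cycle, `t` consists of two paths with the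
same edges as `s`, `gs` consists of swaps, and `ps`, `s` and the first members of `gs` together
decompose the `l`-fold multigraph of the tensor product with adjacency `f` and `h`. -/
def CertifiesFullFrom (a b l a₀ : ℕ) (f h : ℕ → ℕ → Bool) (ps s t : List (List ℕ))
    (gs : List (List (List (List ℕ)))) : Bool :=
  pathCount ps + 1 == a₀ && ps.length + 1 == a₀ && pathCount s == 1 && s.length == 2 &&
    pathCount t == 2 && t.length == 2 && ValidPieces (a * b) ps && ValidPieces (a * b) s &&
    ValidPieces (a * b) t && SameCodes (codes t) (codes s) && gs.all (IsSwap (a * b)) &&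
    SameCodes (codes (ps ++ s ++ gs.flatMap fun g => g.headD [])) (targetCodes a b l f h)

theorem fullFrom_of_certifiesFullFrom {a b l a₀ : ℕ} [NeZero a] [NeZero b] {f h : ℕ → ℕ → Bool}
    {ps s t : List (List ℕ)} {gs : List (List (List (List ℕ)))}
    (hgs : CertifiesFullFrom a b l a₀ f h ps s t gs = true) (hN : a * b ≤ 64)
    {G : SimpleGraph (Fin a)} {H : SimpleGraph (Fin b)} (hG : ∀ x y, G.Adj x y ↔ f x y = true)
    (hH : ∀ x y, H.Adj x y ↔ h x y = true) : FullFrom (G.tensorProduct H) l a₀ := by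
  simp only [CertifiesFullFrom, Bool.and_eq_true, beq_iff_eq] at hgs
  obtain ⟨⟨⟨⟨⟨⟨⟨⟨⟨⟨⟨hp, hpl⟩, hs⟩, hsl⟩, ht⟩, htl⟩, vp⟩, vs⟩, vt⟩, hperm⟩, hsw⟩, htarget⟩ := hgs
  refine ⟨_, isFold_targetCodes hN l hG hH, ?_⟩
  have hν := vertexOf_injOn a b
  rw [← Multiset.coe_eq_coe.2 ((perm_of_sameCodes htarget).map _)]
  change Shiftable (edgesOf (vertexOf a b) (ps ++ s ++ _)) a₀
  rw [edgesOf_append]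
  refine Shiftable.add_swappable ⟨1, le_rfl, fun p hp1 hp2 => ?_⟩
    (swappable_of_forall_isSwap hν hN hsw)
  have dp := decomposes_edgesOf hν hN ps vp
  have ds := decomposes_edgesOf hν hN s vs
  have dt := decomposes_edgesOf hν hN t vt
  rw [edgesOf_append]
  obtain rfl | rfl : p = a₀ ∨ p = a₀ + 1 := by omega
  · have := dp.add ds
    rwa [show ps.length - pathCount ps + (s.length - pathCount s) = p + 1 - p by omega,
      show pathCount ps + pathCount s = p by omega] at this
  · rw [← edgesOf_perm _ hperm]
    have := dp.add dt
    rwa [show ps.length - pathCount ps + (t.length - pathCount t) = a₀ + 1 - (a₀ + 1) by omega,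
      show pathCount ps + pathCount t = a₀ + 1 by omega] at this

/-! ### Explicit decompositions -/

/-- Adjacency in the complete bipartite graph on `ℕ` whose first part is `{0, …, a - 1}`. -/
def bipAdj (a x y : ℕ) : Bool := decide (x < a) != decide (y < a)

/-- Adjacency of distinct numbers at least one of which is less than `a`. -/
def joinAdj (a x y : ℕ) : Bool := x != y && (decide (x < a) || decide (y < a))

/-- The complete bipartite graph on `a + b` vertices with the first `a` of them as one part. -/
def bipFin (a b : ℕ) : SimpleGraph (Fin (a + b)) where
  Adj x y := bipAdj a x y = true
  symm := ⟨fun x y h => by rw [bipAdj, bne_iff_ne] at h ⊢; exact h.symm⟩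
  loopless := ⟨fun _ h => by simp [bipAdj] at h⟩

/-- The complete graph on `a + b` vertices without the edges between the last `b` of them. -/
def joinFin (a b : ℕ) : SimpleGraph (Fin (a + b)) where
  Adj x y := joinAdj a x y = true
  symm := ⟨fun x y h => by
    simp only [joinAdj, Bool.and_eq_true, bne_iff_ne, Bool.or_eq_true] at h ⊢
    exact ⟨h.1.symm, h.2.symm⟩⟩
  loopless := ⟨fun _ h => by simp [joinAdj] at h⟩

theorem top_adj_iff {n : ℕ} (x y : Fin n) :
    (⊤ : SimpleGraph (Fin n)).Adj x y ↔ ((x : ℕ) != (y : ℕ)) = true := by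
  simp [Fin.ext_iff]

theorem bipFin_adj (a b : ℕ) (x y : Fin (a + b)) : (bipFin a b).Adj x y ↔ bipAdj a x y = true :=
  Iff.rfl

theorem joinFin_adj (a b : ℕ) (x y : Fin (a + b)) :
    (joinFin a b).Adj x y ↔ joinAdj a x y = true :=
  Iff.rfl

/-- The decomposition used in `full_bip_eight_four`, divided into swaps. -/
def bipEightFourSwaps : List (List (List (List ℕ))) :=
  [[[[19, 14, 21, 12, 17, 6, 23, 8], [23, 4, 19, 10, 21, 0, 17, 14], [10, 17, 8, 21, 2, 19, 0,
  23], [23, 12, 19, 6, 21, 4, 17, 2]], [[0, 21, 8, 17, 14, 19, 2, 23, 10], [0, 17, 12, 21, 6, 23,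
  8, 19, 10], [6, 19, 0, 23, 4, 21, 10, 17], [21, 2, 17, 4, 19, 12, 23, 14]], [[8, 17, 4, 21, 2,
  19, 14, 23, 6], [14, 21, 12, 23, 8, 19, 10, 17], [12, 19, 4, 23, 0, 17, 6, 21, 8], [6, 19, 0,
  21, 10, 23, 2, 17, 12]], [[6, 17, 0, 23, 12, 19, 14, 21, 10], [12, 21, 2, 17, 14, 23, 6, 19, 4],
  [4, 17, 10, 23, 8, 19, 0, 21, 6], [10, 19, 2, 23, 4, 21, 8, 17, 12]]], [[[18, 15, 20, 13, 16, 7,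
  22, 9], [22, 5, 18, 11, 20, 1, 16, 15], [11, 16, 9, 20, 3, 18, 1, 22], [22, 13, 18, 7, 20, 5,
  16, 3]], [[1, 20, 9, 16, 15, 18, 3, 22, 11], [1, 16, 13, 20, 7, 22, 9, 18, 11], [7, 18, 1, 22,
  5, 20, 11, 16], [20, 3, 16, 5, 18, 13, 22, 15]], [[9, 16, 5, 20, 3, 18, 15, 22, 7], [15, 20, 13,
  22, 9, 18, 11, 16], [13, 18, 5, 22, 1, 16, 7, 20, 9], [7, 18, 1, 20, 11, 22, 3, 16, 13]], [[7,
  16, 1, 22, 13, 18, 15, 20, 11], [13, 20, 3, 16, 15, 22, 7, 18, 5], [5, 16, 11, 22, 9, 18, 1, 20,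
  7], [11, 18, 3, 22, 5, 20, 9, 16, 13]]]]

theorem full_bip_eight_four :
    Full ((bipFin 8 4).tensorProduct (⊤ : SimpleGraph (Fin 2))) 1 :=
  full_of_certifiesFull (a := 12) (b := 2) (f := bipAdj 8) (h := (· != ·))
    (gs := bipEightFourSwaps) (by decide +kernel) (by norm_num) (bipFin_adj 8 4) top_adj_iff

/-- The decomposition used in `full_nine`, divided into swaps. -/
def nineSwaps : List (List (List (List ℕ))) :=
  [[[[3, 8, 17, 2, 15, 16, 13, 10], [9, 12, 11, 16, 5, 10, 1, 4], [15, 12, 5, 6, 1, 14, 3, 0]],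
  [[0, 15, 16, 11, 12, 5, 10, 3], [10, 13, 16, 5, 6, 1, 4, 9, 12], [12, 15, 2, 17, 8, 3, 14, 1,
  10]], [[1, 10, 3, 8, 17, 2, 15, 12, 5], [13, 16, 11, 12, 9, 4, 1, 6, 5], [1, 14, 3, 0, 15, 16,
  5, 10, 13]]], [[[9, 6, 3, 4, 15, 10, 7, 14], [10, 17, 4, 7, 16, 1, 2, 9], [14, 5, 8, 1, 12, 7,
  2, 11]], [[17, 10, 7, 14, 9, 6, 3, 4], [8, 1, 16, 7, 2, 9, 10, 15, 4], [4, 7, 12, 1, 2, 11, 14,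
  5, 8]], [[8, 5, 14, 7, 12, 1, 2, 9, 6], [14, 11, 2, 7, 10, 15, 4, 3, 6], [14, 9, 10, 17, 4, 7,
  16, 1, 8]]], [[[0, 7, 8, 11, 6, 13, 2, 5], [9, 0, 13, 14, 17, 12, 3, 16], [13, 4, 11, 0, 17, 6,
  15, 8]], [[15, 8, 13, 4, 11, 0, 17, 12, 3], [15, 6, 17, 14, 13, 0, 9, 16, 3], [7, 0, 5, 2, 13,
  6, 11, 8]], [[7, 0, 13, 14, 17, 6, 11, 8, 15], [15, 6, 13, 2, 5, 0, 17, 12, 3], [7, 8, 13, 4,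
  11, 0, 9, 16, 3]]]]

theorem full_nine :
    Full ((⊤ : SimpleGraph (Fin 9)).tensorProduct (⊤ : SimpleGraph (Fin 2))) 1 :=
  full_of_certifiesFull (a := 9) (b := 2) (f := (· != ·)) (h := (· != ·))
    (gs := nineSwaps) (by decide +kernel) (by norm_num) top_adj_iff top_adj_iff

/-- The decomposition used in `full_five_star`, divided into swaps. -/
def fiveStarSwaps : List (List (List (List ℕ))) :=
  [[[[14, 0, 8, 3, 11, 12, 5, 6], [1, 6, 11, 0, 5, 9, 8, 12], [0, 4, 12, 7, 9, 1, 3, 10], [2, 3,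
  7, 0, 13, 9, 4, 6], [6, 13, 3, 14, 9, 2, 12, 10]], [[7, 9, 14, 0, 13, 6, 1, 3], [2, 12, 5, 6,
  11, 3, 10, 0, 8], [5, 0, 11, 12, 10, 6, 2, 9], [2, 3, 14, 6, 4, 12, 1, 9, 8], [8, 3, 13, 9, 4,
  0, 7, 12]], [[4, 9, 13, 6, 11, 12, 2, 3, 14], [8, 9, 2, 6, 1, 12, 10, 0, 14], [8, 12, 5, 9, 1,
  3, 11, 0, 4], [9, 7, 0, 13, 3, 10, 6, 14], [6, 4, 12, 7, 3, 8, 0, 5]], [[6, 1, 12, 11, 3, 2, 9,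
  5, 0], [5, 12, 8, 9, 13, 0, 10, 6], [2, 6, 13, 3, 14, 0, 7, 9, 4], [6, 14, 9, 1, 3, 10, 12, 4,
  0], [2, 12, 7, 3, 8, 0, 11, 6, 4]], [[8, 9, 4, 6, 13, 3, 11, 12, 2], [2, 6, 1, 3, 7, 0, 14, 9,
  13], [14, 6, 5, 12, 4, 0, 10, 3, 2], [13, 0, 5, 9, 7, 12, 8, 3, 14], [8, 0, 11, 6, 10, 12, 1, 9,
  2]]]]

theorem full_five_star :
    Full ((⊤ : SimpleGraph (Fin 5)).tensorProduct (bipFin 1 2)) 1 :=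
  full_of_certifiesFull (a := 5) (b := 3) (f := (· != ·)) (h := bipAdj 1)
    (gs := fiveStarSwaps) (by decide +kernel) (by norm_num) top_adj_iff (bipFin_adj 1 2)

/-- The decomposition used in `full_five`, divided into swaps. -/
def fiveSwaps : List (List (List (List ℕ))) :=
  [[[[5, 8, 1, 6, 3, 4, 7, 0], [7, 8, 5, 2, 1, 4, 9, 0], [0, 3, 8, 1, 2, 5, 6, 9], [3, 6, 1, 4, 9,
  2, 7, 8], [0, 5, 6, 9, 2, 7, 4, 3]], [[6, 3, 8, 7, 2, 1, 4, 9], [3, 8, 1, 2, 5, 0, 7, 4], [3, 4,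
  7, 0, 9, 2, 5, 6, 1], [1, 6, 5, 8, 7, 2, 9, 0, 3], [6, 9, 4, 1, 8, 5, 0, 3]], [[6, 9, 4, 7, 2,
  1, 8, 3], [8, 5, 0, 9, 6, 3, 4, 1, 2], [2, 5, 8, 7, 0, 3, 4, 1, 6], [8, 3, 0, 7, 4, 9, 2, 5, 6],
  [5, 0, 9, 2, 7, 8, 1, 6]], [[2, 7, 4, 1, 8, 5, 6, 3, 0], [3, 4, 1, 6, 5, 2, 9, 0, 7], [7, 8, 1,
  2, 5, 0, 9, 4, 3], [0, 3, 8, 7, 4, 9, 6, 1, 2], [2, 9, 6, 3, 8, 5, 0, 7]], [[5, 8, 3, 4, 7, 0,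
  9, 6, 1], [8, 3, 4, 7, 2, 1, 6, 5, 0], [6, 5, 2, 9, 4, 1, 8, 7, 0], [8, 5, 2, 1, 4, 9, 0, 3, 6],
  [5, 0, 3, 6, 9, 2, 7, 8, 1]]]]

theorem full_five :
    Full ((⊤ : SimpleGraph (Fin 5)).tensorProduct (⊤ : SimpleGraph (Fin 2))) 2 :=
  full_of_certifiesFull (a := 5) (b := 2) (f := (· != ·)) (h := (· != ·))
    (gs := fiveSwaps) (by decide +kernel) (by norm_num) top_adj_iff top_adj_iff

/-- The decomposition used in `full_eight`, divided into swaps. -/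
def eightSwaps : List (List (List (List ℕ))) :=
  [[[[5, 8, 11, 2, 1, 6, 13, 14], [2, 15, 8, 1, 12, 11, 6, 5], [12, 3, 14, 11, 0, 7, 4, 1]], [[15,
  8, 11, 6, 1, 12, 3, 14, 13], [13, 6, 5, 14, 11, 12, 1, 2, 15], [5, 8, 1, 4, 7, 0, 11, 2]], [[15,
  2, 5, 8, 11, 12, 1, 4, 7], [13, 14, 5, 6, 1, 2, 11, 0, 7], [13, 6, 11, 14, 3, 12, 1, 8, 15]]],
  [[[8, 3, 0, 5, 10, 7, 12, 15], [2, 9, 12, 3, 8, 1, 14, 7], [2, 7, 4, 3, 10, 9, 0, 13]], [[15,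
  12, 3, 10, 7, 2, 13, 0, 5], [5, 10, 9, 2, 7, 4, 3, 8, 15], [12, 7, 14, 1, 8, 3, 0, 9]], [[12, 7,
  14, 1, 8, 3, 0, 13, 2], [4, 7, 2, 9, 10, 3, 8, 15, 12], [4, 3, 12, 9, 0, 5, 10, 7, 2]]], [[[13,
  8, 11, 2, 5, 12, 15, 4], [4, 15, 6, 13, 8, 7, 0, 3], [3, 6, 9, 4, 11, 0, 15, 10]], [[10, 3, 6,
  9, 4, 11, 0, 15], [11, 8, 13, 6, 15, 4, 3, 0, 7], [11, 2, 5, 12, 15, 4, 13, 8, 7]], [[2, 11, 4,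
  15, 0, 7, 8, 13, 6], [6, 3, 0, 11, 8, 13, 4, 15, 10], [10, 3, 4, 9, 6, 15, 12, 5, 2]]], [[[5, 0,
  9, 4, 1, 10, 13, 14], [7, 10, 1, 14, 9, 6, 5, 8], [5, 10, 15, 2, 1, 6, 11, 12], [9, 2, 13, 4,
  11, 14, 7, 12], [14, 9, 10, 13, 0, 15, 6, 3]], [[1, 4, 11, 12, 5, 14, 3, 6, 9], [9, 12, 7, 8, 5,
  6, 15, 10, 1], [7, 10, 9, 4, 13, 2, 1, 14], [11, 14, 9, 0, 13, 10, 1, 6], [5, 0, 15, 2, 9, 14,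
  13, 10]], [[3, 6, 1, 4, 13, 2, 9, 14], [2, 1, 10, 7, 8, 5, 6, 15], [6, 9, 12, 7, 14, 1, 10, 15,
  0], [0, 13, 10, 9, 14, 5, 12, 11, 4], [4, 9, 0, 5, 10, 13, 14, 11, 6]], [[14, 3, 6, 11, 4, 1, 2,
  9, 12], [15, 6, 5, 14, 7, 10, 9, 0, 13], [13, 10, 1, 14, 11, 12, 5, 0, 15], [14, 9, 4, 13, 10,
  5, 8, 7, 12], [2, 13, 14, 9, 6, 1, 10, 15]], [[10, 13, 14, 7, 8, 5, 6, 9, 2], [5, 14, 9, 10, 1,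
  6, 11, 4, 13], [2, 15, 0, 5, 12, 7, 10, 1, 4], [13, 0, 9, 14, 3, 6, 15, 10, 5], [4, 9, 12, 11,
  14, 1, 2, 13, 10]]]]

theorem full_eight :
    Full ((⊤ : SimpleGraph (Fin 8)).tensorProduct (⊤ : SimpleGraph (Fin 2))) 2 :=
  full_of_certifiesFull (a := 8) (b := 2) (f := (· != ·)) (h := (· != ·))
    (gs := eightSwaps) (by decide +kernel) (by norm_num) top_adj_iff top_adj_iff

/-- The decomposition used in `full_twelve`, divided into swaps. -/
def twelveSwaps : List (List (List (List ℕ))) :=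
  [[[[17, 14, 5, 8, 23, 20, 9, 0], [17, 14, 19, 0, 5, 8, 7, 18], [9, 16, 13, 22, 1, 6, 11, 14]],
  [[13, 22, 1, 6, 11, 14, 9, 20, 23], [23, 8, 5, 14, 17, 0, 9, 16, 13], [7, 18, 17, 14, 19, 0, 5,
  8]], [[19, 14, 17, 18, 7, 8, 5, 0, 9], [19, 0, 17, 14, 9, 16, 13, 22, 1], [1, 6, 11, 14, 5, 8,
  23, 20, 9]]], [[[7, 18, 21, 22, 1, 10, 15, 4], [14, 13, 4, 17, 2, 9, 22, 3], [11, 8, 21, 0, 13,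
  16, 23, 18]], [[8, 21, 0, 13, 4, 7, 18, 23, 16], [16, 13, 14, 3, 22, 21, 18, 11, 8], [2, 9, 22,
  1, 10, 15, 4, 17]], [[10, 1, 22, 21, 18, 23, 16, 13, 4], [0, 13, 14, 3, 22, 9, 2, 17, 4], [10,
  15, 4, 7, 18, 11, 8, 21, 0]]], [[[2, 11, 0, 17, 10, 7, 12, 15], [23, 6, 15, 8, 3, 20, 9, 18],
  [7, 14, 1, 16, 21, 22, 3, 20]], [[17, 10, 7, 12, 15, 8, 3, 20, 9], [9, 18, 23, 6, 15, 2, 11, 0,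
  17], [16, 21, 22, 3, 20, 7, 14, 1]], [[8, 15, 2, 11, 0, 17, 10, 7, 14], [18, 23, 6, 15, 12, 7,
  20, 3, 8], [18, 9, 20, 3, 22, 21, 16, 1, 14]]], [[[17, 18, 3, 8, 7, 16, 19, 12], [15, 20, 1, 4,
  7, 2, 13, 22], [23, 0, 15, 2, 17, 8, 1, 12]], [[8, 3, 18, 17, 2, 13, 22, 15, 20], [20, 1, 12,
  23, 0, 15, 2, 7, 8], [12, 19, 16, 7, 4, 1, 8, 17]], [[3, 18, 17, 2, 13, 22, 15, 0, 23], [15, 2,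
  7, 16, 19, 12, 1, 8, 3], [23, 12, 17, 8, 7, 4, 1, 20, 15]]], [[[16, 19, 4, 13, 6, 3, 0, 15],
  [18, 5, 16, 23, 6, 21, 12, 9], [10, 23, 2, 13, 18, 5, 14, 3]], [[12, 21, 6, 3, 14, 5, 18, 9],
  [4, 13, 6, 23, 16, 15, 0, 3, 10], [4, 19, 16, 5, 18, 13, 2, 23, 10]], [[12, 21, 6, 23, 2, 13, 4,
  19, 16], [14, 5, 18, 13, 6, 3, 10, 23, 16], [12, 9, 18, 5, 16, 15, 0, 3, 14]]], [[[16, 3, 4, 1,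
  6, 5, 10, 15], [12, 3, 16, 11, 2, 5, 0, 23], [1, 8, 11, 6, 17, 20, 13, 10]], [[2, 11, 6, 17, 20,
  13, 10, 5], [10, 1, 8, 11, 16, 3, 12, 23, 0], [0, 5, 6, 1, 4, 3, 16, 15, 10]], [[10, 5, 2, 11,
  16, 3, 12, 23, 0], [10, 13, 20, 17, 6, 1, 4, 3, 16], [16, 15, 10, 1, 8, 11, 6, 5, 0]]], [[[11,
  20, 23, 14, 21, 4, 3, 0], [20, 11, 4, 23, 8, 19, 10, 13], [9, 4, 15, 18, 21, 12, 5, 10]], [[0,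
  11, 20, 23, 4, 9, 10, 19, 8], [0, 3, 4, 15, 18, 21, 14, 23, 8], [5, 12, 21, 4, 11, 20, 13, 10]],
  [[10, 13, 20, 11, 0, 3, 4, 21, 18], [18, 15, 4, 23, 8, 19, 10, 5, 12], [12, 21, 14, 23, 20, 11,
  4, 9, 10]]], [[[5, 20, 19, 12, 9, 6, 17, 22], [11, 22, 15, 6, 19, 2, 21, 4], [18, 1, 2, 5, 22,
  19, 8, 13]], [[18, 13, 8, 19, 22, 5, 2, 1], [15, 22, 17, 6, 19, 2, 21, 4, 11], [11, 22, 5, 20,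
  19, 12, 9, 6, 15]], [[21, 4, 11, 22, 19, 8, 13, 18, 1], [9, 6, 17, 22, 5, 20, 19, 2, 1], [9, 12,
  19, 6, 15, 22, 5, 2, 21]]], [[[12, 11, 22, 9, 6, 13, 0, 7], [8, 17, 4, 23, 2, 9, 14, 13], [21,
  14, 23, 10, 7, 22, 19, 0]], [[8, 13, 6, 9, 2, 23, 4, 17], [13, 14, 23, 10, 7, 22, 19, 0, 21],
  [13, 0, 7, 12, 11, 22, 9, 14, 21]], [[7, 22, 9, 14, 23, 4, 17, 8, 13], [9, 6, 13, 0, 19, 22, 11,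
  12, 7], [9, 2, 23, 10, 7, 0, 21, 14, 13]]], [[[9, 10, 21, 2, 19, 14, 7, 0], [17, 22, 7, 16, 1,
  14, 11, 12], [5, 6, 21, 16, 11, 18, 15, 20]], [[12, 11, 14, 1, 16, 7, 22, 17], [6, 21, 10, 9, 0,
  7, 14, 19, 2], [6, 5, 20, 15, 18, 11, 16, 21, 2]], [[21, 2, 19, 14, 11, 18, 15, 20, 5], [5, 6,
  21, 16, 7, 22, 17, 12, 11], [21, 10, 9, 0, 7, 14, 1, 16, 11]]], [[[19, 20, 7, 2, 1, 18, 3, 10],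
  [5, 16, 9, 4, 19, 6, 3, 12], [10, 17, 20, 1, 12, 15, 8, 21]], [[7, 20, 17, 10, 3, 18, 1, 2], [8,
  21, 10, 19, 6, 3, 12, 5, 16], [8, 15, 12, 1, 20, 19, 4, 9, 16]], [[12, 15, 8, 21, 10, 3, 6, 19,
  20], [20, 7, 2, 1, 12, 5, 16, 9, 4], [12, 3, 18, 1, 20, 17, 10, 19, 4]]]]

theorem full_twelve :
    Full ((⊤ : SimpleGraph (Fin 12)).tensorProduct (⊤ : SimpleGraph (Fin 2))) 2 :=
  full_of_certifiesFull (a := 12) (b := 2) (f := (· != ·)) (h := (· != ·))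
    (gs := twelveSwaps) (by decide +kernel) (by norm_num) top_adj_iff top_adj_iff

/-- The decomposition used in `full_four_star`, divided into swaps. -/
def fourStarSwaps : List (List (List (List ℕ))) :=
  [[[[4, 6, 11, 0, 7, 3, 2, 9], [4, 0, 8, 3, 11, 6, 5, 9], [10, 6, 1, 3, 7, 9, 5, 0]], [[8, 0, 11,
  6, 5, 9, 7, 3], [5, 0, 7, 3, 1, 6, 4, 9, 2], [5, 9, 4, 0, 10, 6, 11, 3, 2]], [[7, 3, 11, 0, 10,
  6, 4, 9, 2], [11, 6, 1, 3, 8, 0, 5, 9, 7], [11, 6, 5, 9, 4, 0, 7, 3, 2]]], [[[8, 9, 2, 6, 10, 3,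
  11, 0], [10, 0, 4, 6, 1, 9, 8, 3], [3, 1, 9, 7, 0, 5, 6, 2]], [[11, 0, 7, 9, 1, 6, 2, 3], [2, 6,
  4, 0, 10, 3, 8, 9, 1], [2, 9, 8, 0, 5, 6, 10, 3, 1]], [[2, 3, 10, 0, 4, 6, 1, 9, 8], [2, 6, 10,
  3, 8, 0, 7, 9, 1], [8, 9, 2, 6, 5, 0, 11, 3, 1]]]]

theorem full_four_star :
    Full ((⊤ : SimpleGraph (Fin 4)).tensorProduct (bipFin 1 2)) 2 :=
  full_of_certifiesFull (a := 4) (b := 3) (f := (· != ·)) (h := bipAdj 1)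
    (gs := fourStarSwaps) (by decide +kernel) (by norm_num) top_adj_iff (bipFin_adj 1 2)

/-- The decomposition used in `full_four_three`, divided into swaps. -/
def fourThreeSwaps : List (List (List (List ℕ))) :=
  [[[[4, 2, 3, 11, 1, 5, 9, 8], [0, 11, 4, 2, 9, 5, 10, 8], [6, 5, 0, 10, 2, 7, 9, 4]], [[8, 10,
  0, 11, 4, 2, 9, 5, 1], [8, 4, 9, 5, 10, 2, 3, 11, 1], [7, 2, 4, 6, 5, 0, 8, 9]], [[8, 10, 5, 0,
  11, 4, 2, 9, 7], [8, 9, 5, 6, 4, 2, 3, 11, 1], [7, 2, 10, 0, 8, 4, 9, 5, 1]]], [[[6, 4, 9, 8, 3,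
  7, 0, 11], [1, 8, 0, 4, 11, 3, 7, 9], [8, 1, 6, 5, 7, 0, 10, 3]], [[1, 8, 3, 7, 5, 6, 4, 0, 10],
  [10, 3, 8, 9, 7, 0, 11, 6, 1], [9, 1, 8, 0, 7, 3, 11, 4]], [[10, 0, 7, 5, 6, 11, 3, 8, 9], [6,
  1, 8, 3, 7, 0, 11, 4, 9], [10, 3, 7, 9, 1, 8, 0, 4, 6]]], [[[2, 9, 1, 3, 10, 6, 11, 7], [10, 5,
  7, 11, 1, 3, 2, 6], [5, 1, 6, 2, 10, 8, 4, 0]], [[7, 5, 1, 6, 2, 10, 8, 4, 0], [7, 11, 1, 3, 2,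
  6, 10, 5, 0], [3, 1, 9, 2, 7, 11, 6, 10]], [[3, 10, 2, 6, 1, 5, 0, 4, 8], [9, 2, 6, 10, 5, 7,
  11, 1, 3], [8, 10, 6, 11, 7, 2, 3, 1, 9]]]]

theorem full_four_three :
    Full ((⊤ : SimpleGraph (Fin 4)).tensorProduct (⊤ : SimpleGraph (Fin 3))) 2 :=
  full_of_certifiesFull (a := 4) (b := 3) (f := (· != ·)) (h := (· != ·))
    (gs := fourThreeSwaps) (by decide +kernel) (by norm_num) top_adj_iff top_adj_iff

/-- The decomposition used in `full_three_three`, divided into swaps. -/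
def threeThreeSwaps : List (List (List (List ℕ))) :=
  [[[[7, 0, 4, 8, 3, 1, 6, 2], [5, 6, 4, 8, 0, 7, 3, 1], [3, 8, 1, 6, 5, 0, 7, 2]], [[4, 8, 3, 1,
  6, 2, 7, 0, 5], [4, 0, 7, 2, 3, 8, 1, 6, 5], [0, 7, 3, 1, 5, 6, 4, 8]], [[2, 6, 5, 1, 3, 7, 0,
  8, 4], [5, 6, 1, 3, 8, 4, 0, 7, 2], [4, 6, 1, 8, 3, 2, 7, 0, 5]]], [[[2, 6, 4, 8, 0, 5, 1, 3],
  [7, 5, 0, 4, 2, 6, 1, 3], [6, 5, 7, 2, 4, 0, 8, 1]], [[3, 1, 8, 4, 0, 5, 6, 2], [3, 7, 5, 1, 6,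
  2, 4, 0, 8], [3, 1, 6, 4, 2, 7, 5, 0, 8]], [[7, 5, 0, 4, 6, 2, 3, 1, 8], [3, 1, 6, 5, 0, 8, 4,
  2, 7], [3, 7, 5, 1, 6, 2, 4, 0, 8]]], [[[5, 7, 0, 8, 3, 2, 4, 6], [2, 4, 0, 5, 1, 8, 3, 7], [1,
  8, 4, 6, 2, 3, 7, 5]], [[0, 4, 2, 7, 3, 8, 1, 5], [0, 7, 5, 6, 4, 2, 3, 8, 1], [1, 5, 7, 3, 2,
  6, 4, 8, 0]], [[0, 7, 5, 1, 8, 3, 2, 4, 6], [0, 8, 3, 7, 2, 4, 6, 5, 1], [1, 8, 4, 0, 5, 7, 3,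
  2, 6]]]]

theorem full_three_three :
    Full ((⊤ : SimpleGraph (Fin 3)).tensorProduct (⊤ : SimpleGraph (Fin 3))) 4 :=
  full_of_certifiesFull (a := 3) (b := 3) (f := (· != ·)) (h := (· != ·))
    (gs := threeThreeSwaps) (by decide +kernel) (by norm_num) top_adj_iff top_adj_iff

/-- The decomposition used in `full_six`, divided into swaps. -/
def sixSwaps : List (List (List (List ℕ))) :=
  [[[[11, 8, 3, 4, 1, 10, 5, 6], [10, 5, 2, 9, 4, 3, 6, 1], [8, 1, 2, 9, 10, 7, 0, 3]], [[0, 7,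
  10, 5, 2, 1, 6, 3], [6, 5, 10, 1, 8, 3, 4, 9, 2], [6, 11, 8, 3, 4, 1, 10, 9, 2]], [[6, 1, 10, 5,
  2, 9, 4, 3, 8], [0, 7, 10, 9, 2, 1, 8, 3, 6], [0, 3, 4, 1, 10, 5, 6, 11, 8]]], [[[10, 5, 6, 9,
  4, 11, 0, 3], [0, 9, 10, 3, 4, 11, 6, 5], [0, 9, 4, 1, 6, 11, 8, 7]], [[10, 9, 0, 5, 6, 1, 4,
  11, 8], [8, 7, 0, 11, 6, 9, 4, 3, 10], [9, 4, 11, 6, 5, 10, 3, 0]], [[7, 8, 11, 6, 9, 4, 3, 0,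
  5], [5, 6, 1, 4, 11, 0, 9, 10, 3], [3, 10, 5, 6, 11, 4, 9, 0, 7]]], [[[3, 6, 9, 2, 1, 4, 7, 10],
  [7, 4, 1, 10, 3, 0, 5, 2], [2, 1, 8, 7, 10, 9, 0, 11]], [[5, 0, 3, 10, 1, 8, 7, 2, 9], [9, 6, 3,
  10, 7, 4, 1, 2, 5], [4, 7, 10, 9, 0, 11, 2, 1]], [[9, 6, 3, 10, 7, 4, 1, 2, 5], [3, 0, 11, 2, 7,
  4, 1, 10, 9], [3, 10, 7, 8, 1, 2, 9, 0, 5]]], [[[1, 8, 5, 0, 11, 4, 7, 2], [10, 1, 6, 3, 8, 5,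
  2, 7], [6, 5, 8, 11, 2, 7, 0, 9]], [[10, 1, 8, 5, 2, 7, 4, 11, 0], [10, 7, 2, 11, 8, 5, 6, 9,
  0], [7, 0, 5, 8, 3, 6, 1, 2]], [[1, 10, 7, 2, 11, 8, 5, 0, 9], [9, 6, 5, 8, 1, 2, 7, 4, 11], [1,
  6, 3, 8, 5, 2, 7, 0, 11]]], [[[4, 3, 6, 9, 10, 5, 8, 11], [11, 2, 5, 0, 7, 8, 1, 6], [9, 4, 7,
  8, 3, 0, 11, 2]], [[0, 3, 6, 1, 8, 7, 4, 11, 2], [2, 11, 6, 9, 10, 5, 8, 7, 0], [9, 4, 3, 8, 11,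
  0, 5, 2]], [[4, 3, 0, 7, 8, 5, 2, 11, 6], [0, 11, 2, 9, 6, 3, 8, 7, 4], [6, 1, 8, 11, 4, 9, 10,
  5, 0]]]]

theorem full_six :
    Full ((⊤ : SimpleGraph (Fin 6)).tensorProduct (⊤ : SimpleGraph (Fin 2))) 4 :=
  full_of_certifiesFull (a := 6) (b := 2) (f := (· != ·)) (h := (· != ·))
    (gs := sixSwaps) (by decide +kernel) (by norm_num) top_adj_iff top_adj_iff

/-- The decomposition used in `full_seven`, divided into swaps. -/
def sevenSwaps : List (List (List (List ℕ))) :=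
  [[[[1, 4, 3, 6, 11, 0, 7, 2], [9, 4, 11, 0, 13, 6, 5, 10], [8, 3, 6, 1, 10, 7, 2, 5]], [[8, 3,
  6, 13, 0, 7, 2, 5], [2, 1, 4, 9, 10, 5, 6, 11, 0], [2, 7, 10, 1, 6, 3, 4, 11, 0]], [[7, 10, 1,
  4, 11, 0, 13, 6, 5], [7, 2, 5, 10, 9, 4, 3, 6, 1], [5, 8, 3, 6, 11, 0, 7, 2, 1]]], [[[7, 12, 11,
  4, 13, 10, 9, 2], [4, 9, 6, 5, 2, 13, 0, 3], [12, 11, 2, 5, 6, 13, 4, 7]], [[3, 0, 13, 6, 5, 2,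
  7, 4], [5, 2, 9, 10, 13, 4, 11, 12, 7], [7, 12, 11, 2, 13, 4, 9, 6, 5]], [[9, 2, 5, 6, 13, 4, 7,
  12, 11], [5, 2, 11, 4, 3, 0, 13, 10, 9], [11, 12, 7, 2, 13, 4, 9, 6, 5]]], [[[6, 1, 8, 3, 0, 5,
  10, 13], [3, 12, 9, 0, 13, 2, 11, 8], [6, 9, 12, 5, 8, 1, 10, 3]], [[6, 13, 10, 1, 8, 5, 0, 3,
  12], [6, 3, 8, 11, 2, 13, 0, 9, 12], [10, 5, 12, 9, 6, 1, 8, 3]], [[6, 3, 0, 5, 8, 1, 10, 13,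
  2], [6, 1, 8, 3, 10, 5, 12, 9, 0], [2, 11, 8, 3, 12, 9, 6, 13, 0]]], [[[0, 11, 12, 5, 8, 7, 4,
  3], [9, 6, 11, 2, 1, 10, 3, 12], [7, 10, 13, 8, 1, 6, 5, 0]], [[13, 10, 3, 12, 9, 6, 11, 0, 7],
  [7, 4, 3, 0, 5, 6, 1, 8, 13], [5, 12, 11, 2, 1, 10, 7, 8]], [[6, 5, 8, 13, 10, 3, 12, 11, 2],
  [2, 1, 10, 7, 0, 11, 6, 9, 12], [12, 5, 0, 3, 4, 7, 8, 1, 6]]], [[[4, 1, 12, 9, 2, 5, 0, 7],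
  [11, 8, 13, 0, 9, 2, 1, 6], [3, 12, 7, 8, 11, 4, 9, 10]], [[12, 3, 10, 9, 4, 1, 6, 11, 8], [8,
  11, 4, 7, 0, 5, 2, 9, 12], [12, 7, 8, 13, 0, 9, 2, 1]], [[8, 13, 0, 7, 4, 1, 2, 9, 10], [0, 9,
  4, 11, 8, 7, 12, 3, 10], [8, 11, 6, 1, 12, 9, 2, 5, 0]]], [[[4, 1, 12, 5, 10, 7, 2, 13], [10, 5,
  8, 7, 12, 3, 6, 13], [11, 6, 9, 0, 5, 12, 1, 4]], [[13, 6, 3, 12, 7, 8, 5, 0, 9], [13, 10, 5,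
  12, 1, 4, 11, 6, 9], [7, 2, 13, 4, 1, 12, 5, 10]], [[8, 5, 0, 9, 6, 3, 12, 1, 4], [6, 11, 4, 13,
  10, 5, 12, 7, 8], [6, 13, 2, 7, 10, 5, 12, 1, 4]]], [[[7, 4, 13, 8, 11, 2, 1, 10], [9, 4, 3, 8,
  1, 12, 11, 0], [13, 8, 7, 0, 3, 10, 9, 2]], [[9, 2, 11, 8, 3, 0, 7, 10, 1], [9, 10, 3, 4, 7, 8,
  13, 2, 1], [0, 9, 4, 13, 8, 1, 12, 11]], [[7, 0, 9, 4, 13, 2, 1, 8, 11], [11, 12, 1, 10, 3, 4,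
  7, 8, 13], [7, 10, 9, 2, 11, 0, 3, 8, 13]]]]

theorem full_seven :
    Full ((⊤ : SimpleGraph (Fin 7)).tensorProduct (⊤ : SimpleGraph (Fin 2))) 4 :=
  full_of_certifiesFull (a := 7) (b := 2) (f := (· != ·)) (h := (· != ·))
    (gs := sevenSwaps) (by decide +kernel) (by norm_num) top_adj_iff top_adj_iff

/-- The decomposition used in `full_bip_four_five`, divided into swaps. -/
def bipFourFiveSwaps : List (List (List (List ℕ))) :=
  [[[[17, 2, 11, 0, 13, 4, 9, 6], [13, 0, 11, 4, 17, 6, 15, 2], [9, 2, 11, 6, 13, 4, 15, 0], [11,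
  4, 9, 2, 17, 0, 15, 6], [15, 4, 17, 0, 9, 6, 13, 2]], [[15, 0, 13, 6, 11, 4, 17, 2], [11, 2, 15,
  4, 9, 0, 17, 6], [11, 2, 9, 6, 17, 0, 13, 4], [17, 4, 15, 6, 13, 2, 9, 0, 11], [11, 0, 15, 6, 9,
  4, 13, 2, 17]], [[17, 2, 13, 4, 11, 0, 15, 6], [15, 6, 13, 2, 11, 4, 9, 0, 17], [15, 2, 9, 6,
  17, 4, 13, 0, 11], [11, 6, 13, 0, 9, 2, 15, 4, 17], [0, 17, 2, 11, 6, 9, 4, 15]], [[13, 2, 17,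
  4, 9, 0, 15, 6, 11], [11, 6, 17, 4, 13, 2, 15, 0, 9], [15, 2, 11, 0, 13, 6, 9, 4], [13, 6, 9, 2,
  17, 0, 11, 4, 15], [9, 2, 11, 4, 13, 0, 17, 6, 15]], [[13, 2, 9, 0, 17, 6, 11, 4, 15], [13, 6,
  11, 0, 15, 2, 17, 4, 9], [11, 4, 13, 2, 9, 6, 15, 0, 17], [17, 4, 9, 6, 13, 0, 11, 2, 15], [9,
  0, 13, 4, 15, 6, 17, 2, 11]]], [[[16, 3, 10, 1, 12, 5, 8, 7], [12, 1, 10, 5, 16, 7, 14, 3], [8,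
  3, 10, 7, 12, 5, 14, 1], [10, 5, 8, 3, 16, 1, 14, 7], [14, 5, 16, 1, 8, 7, 12, 3]], [[14, 1, 12,
  7, 10, 5, 16, 3], [10, 3, 14, 5, 8, 1, 16, 7], [10, 3, 8, 7, 16, 1, 12, 5], [16, 5, 14, 7, 12,
  3, 8, 1, 10], [10, 1, 14, 7, 8, 5, 12, 3, 16]], [[16, 3, 12, 5, 10, 1, 14, 7], [14, 7, 12, 3,
  10, 5, 8, 1, 16], [14, 3, 8, 7, 16, 5, 12, 1, 10], [10, 7, 12, 1, 8, 3, 14, 5, 16], [1, 16, 3,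
  10, 7, 8, 5, 14]], [[12, 3, 16, 5, 8, 1, 14, 7, 10], [10, 7, 16, 5, 12, 3, 14, 1, 8], [14, 3,
  10, 1, 12, 7, 8, 5], [12, 7, 8, 3, 16, 1, 10, 5, 14], [8, 3, 10, 5, 12, 1, 16, 7, 14]], [[12, 3,
  8, 1, 16, 7, 10, 5, 14], [12, 7, 10, 1, 14, 3, 16, 5, 8], [10, 5, 12, 3, 8, 7, 14, 1, 16], [16,
  5, 8, 7, 12, 1, 10, 3, 14], [8, 1, 12, 5, 14, 7, 16, 3, 10]]]]

theorem full_bip_four_five :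
    Full ((bipFin 4 5).tensorProduct (⊤ : SimpleGraph (Fin 2))) 2 :=
  full_of_certifiesFull (a := 9) (b := 2) (f := bipAdj 4) (h := (· != ·))
    (gs := bipFourFiveSwaps) (by decide +kernel) (by norm_num) (bipFin_adj 4 5) top_adj_iff

/-- The decomposition used in `full_bip_four_six`, divided into swaps. -/
def bipFourSixSwaps : List (List (List (List ℕ))) :=
  [[[[18, 5, 12, 7, 16, 3, 10, 1], [8, 7, 10, 5, 14, 3, 12, 1], [14, 7, 18, 3, 8, 5, 16, 1]],
  [[12, 5, 8, 1, 14, 3, 18, 7, 16], [16, 5, 14, 7, 8, 3, 10, 1, 12], [10, 7, 12, 3, 16, 1, 18,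
  5]], [[18, 3, 16, 7, 10, 5, 14, 1, 8], [18, 1, 10, 3, 8, 5, 12, 7, 14], [8, 7, 18, 5, 16, 1, 12,
  3, 14]]], [[[2, 11, 6, 19, 4, 17, 0, 9], [19, 0, 15, 4, 13, 6, 17, 2], [4, 11, 0, 13, 2, 15, 6,
  9]], [[11, 2, 15, 0, 13, 6, 19, 4, 9], [13, 2, 17, 6, 9, 0, 11, 4], [11, 6, 15, 4, 17, 0, 19, 2,
  9]], [[19, 4, 11, 2, 17, 0, 13, 6, 15], [19, 6, 9, 0, 15, 2, 13, 4, 17], [15, 4, 9, 2, 19, 0,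
  11, 6, 17]]]]

theorem full_bip_four_six :
    Full ((bipFin 4 6).tensorProduct (⊤ : SimpleGraph (Fin 2))) 1 :=
  full_of_certifiesFull (a := 10) (b := 2) (f := bipAdj 4) (h := (· != ·))
    (gs := bipFourSixSwaps) (by decide +kernel) (by norm_num) (bipFin_adj 4 6) top_adj_iff

/-- The decomposition used in `full_bip_four_seven`, divided into swaps. -/
def bipFourSevenSwaps : List (List (List (List ℕ))) :=
  [[[[4, 15, 6, 17, 0, 19, 2, 11], [9, 4, 13, 6, 17, 2, 15, 0], [21, 6, 9, 2, 15, 4, 11, 0]],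
  [[17, 6, 9, 0, 19, 2, 15, 4, 13], [17, 0, 11, 4, 9, 2, 15, 6, 13], [2, 11, 4, 15, 0, 21, 6,
  17]], [[11, 0, 21, 6, 13, 4, 15, 2, 17], [19, 2, 9, 6, 17, 0, 15, 4, 11], [17, 6, 15, 2, 11, 4,
  9, 0, 19]]], [[[21, 0, 9, 6, 13, 4, 19, 2], [13, 2, 21, 4, 19, 6, 11, 0], [6, 21, 4, 17, 2, 13,
  0, 19], [6, 15, 0, 17, 4, 9, 2, 11]], [[17, 4, 19, 2, 13, 0, 9, 6, 11], [15, 0, 11, 2, 17, 4,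
  21, 6], [11, 6, 19, 4, 21, 2, 13, 0, 17], [19, 6, 13, 4, 9, 2, 21, 0]], [[15, 6, 9, 4, 13, 2,
  17, 0], [13, 0, 11, 6, 21, 4, 19, 2, 9], [9, 0, 21, 2, 13, 6, 19, 4, 17], [13, 0, 19, 6, 11, 2,
  21, 4, 17]], [[13, 6, 11, 2, 9, 0, 21, 4, 17], [9, 4, 17, 2, 19, 6, 15, 0, 13], [9, 6, 19, 4,
  21, 2, 13, 0, 11], [17, 0, 19, 4, 13, 2, 21, 6, 11]]], [[[5, 14, 7, 16, 1, 18, 3, 10], [8, 5,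
  12, 7, 16, 3, 14, 1], [20, 7, 8, 3, 14, 5, 10, 1]], [[16, 7, 8, 1, 18, 3, 14, 5, 12], [16, 1,
  10, 5, 8, 3, 14, 7, 12], [3, 10, 5, 14, 1, 20, 7, 16]], [[10, 1, 20, 7, 12, 5, 14, 3, 16], [18,
  3, 8, 7, 16, 1, 14, 5, 10], [16, 7, 14, 3, 10, 5, 8, 1, 18]]], [[[20, 1, 8, 7, 12, 5, 18, 3],
  [12, 3, 20, 5, 18, 7, 10, 1], [7, 20, 5, 16, 3, 12, 1, 18], [7, 14, 1, 16, 5, 8, 3, 10]], [[16,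
  5, 18, 3, 12, 1, 8, 7, 10], [14, 1, 10, 3, 16, 5, 20, 7], [10, 7, 18, 5, 20, 3, 12, 1, 16], [18,
  7, 12, 5, 8, 3, 20, 1]], [[14, 7, 8, 5, 12, 3, 16, 1], [12, 1, 10, 7, 20, 5, 18, 3, 8], [8, 1,
  20, 3, 12, 7, 18, 5, 16], [12, 1, 18, 7, 10, 3, 20, 5, 16]], [[12, 7, 10, 3, 8, 1, 20, 5, 16],
  [8, 5, 16, 3, 18, 7, 14, 1, 12], [8, 7, 18, 5, 20, 3, 12, 1, 10], [16, 1, 18, 5, 12, 3, 20, 7,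
  10]]]]

theorem full_bip_four_seven :
    Full ((bipFin 4 7).tensorProduct (⊤ : SimpleGraph (Fin 2))) 2 :=
  full_of_certifiesFull (a := 11) (b := 2) (f := bipAdj 4) (h := (· != ·))
    (gs := bipFourSevenSwaps) (by decide +kernel) (by norm_num) (bipFin_adj 4 7) top_adj_iff

/-- The decomposition used in `full_eight_cycle`, divided into swaps. -/
def eightCycleSwaps : List (List (List (List ℕ))) :=
  [[[[7, 21, 18, 24, 2, 17, 23, 8], [24, 10, 21, 14, 28, 23, 13, 30], [7, 28, 19, 9, 30, 25, 18,
  0]], [[25, 30, 13, 23, 17, 2, 24, 18, 21], [21, 14, 28, 23, 8, 7, 0, 18, 25], [19, 9, 30, 24,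
  10, 21, 7, 28]], [[30, 25, 18, 0, 7, 28, 23, 17, 2], [10, 24, 18, 21, 7, 8, 23, 13, 30], [2, 24,
  30, 9, 19, 28, 14, 21, 10]]], [[[15, 17, 11, 25, 6, 20, 14, 9], [25, 10, 4, 19, 24, 11, 12, 3],
  [28, 6, 16, 3, 4, 18, 20, 26]], [[15, 9, 14, 20, 26, 28, 6, 16, 3], [15, 17, 11, 25, 6, 20, 18,
  4, 3], [24, 19, 4, 10, 25, 3, 12, 11]], [[18, 4, 19, 24, 11, 17, 15, 9, 14], [10, 4, 3, 25, 6,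
  28, 26, 20, 14], [10, 25, 11, 12, 3, 16, 6, 20, 18]]], [[[28, 18, 9, 6, 12, 27, 20, 3], [11, 16,
  7, 29, 10, 5, 22, 28], [24, 15, 4, 31, 8, 14, 29, 3]], [[11, 28, 3, 20, 27, 12, 6, 9, 18], [18,
  28, 22, 5, 10, 29, 7, 16, 11], [15, 4, 31, 8, 14, 29, 3, 24]], [[16, 7, 29, 14, 8, 31, 4, 15,
  24], [20, 3, 29, 10, 5, 22, 28, 11, 16], [20, 27, 12, 6, 9, 18, 28, 3, 24]]], [[[11, 13, 22, 17,
  10, 1, 6, 0], [26, 0, 14, 1, 11, 20, 31, 13], [13, 2, 20, 15, 29, 26, 5, 18]], [[26, 13, 11, 0,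
  6, 1, 10, 17, 22], [26, 0, 14, 1, 11, 20, 2, 13, 22], [31, 20, 15, 29, 26, 5, 18, 13]], [[11, 0,
  14, 1, 10, 17, 22, 13, 26], [26, 29, 15, 20, 2, 13, 11, 1, 6], [11, 20, 31, 13, 18, 5, 26, 0,
  6]]], [[[12, 7, 24, 31, 9, 3, 21, 19], [6, 8, 22, 24, 14, 16, 31, 21], [27, 17, 26, 4, 22, 9, 2,
  16]], [[26, 17, 27, 16, 31, 24, 22, 4], [31, 21, 6, 8, 22, 9, 2, 16, 14], [14, 24, 7, 12, 19,
  21, 3, 9, 31]], [[12, 7, 24, 14, 16, 27, 17, 26, 4], [8, 22, 24, 31, 9, 3, 21, 19, 12], [8, 6,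
  21, 31, 16, 2, 9, 22, 4]]], [[[29, 2, 4, 30, 20, 7, 13, 27], [0, 23, 24, 6, 17, 7, 25, 22], [23,
  16, 30, 0, 15, 5, 2, 12]], [[6, 24, 23, 0, 22, 25, 7, 17], [4, 2, 5, 15, 0, 30, 20, 7, 13], [13,
  27, 29, 2, 12, 23, 16, 30, 4]], [[23, 24, 6, 17, 7, 25, 22, 0, 30], [23, 12, 2, 4, 30, 20, 7,
  13, 27], [27, 29, 2, 5, 15, 0, 23, 16, 30]]], [[[18, 1, 27, 28, 15, 16, 22, 29], [3, 8, 26, 21,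
  11, 4, 27, 5], [12, 26, 9, 23, 4, 14, 5, 31]], [[16, 15, 28, 27, 4, 11, 21, 26, 8], [16, 22, 29,
  18, 1, 27, 5, 3, 8], [5, 31, 12, 26, 9, 23, 4, 14]], [[21, 11, 4, 14, 5, 31, 12, 26, 8], [16,
  15, 28, 27, 4, 23, 9, 26, 21], [8, 3, 5, 27, 1, 18, 29, 22, 16]]], [[[8, 30, 12, 22, 1, 7, 9,
  27], [10, 20, 19, 1, 30, 21, 2, 28], [3, 17, 30, 5, 11, 29, 19, 13]], [[3, 13, 19, 1, 22, 12,
  30, 17], [29, 11, 5, 30, 1, 7, 9, 27, 8], [29, 19, 20, 10, 28, 2, 21, 30, 8]], [[10, 28, 2, 21,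
  30, 17, 3, 13, 19], [7, 1, 30, 5, 11, 29, 19, 20, 10], [7, 9, 27, 8, 30, 12, 22, 1, 19]]],
  [[[10, 12, 18, 8, 15, 1, 26, 16], [25, 15, 21, 27, 0, 19, 8, 2], [31, 1, 23, 5, 19, 25, 14, 17],
  [29, 23, 25, 31, 0, 10, 13, 6]], [[2, 25, 15, 1, 23, 5, 19, 8], [1, 26, 16, 10, 0, 19, 25, 31],
  [29, 6, 13, 10, 12, 18, 8, 15, 21], [21, 27, 0, 31, 17, 14, 25, 23, 29]], [[13, 6, 29, 23, 5,
  19, 25, 31, 0], [1, 23, 25, 15, 8, 18, 12, 10, 13], [1, 31, 17, 14, 25, 2, 8, 19, 0], [0, 10,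
  16, 26, 1, 15, 21, 27]], [[23, 1, 31, 0, 27, 21, 15, 8, 19], [23, 25, 15, 1, 26, 16, 10, 13, 6],
  [19, 0, 10, 12, 18, 8, 2, 25, 31], [31, 17, 14, 25, 19, 5, 23, 29, 6]]]]

theorem full_eight_cycle :
    Full ((⊤ : SimpleGraph (Fin 8)).tensorProduct (bipFin 2 2)) 1 :=
  full_of_certifiesFull (a := 8) (b := 4) (f := (· != ·)) (h := bipAdj 2)
    (gs := eightCycleSwaps) (by decide +kernel) (by norm_num) top_adj_iff (bipFin_adj 2 2)

/-- The decomposition used in `full_eight_three`, divided into swaps. -/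
def eightThreeSwaps : List (List (List (List ℕ))) :=
  [[[[17, 7, 23, 12, 22, 6, 1, 9], [8, 21, 16, 11, 4, 20, 7, 12], [21, 20, 0, 5, 1, 23, 18, 13]],
  [[0, 5, 1, 6, 22, 12, 7, 20], [4, 11, 16, 21, 8, 12, 23, 7, 17], [4, 20, 21, 13, 18, 23, 1, 9,
  17]], [[17, 7, 12, 23, 18, 13, 21, 20, 0], [0, 5, 1, 23, 7, 20, 4, 11, 16], [16, 21, 8, 12, 22,
  6, 1, 9, 17]]], [[[9, 13, 0, 7, 18, 17, 19, 23], [7, 3, 19, 14, 4, 23, 6, 5], [23, 3, 22, 15, 5,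
  9, 19, 0]], [[15, 5, 9, 23, 0, 19, 3, 22], [18, 7, 0, 13, 9, 19, 23, 6, 5], [5, 7, 3, 23, 4, 14,
  19, 17, 18]], [[3, 7, 0, 19, 9, 23, 6, 5, 15], [15, 22, 3, 19, 23, 0, 13, 9, 5], [3, 23, 4, 14,
  19, 17, 18, 7, 5]]], [[[15, 23, 10, 0, 16, 8, 22, 14], [10, 17, 4, 9, 14, 6, 13, 15], [8, 18,
  16, 20, 1, 21, 5, 10]], [[22, 14, 6, 13, 15, 23, 10, 17, 4], [22, 8, 16, 0, 10, 15, 14, 9, 4],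
  [21, 5, 10, 8, 18, 16, 20, 1]], [[16, 8, 10, 23, 15, 13, 6, 14, 22], [16, 20, 1, 21, 5, 10, 17,
  4, 9], [9, 14, 15, 10, 0, 16, 18, 8, 22]]], [[[9, 22, 18, 11, 3, 10, 2, 7], [11, 12, 5, 22, 2,
  21, 4, 6], [0, 4, 2, 13, 8, 19, 21, 17]], [[8, 13, 2, 4, 0, 17, 21, 19], [10, 2, 21, 4, 6, 11,
  18, 22, 9], [9, 7, 2, 22, 5, 12, 11, 3, 10]], [[17, 0, 4, 2, 10, 3, 11, 12, 5], [5, 22, 2, 13,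
  8, 19, 21, 4, 6], [17, 21, 2, 7, 9, 22, 18, 11, 6]]], [[[14, 10, 6, 2, 9, 20, 22, 0], [9, 16,
  23, 13, 20, 15, 4, 8], [8, 1, 15, 7, 21, 11, 13, 3]], [[11, 21, 7, 15, 1, 8, 3, 13, 23], [11,
  13, 20, 15, 4, 8, 9, 16, 23], [9, 20, 22, 0, 14, 10, 6, 2]], [[20, 22, 0, 14, 10, 6, 2, 9, 8],
  [3, 8, 1, 15, 7, 21, 11, 13, 20], [8, 4, 15, 20, 9, 16, 23, 13, 3]]], [[[15, 2, 3, 17, 22, 11,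
  0, 8], [11, 15, 19, 2, 18, 4, 12, 1], [11, 7, 14, 1, 3, 16, 12, 19]], [[17, 22, 11, 1, 12, 19,
  2, 3], [0, 8, 15, 11, 7, 14, 1, 3, 16], [16, 12, 4, 18, 2, 15, 19, 11, 0]], [[12, 19, 11, 1, 3,
  2, 15, 8, 0], [0, 11, 22, 17, 3, 16, 12, 1, 14], [12, 4, 18, 2, 19, 15, 11, 7, 14]]], [[[5, 16,
  2, 12, 20, 3, 14, 18], [5, 19, 6, 20, 10, 12, 17, 13], [14, 21, 10, 18, 1, 17, 6, 16]], [[1, 18,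
  10, 12, 20, 3, 14, 16, 5], [1, 17, 6, 20, 10, 21, 14, 18, 5], [16, 2, 12, 17, 13, 5, 19, 6]],
  [[1, 18, 14, 21, 10, 20, 12, 17, 13], [1, 17, 6, 20, 3, 14, 16, 5, 18], [13, 5, 19, 6, 16, 2,
  12, 10, 18]]]]

theorem full_eight_three :
    Full ((⊤ : SimpleGraph (Fin 8)).tensorProduct (⊤ : SimpleGraph (Fin 3))) 1 :=
  full_of_certifiesFull (a := 8) (b := 3) (f := (· != ·)) (h := (· != ·))
    (gs := eightThreeSwaps) (by decide +kernel) (by norm_num) top_adj_iff top_adj_iff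

/-- Swaps that complete the paths and the cycle in `fullFrom_sixteen` to a
decomposition. -/
def sixteenSwaps : List (List (List (List ℕ))) :=
  [[[[19, 22, 27, 16, 15, 20, 13, 28], [19, 30, 29, 14, 13, 6, 3, 16], [5, 22, 17, 12, 19, 0, 15,
  24]], [[6, 13, 20, 15, 0, 19, 16, 3], [24, 5, 22, 19, 28, 13, 14, 29, 30], [24, 15, 16, 27, 22,
  17, 12, 19, 30]], [[27, 16, 3, 6, 13, 28, 19, 30, 29], [5, 22, 19, 0, 15, 20, 13, 14, 29], [27,
  22, 17, 12, 19, 16, 15, 24, 5]]], [[[18, 7, 28, 17, 30, 15, 12, 25], [1, 18, 17, 0, 23, 24, 27,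
  10], [6, 23, 14, 1, 22, 3, 24, 31]], [[30, 15, 12, 25, 18, 7, 28, 17], [14, 1, 10, 27, 24, 31,
  6, 23, 0], [0, 17, 18, 1, 22, 3, 24, 23, 14]], [[28, 17, 30, 15, 12, 25, 18, 1, 22], [10, 27,
  24, 23, 0, 17, 18, 7, 28], [10, 1, 14, 23, 6, 31, 24, 3, 22]]], [[[10, 13, 30, 9, 28, 1, 8, 5],
  [10, 7, 16, 1, 26, 13, 4, 31], [19, 4, 11, 30, 25, 6, 29, 8]], [[5, 8, 19, 4, 11, 30, 13, 10],
  [8, 1, 16, 7, 10, 31, 4, 13, 26], [8, 29, 6, 25, 30, 9, 28, 1, 26]], [[16, 1, 28, 9, 30, 13, 10,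
  5, 8], [6, 25, 30, 11, 4, 13, 26, 1, 8], [6, 29, 8, 19, 4, 31, 10, 7, 16]]], [[[15, 8, 7, 2, 1,
  12, 31, 26], [1, 24, 19, 10, 17, 8, 23, 30], [8, 21, 10, 25, 4, 9, 20, 31], [26, 11, 20, 25, 2,
  5, 30, 3]], [[19, 10, 17, 8, 31, 12, 1, 24], [21, 10, 25, 2, 1, 30, 23, 8], [5, 30, 3, 26, 11,
  20, 9, 4, 25], [5, 2, 7, 8, 15, 26, 31, 20, 25]], [[21, 8, 23, 30, 5, 2, 25, 10], [12, 1, 30, 3,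
  26, 31, 20, 25, 4], [4, 9, 20, 11, 26, 15, 8, 7, 2], [2, 1, 24, 19, 10, 17, 8, 31, 12]], [[30,
  5, 2, 7, 8, 21, 10, 19, 24], [20, 31, 8, 15, 26, 3, 30, 1, 12], [20, 9, 4, 25, 10, 17, 8, 23,
  30], [12, 31, 26, 11, 20, 25, 2, 1, 24]]]]

theorem fullFrom_sixteen :
    FullFrom ((⊤ : SimpleGraph (Fin 16)).tensorProduct (⊤ : SimpleGraph (Fin 2))) 1 16 :=
  fullFrom_of_certifiesFullFrom (a := 16) (b := 2) (f := (· != ·)) (h := (· != ·))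
    (ps :=
      [[26, 9, 0, 29, 20, 27, 18, 11, 22], [30, 27, 6, 11, 2, 15, 18, 9, 10], [25, 26, 21, 6, 5,
      14, 11, 28, 27], [29, 22, 31, 28, 5, 18, 23, 4, 1], [18, 31, 16, 13, 22, 9, 12, 11, 0], [6,
      1, 20, 19, 26, 7, 22, 21, 24], [15, 22, 25, 8, 13, 0, 21, 30, 7], [3, 18, 29, 24, 11, 8, 27,
      12, 23], [11, 16, 5, 26, 17, 24, 7, 0, 31], [4, 3, 10, 29, 16, 9, 2, 17, 20], [17, 6, 15, 4,
      27, 14, 31, 2, 21], [28, 3, 0, 5, 12, 21, 4, 17, 14], [13, 18, 21, 16, 25, 14, 9, 6, 19],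
      [8, 3, 12, 29, 4, 7, 20, 23, 16], [2, 29, 26, 23, 28, 21, 14, 7, 12]])
    (s := [[5,20,3,14,19,2,13,24,9],[15,10,23,2,27,0,25,28]])
    (t := [[15,28,25,0,27,2,13,24,9],[15,10,23,2,19,14,3,20,5]])
    (gs := sixteenSwaps)
    (by decide +kernel) (by norm_num) top_adj_iff top_adj_iff

/-- Swaps that complete the paths and the cycle in `fullFrom_join_eight_eight` to a
decomposition. -/
def joinEightEightSwaps : List (List (List (List ℕ))) :=
  [[[[25, 8, 17, 14, 11, 30, 7, 12], [10, 9, 12, 31, 14, 25, 6, 17], [5, 28, 15, 0, 21, 2, 11,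
  26]], [[26, 11, 2, 21, 0, 15, 28, 5], [30, 11, 14, 17, 8, 25, 12, 9, 10], [10, 17, 6, 25, 14,
  31, 12, 7, 30]], [[8, 17, 6, 25, 12, 31, 14, 11, 26], [8, 25, 14, 17, 10, 9, 12, 7, 30], [26, 5,
  28, 15, 0, 21, 2, 11, 30]]], [[[19, 14, 23, 12, 21, 6, 31, 2], [31, 10, 7, 22, 15, 6, 5, 0],
  [20, 1, 12, 3, 18, 7, 2, 13]], [[14, 19, 2, 7, 18, 3, 12, 23], [1, 20, 13, 2, 31, 6, 15, 22, 7],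
  [7, 10, 31, 0, 5, 6, 21, 12, 1]], [[1, 20, 13, 2, 31, 6, 21, 12, 23], [5, 6, 15, 22, 7, 18, 3,
  12, 1], [5, 0, 31, 10, 7, 2, 19, 14, 23]]], [[[13, 26, 15, 8, 23, 2, 5, 22], [19, 6, 23, 4, 17,
  0, 3, 8], [0, 27, 6, 1, 22, 3, 16, 7]], [[3, 16, 7, 0, 17, 4, 23, 8, 15], [15, 26, 13, 22, 1, 6,
  27, 0, 3], [3, 22, 5, 2, 23, 6, 19, 8]], [[1, 6, 23, 8, 3, 16, 7, 0, 17], [15, 26, 13, 22, 5, 2,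
  23, 4, 17], [1, 22, 3, 0, 27, 6, 19, 8, 15]]], [[[18, 13, 30, 1, 24, 15, 4, 9], [26, 3, 4, 29,
  6, 13, 24, 7], [2, 27, 8, 31, 4, 19, 0, 25], [4, 13, 0, 29, 2, 17, 12, 27], [10, 13, 8, 1, 26,
  9, 16, 15]], [[31, 4, 15, 10, 13, 24, 1, 8], [7, 24, 15, 16, 9, 4, 3, 26], [9, 26, 1, 30, 13, 6,
  29, 0, 25], [25, 2, 27, 4, 19, 0, 13, 18, 9], [17, 12, 27, 8, 13, 4, 29, 2]], [[3, 26, 9, 18,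
  13, 10, 15, 4], [26, 7, 24, 13, 4, 31, 8, 1], [0, 25, 2, 29, 6, 13, 8, 27, 12], [0, 19, 4, 9,
  16, 15, 24, 1, 30], [30, 13, 0, 29, 4, 27, 2, 17, 12]], [[10, 13, 18, 9, 26, 1, 24, 15], [9, 16,
  15, 4, 29, 6, 13, 30, 1], [19, 4, 13, 0, 29, 2, 17, 12, 27], [27, 8, 13, 24, 7, 26, 3, 4, 9],
  [19, 0, 25, 2, 27, 4, 31, 8, 1]], [[12, 27, 8, 1, 24, 13, 6, 29, 4], [12, 17, 2, 27, 4, 13, 10,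
  15, 24], [24, 7, 26, 1, 30, 13, 8, 31, 4], [15, 16, 9, 26, 3, 4, 19, 0, 25], [25, 2, 29, 0, 13,
  18, 9, 4, 15]]]]

theorem fullFrom_join_eight_eight :
    FullFrom ((joinFin 8 8).tensorProduct (⊤ : SimpleGraph (Fin 2))) 1 8 :=
  fullFrom_of_certifiesFullFrom (a := 16) (b := 2) (f := joinAdj 8) (h := (· != ·))
    (ps :=
      [[0, 23, 10, 29, 12, 15, 18, 11, 6], [7, 4, 21, 8, 29, 14, 5, 10, 3], [5, 16, 1, 2, 9, 24,
      3, 20, 15], [9, 20, 7, 14, 27, 10, 25, 4, 1], [13, 14, 1, 18, 5, 30, 9, 22, 11], [10, 21,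
      14, 9, 0, 11, 20, 5, 12], [4, 11, 16, 13, 28, 9, 6, 3, 14]])
    (s := [[8,5,24,11,28,3,30,15,2],[10,1,28,7,8,11,12,19]])
    (t := [[2,15,30,3,28,7,8,11,12],[12,19,10,1,28,11,24,5,8]])
    (gs := joinEightEightSwaps)
    (by decide +kernel) (by norm_num) (joinFin_adj 8 8) top_adj_iff

/-- Swaps that complete the paths and the cycle in `fullFrom_eight_four` to a
decomposition. -/
def eightFourSwaps : List (List (List (List ℕ))) :=
  [[[[13, 23, 28, 15, 25, 7, 20, 3], [1, 14, 24, 10, 20, 9, 2, 7], [0, 13, 11, 26, 20, 6, 29,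
  15]], [[24, 14, 1, 7, 2, 9, 20, 10], [0, 13, 23, 28, 15, 29, 6, 20, 26], [26, 11, 13, 3, 20, 7,
  25, 15, 0]], [[7, 1, 14, 24, 10, 20, 6, 29, 15], [15, 28, 23, 13, 11, 26, 20, 7, 25], [25, 15,
  0, 13, 3, 20, 9, 2, 7]]], [[[16, 29, 12, 18, 24, 1, 30, 3], [2, 21, 15, 4, 30, 12, 10, 19], [9,
  27, 20, 1, 15, 8, 2, 23]], [[9, 23, 2, 8, 15, 1, 20, 27], [10, 19, 2, 21, 15, 4, 30, 12, 29],
  [10, 12, 18, 24, 1, 30, 3, 16, 29]], [[3, 16, 29, 12, 10, 19, 2, 8, 15], [15, 4, 30, 12, 18, 24,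
  1, 20, 27], [27, 9, 23, 2, 21, 15, 1, 30, 3]]], [[[20, 2, 11, 5, 16, 13, 22, 15], [18, 7, 9, 0,
  14, 20, 29, 4], [29, 11, 16, 15, 2, 13, 7, 24]], [[4, 18, 7, 13, 22, 15, 20, 29], [13, 16, 5,
  11, 2, 20, 14, 0, 9], [13, 2, 15, 16, 11, 29, 24, 7, 9]], [[9, 7, 13, 16, 5, 11, 2, 15, 22],
  [22, 13, 2, 20, 29, 24, 7, 18, 4], [9, 0, 14, 20, 15, 16, 11, 29, 4]]], [[[28, 14, 4, 31, 6, 3,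
  26, 13], [31, 14, 23, 26, 16, 25, 4, 9], [26, 29, 18, 1, 27, 17, 31, 8]], [[18, 29, 26, 8, 31,
  17, 27, 1], [3, 26, 23, 14, 31, 9, 4, 25, 16], [3, 6, 31, 4, 14, 28, 13, 26, 16]], [[28, 13, 26,
  8, 31, 9, 4, 25, 16], [1, 27, 17, 31, 4, 14, 23, 26, 16], [1, 18, 29, 26, 3, 6, 31, 14, 28]]],
  [[[16, 22, 31, 12, 27, 29, 3, 10], [3, 24, 2, 28, 21, 26, 15, 9], [28, 27, 6, 0, 22, 12, 9,
  19]], [[0, 6, 27, 28, 19, 9, 12, 22], [10, 16, 22, 31, 12, 27, 29, 3, 9], [10, 3, 24, 2, 28, 21,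
  26, 15, 9]], [[24, 3, 29, 27, 6, 0, 22, 16, 10], [24, 2, 28, 21, 26, 15, 9, 12, 22], [22, 31,
  12, 27, 28, 19, 9, 3, 10]]], [[[13, 31, 24, 5, 20, 17, 23, 10], [30, 19, 1, 4, 10, 29, 0, 25],
  [27, 8, 19, 26, 17, 22, 29, 2]], [[20, 17, 23, 10, 29, 0, 25, 30, 19], [19, 1, 4, 10, 13, 31,
  24, 5, 20], [22, 29, 2, 27, 8, 19, 26, 17]], [[4, 10, 29, 0, 25, 30, 19, 8, 27], [31, 24, 5, 20,
  17, 26, 19, 1, 4], [27, 2, 29, 22, 17, 23, 10, 13, 31]]], [[[12, 1, 23, 24, 9, 26, 0, 5], [14,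
  5, 22, 25, 2, 12, 11, 21], [9, 14, 8, 21, 0, 11, 24, 22]], [[2, 12, 5, 0, 26, 9, 22, 25], [5,
  14, 8, 21, 0, 11, 24, 23, 1], [5, 22, 24, 9, 14, 21, 11, 12, 1]], [[1, 23, 24, 11, 12, 5, 14, 9,
  22], [22, 24, 9, 26, 0, 11, 21, 14, 8], [1, 12, 2, 25, 22, 5, 0, 21, 8]]], [[[28, 3, 22, 8, 5,
  30, 21, 18], [20, 25, 8, 1, 28, 9, 18, 13], [31, 20, 11, 4, 17, 24, 19, 0], [10, 21, 4, 19, 6,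
  9, 30, 7]], [[24, 19, 0, 31, 20, 11, 4, 21, 10], [10, 7, 30, 9, 6, 19, 4, 17, 24], [13, 18, 28,
  3, 22, 8, 25, 20], [18, 21, 30, 5, 8, 1, 28, 9]], [[11, 20, 25, 8, 5, 30, 21, 4], [22, 3, 28,
  18, 21, 10, 7, 30, 9], [17, 24, 19, 0, 31, 20, 13, 18, 9], [17, 4, 19, 6, 9, 28, 1, 8, 22]],
  [[6, 19, 0, 31, 20, 25, 8, 22, 3], [19, 4, 11, 20, 13, 18, 28, 9, 6], [7, 10, 21, 30, 5, 8, 1,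
  28, 3], [7, 30, 9, 18, 21, 4, 17, 24, 19]]]]

theorem fullFrom_eight_four :
    FullFrom ((⊤ : SimpleGraph (Fin 8)).tensorProduct (⊤ : SimpleGraph (Fin 4))) 1 16 :=
  fullFrom_of_certifiesFullFrom (a := 8) (b := 4) (f := (· != ·)) (h := (· != ·))
    (ps :=
      [[11, 22, 19, 25, 10, 28, 26, 5, 2], [29, 8, 23, 6, 12, 25, 11, 1, 26], [13, 24, 21, 7, 8,
      17, 30, 16, 9], [19, 12, 17, 28, 22, 7, 14, 3, 8], [23, 12, 7, 16, 6, 24, 15, 10, 5], [30,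
      11, 28, 25, 14, 19, 13, 27, 21], [16, 2, 31, 18, 20, 19, 21, 6, 28], [1, 10, 27, 0, 18, 8,
      6, 25, 31], [4, 13, 30, 23, 5, 28, 7, 0, 10], [14, 11, 6, 17, 7, 29, 19, 5, 3], [7, 26, 4,
      27, 5, 18, 15, 30, 20], [0, 30, 8, 13, 6, 1, 31, 5, 15], [24, 30, 27, 18, 23, 0, 17, 15, 6],
      [18, 11, 17, 14, 29, 23, 16, 27, 22], [25, 3, 17, 10, 31, 21, 16, 14, 27]])
    (s := [[17,2,4,23,25,18,3,21,12],[31,16,1,22,4,3,12,26]])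
    (t := [[12,21,3,4,22,1,16,31,26],[17,2,4,23,25,18,3,12,26]])
    (gs := eightFourSwaps)
    (by decide +kernel) (by norm_num) top_adj_iff top_adj_iff

/-- Swaps that complete the paths and the cycle in `fullFrom_eight_join` to a
decomposition. -/
def eightJoinSwaps : List (List (List (List ℕ))) :=
  [[[[11, 20, 26, 29, 18, 5, 19, 25], [26, 4, 17, 2, 20, 29, 14, 1], [30, 25, 4, 21, 7, 28, 19,
  9]], [[7, 21, 4, 25, 30, 9, 19, 28], [4, 17, 2, 20, 26, 1, 14, 29, 18], [4, 26, 29, 20, 11, 25,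
  19, 5, 18]], [[29, 14, 1, 26, 20, 11, 25, 19, 28], [28, 7, 21, 4, 17, 2, 20, 29, 18], [18, 5,
  19, 9, 30, 25, 4, 26, 29]]], [[[17, 30, 1, 19, 4, 3, 16, 7], [3, 20, 15, 16, 31, 24, 5, 28], [9,
  14, 21, 0, 10, 12, 11, 16]], [[19, 1, 30, 17, 7, 16, 3, 4], [15, 20, 3, 28, 5, 24, 31, 16, 11],
  [15, 16, 9, 14, 21, 0, 10, 12, 11]], [[15, 20, 3, 28, 5, 24, 31, 16, 11], [15, 16, 7, 17, 30, 1,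
  19, 4, 3], [3, 16, 9, 14, 21, 0, 10, 12, 11]]], [[[18, 24, 19, 20, 25, 16, 2, 21], [23, 8, 27,
  5, 11, 13, 2, 12], [0, 13, 10, 16, 30, 21, 12, 7]], [[5, 11, 13, 0, 7, 12, 21, 2, 16], [16, 10,
  13, 2, 12, 23, 8, 27, 5], [30, 16, 25, 20, 19, 24, 18, 21]], [[0, 13, 2, 21, 12, 23, 8, 27, 5],
  [0, 7, 12, 2, 16, 30, 21, 18, 24], [5, 11, 13, 10, 16, 25, 20, 19, 24]]], [[[8, 7, 29, 12, 18,
  13, 3, 21], [30, 24, 15, 28, 17, 6, 9, 4], [16, 14, 24, 10, 28, 1, 15, 21]], [[18, 12, 29, 7, 8,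
  21, 15, 1, 28], [28, 15, 24, 14, 16, 21, 3, 13, 18], [17, 6, 9, 4, 30, 24, 10, 28]], [[1, 15,
  24, 10, 28, 17, 6, 9, 4], [18, 13, 3, 21, 16, 14, 24, 30, 4], [18, 12, 29, 7, 8, 21, 15, 28,
  1]]], [[[17, 11, 4, 1, 16, 27, 20, 10], [11, 29, 3, 17, 27, 9, 23, 1], [27, 0, 18, 1, 8, 3, 24,
  29]], [[0, 18, 1, 8, 3, 24, 29, 27], [9, 23, 1, 11, 17, 10, 20, 27, 16], [16, 1, 4, 11, 29, 3,
  17, 27, 9]], [[24, 29, 27, 17, 11, 4, 1, 18, 0], [24, 3, 8, 1, 23, 9, 27, 20, 10], [0, 27, 16,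
  1, 11, 29, 3, 17, 10]]], [[[31, 9, 24, 2, 25, 15, 29, 0], [23, 28, 6, 8, 19, 0, 14, 4], [13, 4,
  10, 1, 22, 16, 29, 19]], [[2, 25, 15, 29, 16, 22, 1, 10, 4], [2, 24, 9, 31, 0, 29, 19, 13, 4],
  [8, 6, 28, 23, 4, 14, 0, 19]], [[19, 29, 15, 25, 2, 24, 9, 31, 0], [0, 14, 4, 13, 19, 8, 6, 28,
  23], [23, 4, 10, 1, 22, 16, 29, 0, 19]]], [[[24, 23, 17, 22, 25, 31, 21, 11], [26, 17, 31, 20,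
  30, 0, 15, 8], [23, 16, 26, 9, 20, 18, 4, 29]], [[24, 23, 17, 31, 20, 30, 0, 15, 8], [8, 26, 17,
  22, 25, 31, 21, 11, 24], [23, 16, 26, 9, 20, 18, 4, 29]], [[0, 30, 20, 31, 21, 11, 24, 23, 29],
  [0, 15, 8, 26, 16, 23, 17, 22, 25], [29, 4, 18, 20, 9, 26, 17, 31, 25]]], [[[22, 29, 2, 28, 27,
  4, 31, 8], [9, 22, 4, 15, 5, 8, 30, 12], [21, 6, 20, 14, 17, 12, 22, 28], [13, 23, 0, 17, 15, 9,
  18, 8], [10, 21, 24, 6, 16, 5, 3, 25]], [[3, 5, 16, 6, 24, 21, 10, 25], [30, 8, 31, 4, 27, 28,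
  22, 12], [21, 28, 2, 29, 22, 9, 18, 8, 5], [21, 6, 20, 14, 17, 12, 9, 15, 5], [4, 15, 17, 0, 23,
  13, 8, 22]], [[29, 2, 28, 27, 4, 31, 8, 22], [20, 6, 21, 28, 22, 12, 17, 14], [30, 12, 9, 15,
  17, 0, 23, 13, 8], [8, 5, 3, 25, 10, 21, 24, 6, 16], [30, 8, 18, 9, 22, 4, 15, 5, 16]], [[17,
  14, 20, 6, 21, 10, 25, 3, 5], [29, 22, 8, 31, 4, 27, 28, 2], [30, 8, 13, 23, 0, 17, 15, 5, 16],
  [17, 12, 9, 22, 28, 21, 24, 6, 16], [5, 8, 18, 9, 15, 4, 22, 12, 30]], [[6, 21, 28, 22, 4, 15,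
  9, 12, 30], [13, 8, 5, 3, 25, 10, 21, 24, 6], [30, 8, 18, 9, 22, 29, 2, 28, 27], [5, 16, 6, 20,
  14, 17, 0, 23, 13], [27, 4, 31, 8, 22, 12, 17, 15, 5]]]]

theorem fullFrom_eight_join :
    FullFrom ((⊤ : SimpleGraph (Fin 8)).tensorProduct (joinFin 2 2)) 1 8 :=
  fullFrom_of_certifiesFullFrom (a := 8) (b := 4) (f := (· != ·)) (h := joinAdj 2)
    (ps :=
      [[21, 19, 12, 3, 9, 28, 13, 26, 5], [16, 13, 22, 5, 23, 25, 6, 0, 9], [12, 25, 0, 5, 30, 13,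
      20, 17, 8], [0, 22, 24, 1, 12, 5, 2, 8, 29], [25, 18, 28, 11, 0, 26, 21, 27, 13], [20, 1,
      31, 12, 6, 13, 7, 24, 17], [4, 2, 9, 7, 20, 5, 31, 13, 24]])
    (s := [[28,25,8,14,5,10,29,6,1],[7,1,27,12,26,28,14,25]])
    (t := [[7,25,8,14,28,26,12,27,1],[7,1,6,29,10,5,14,25,28]])
    (gs := eightJoinSwaps)
    (by decide +kernel) (by norm_num) top_adj_iff (joinFin_adj 2 2)

/-- Swaps that complete the paths and the cycle in `fullFrom_four_four` to a
decomposition. -/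
def fourFourSwaps : List (List (List (List ℕ))) :=
  []

theorem fullFrom_four_four :
    FullFrom ((⊤ : SimpleGraph (Fin 4)).tensorProduct (⊤ : SimpleGraph (Fin 4))) 1 8 :=
  fullFrom_of_certifiesFullFrom (a := 4) (b := 4) (f := (· != ·)) (h := (· != ·))
    (ps :=
      [[4, 9, 15, 8, 1, 6, 11, 5, 0], [8, 14, 7, 2, 15, 1, 11, 12, 6], [2, 4, 11, 0, 10, 1, 12, 9,
      14], [15, 6, 0, 9, 3, 5, 12, 7, 10], [12, 3, 4, 1, 7, 0, 13, 6, 9], [11, 14, 0, 15, 10, 4,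
      13, 8, 7], [1, 14, 4, 15, 5, 2, 13, 10, 3]])
    (s := [[5,14,3,6,8,2,9,7,13],[8,5,10,12,2,11,13,3]])
    (t := [[11,13,7,9,2,8,3,14,5],[11,2,12,10,5,8,6,3,13]])
    (gs := fourFourSwaps)
    (by decide +kernel) (by norm_num) top_adj_iff top_adj_iff

/-- Swaps that complete the paths and the cycle in `fullFrom_eight_three_fold` to a
decomposition. -/
def eightThreeFoldSwaps : List (List (List (List ℕ))) :=
  [[[[3, 10, 7, 12, 11, 14, 1, 6], [6, 13, 14, 7, 8, 1, 2, 15], [11, 14, 7, 2, 5, 6, 3, 8]], [[13,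
  14, 1, 8, 7, 2, 15, 6], [12, 7, 14, 11, 8, 3, 6, 5, 2], [12, 11, 14, 7, 10, 3, 6, 1, 2]], [[5,
  6, 3, 10, 7, 12, 11, 14, 1], [13, 14, 7, 8, 1, 6, 15, 2, 5], [13, 6, 3, 8, 11, 14, 7, 2, 1]]],
  [[[1, 2, 15, 10, 9, 0, 13, 4], [2, 13, 4, 7, 14, 9, 12, 5], [5, 0, 9, 14, 1, 6, 13, 10]], [[1,
  6, 13, 2, 5, 12, 9, 14, 7], [1, 14, 9, 0, 5, 10, 13, 4, 7], [13, 4, 1, 2, 15, 10, 9, 0]], [[0,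
  9, 14, 1, 2, 15, 10, 13, 4], [6, 13, 0, 5, 12, 9, 14, 7, 4], [6, 1, 4, 13, 2, 5, 10, 9, 0]]],
  [[[3, 8, 13, 4, 11, 12, 15, 6], [11, 6, 15, 0, 7, 4, 1, 8], [12, 9, 4, 15, 8, 1, 14, 3]], [[13,
  8, 1, 4, 7, 0, 15, 6, 3], [3, 8, 11, 6, 15, 12, 9, 4, 13], [1, 14, 3, 12, 11, 4, 15, 8]], [[9,
  4, 15, 8, 11, 12, 3, 14, 1], [9, 12, 15, 6, 3, 8, 1, 4, 11], [1, 8, 13, 4, 7, 0, 15, 6, 11]]],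
  [[[13, 10, 1, 12, 3, 4, 7, 8], [7, 12, 15, 8, 5, 0, 3, 10], [11, 4, 3, 0, 7, 12, 5, 8]], [[1,
  10, 7, 8, 5, 0, 3, 12], [10, 3, 4, 11, 8, 5, 12, 7, 0], [10, 13, 8, 15, 12, 7, 4, 3, 0]], [[11,
  8, 15, 12, 7, 10, 3, 0, 5], [5, 8, 7, 4, 3, 12, 1, 10, 13], [11, 4, 3, 0, 7, 12, 5, 8, 13]]]]

theorem fullFrom_eight_three_fold :
    FullFrom ((⊤ : SimpleGraph (Fin 8)).tensorProduct (⊤ : SimpleGraph (Fin 2))) 3 8 :=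
  fullFrom_of_certifiesFullFrom (a := 8) (b := 2) (f := (· != ·)) (h := (· != ·))
    (ps :=
      [[1, 2, 11, 0, 15, 12, 9, 14, 5], [3, 0, 11, 6, 1, 12, 5, 2, 9], [0, 7, 8, 5, 14, 3, 12, 1,
      10], [12, 11, 2, 13, 6, 5, 10, 15, 4], [2, 13, 14, 3, 4, 9, 10, 15, 8], [7, 2, 11, 4, 9, 6,
      5, 0, 15], [14, 13, 10, 1, 4, 15, 2, 9, 6]])
    (s := [[11,14,5,10,7,2,9,0,13],[10,3,8,13,0,11,6,9]])
    (t := [[7,10,5,14,11,6,9,0,13],[11,0,13,8,3,10,9,2,7]])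
    (gs := eightThreeFoldSwaps)
    (by decide +kernel) (by norm_num) top_adj_iff top_adj_iff

/-! ### Splitting tensor products -/

local infixl:75 " ⊠ " => SimpleGraph.tensorProduct

section Tensor

variable {α β α' β' : Type*} {G G₁ G₂ : SimpleGraph α} {H : SimpleGraph β} {l a a₁ a₂ : ℕ}

theorem Full.tensor_sup (h₁ : Full (G₁ ⊠ H) l) (h₂ : Full (G₂ ⊠ H) l)
    (hG : ∀ x y, G.Adj x y ↔ G₁.Adj x y ∨ G₂.Adj x y) (hd : ∀ x y, G₁.Adj x y → ¬ G₂.Adj x y) :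
    Full (G ⊠ H) l :=
  h₁.sup h₂ (fun x y => by simp only [SimpleGraph.tensorProduct, hG, or_and_right])
    fun x y h h' => hd _ _ h.1 h'.1

theorem FullFrom.tensor_sup_full (h₁ : FullFrom (G₁ ⊠ H) l a) (h₂ : Full (G₂ ⊠ H) l)
    (hG : ∀ x y, G.Adj x y ↔ G₁.Adj x y ∨ G₂.Adj x y) (hd : ∀ x y, G₁.Adj x y → ¬ G₂.Adj x y) :
    FullFrom (G ⊠ H) l a :=
  h₁.sup_full h₂ (fun x y => by simp only [SimpleGraph.tensorProduct, hG, or_and_right])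
    fun x y h h' => hd _ _ h.1 h'.1

theorem FullFrom.tensor_sup (h₁ : FullFrom (G₁ ⊠ H) l a₁) (h₂ : FullFrom (G₂ ⊠ H) l a₂)
    (hG : ∀ x y, G.Adj x y ↔ G₁.Adj x y ∨ G₂.Adj x y) (hd : ∀ x y, G₁.Adj x y → ¬ G₂.Adj x y) :
    FullFrom (G ⊠ H) l (a₁ + a₂) :=
  h₁.sup h₂ (fun x y => by simp only [SimpleGraph.tensorProduct, hG, or_and_right])
    fun x y h h' => hd _ _ h.1 h'.1

theorem Full.tensor_of_forall_not_adj (h : ∀ x y, ¬ G.Adj x y) : Full (G ⊠ H) l :=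
  .of_forall_not_adj (fun x y h' => h x.1 y.1 (And.left h')) l

theorem tensorProduct_map (G : SimpleGraph α) (H : SimpleGraph β) (e : α ↪ α') (f : β ↪ β') :
    (G ⊠ H).map (e.prodMap f) = G.map e ⊠ H.map f := by
  ext ⟨x, y⟩ ⟨x', y'⟩
  rw [SimpleGraph.map_adj]
  change _ ↔ (G.map e).Adj x x' ∧ (H.map f).Adj y y'
  rw [SimpleGraph.map_adj, SimpleGraph.map_adj]
  constructor
  · rintro ⟨u, v, h, hu, hv⟩
    obtain ⟨rfl, rfl⟩ := Prod.ext_iff.1 hu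
    obtain ⟨rfl, rfl⟩ := Prod.ext_iff.1 hv
    exact ⟨⟨u.1, v.1, h.1, rfl, rfl⟩, u.2, v.2, h.2, rfl, rfl⟩
  · rintro ⟨⟨a, b, h, rfl, rfl⟩, a', b', h', rfl, rfl⟩
    exact ⟨(a, a'), (b, b'), ⟨h, h'⟩, rfl, rfl⟩

theorem tensorProduct_map_swap (G : SimpleGraph α) (H : SimpleGraph β) :
    (G ⊠ H).map (Equiv.prodComm α β).toEmbedding = H ⊠ G := by
  ext ⟨x, y⟩ ⟨x', y'⟩
  rw [SimpleGraph.map_adj]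
  simp [SimpleGraph.tensorProduct, and_comm]

theorem Full.swap (h : Full (G ⊠ H) l) : Full (H ⊠ G) l :=
  tensorProduct_map_swap G H ▸ h.map _

theorem FullFrom.swap (h : FullFrom (G ⊠ H) l a) : FullFrom (H ⊠ G) l a :=
  tensorProduct_map_swap G H ▸ h.map _

theorem Full.tensor_map {G' : SimpleGraph α'} {H' : SimpleGraph β'} (h : Full (G ⊠ H) l)
    (hG : ∃ e : α ↪ α', G.map e = G') (hH : ∃ f : β ↪ β', H.map f = H') : Full (G' ⊠ H') l := by
  obtain ⟨⟨e, rfl⟩, f, rfl⟩ := And.intro hG hH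
  exact tensorProduct_map G H e f ▸ h.map _

theorem FullFrom.tensor_map {G' : SimpleGraph α'} {H' : SimpleGraph β'} (h : FullFrom (G ⊠ H) l a)
    (hG : ∃ e : α ↪ α', G.map e = G') (hH : ∃ f : β ↪ β', H.map f = H') :
    FullFrom (G' ⊠ H') l a := by
  obtain ⟨⟨e, rfl⟩, f, rfl⟩ := And.intro hG hH
  exact tensorProduct_map G H e f ▸ h.map _

end Tensor

/-! ### Complete and complete bipartite graphs on finite sets -/

section Graphs

variable {α β : Type*}

/-- The complete graph on `S`; the vertices outside `S` are isolated. -/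
def cliqueOn (S : Finset α) : SimpleGraph α where
  Adj x y := x ≠ y ∧ x ∈ S ∧ y ∈ S
  symm := ⟨fun _ _ h => ⟨h.1.symm, h.2.2, h.2.1⟩⟩
  loopless := ⟨fun _ h => h.1 rfl⟩

/-- The complete bipartite graph between the disjoint sets `S` and `T`. -/
def bicliqueOn (S T : Finset α) : SimpleGraph α where
  Adj x y := x ≠ y ∧ (x ∈ S ∧ y ∈ T ∨ x ∈ T ∧ y ∈ S)
  symm := ⟨fun _ _ h => ⟨h.1.symm, h.2.symm.imp And.symm And.symm⟩⟩
  loopless := ⟨fun _ h => h.1 rfl⟩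

/-- The complete graph on `S ∪ T` without the edges inside `T`, for disjoint `S` and `T`. -/
def joinOn (S T : Finset α) : SimpleGraph α where
  Adj x y := x ≠ y ∧ (x ∈ S ∧ y ∈ S ∨ x ∈ S ∧ y ∈ T ∨ x ∈ T ∧ y ∈ S)
  symm := ⟨fun _ _ h => ⟨h.1.symm, by tauto⟩⟩
  loopless := ⟨fun _ h => h.1 rfl⟩

theorem bicliqueOn_comm (S T : Finset α) : bicliqueOn S T = bicliqueOn T S := by
  ext x y
  simp only [bicliqueOn]
  tauto

theorem exists_map_eq_cliqueOn {S : Finset α} {n : ℕ} (hS : S.card = n) :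
    ∃ e : Fin n ↪ α, (⊤ : SimpleGraph (Fin n)).map e = cliqueOn S := by
  refine ⟨(S.equivFinOfCardEq hS).symm.toEmbedding.trans (.subtype _), ?_⟩
  ext x y
  rw [SimpleGraph.map_adj]
  simp only [cliqueOn, SimpleGraph.top_adj]
  constructor
  · rintro ⟨i, j, hij, rfl, rfl⟩
    exact ⟨fun h => hij (Function.Embedding.injective _ h), by simp⟩
  · rintro ⟨hxy, hx, hy⟩
    exact ⟨S.equivFinOfCardEq hS ⟨x, hx⟩, S.equivFinOfCardEq hS ⟨y, hy⟩, by simpa using hxy,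
      by simp, by simp⟩

theorem exists_embedding_add {S T : Finset α} {a b : ℕ} (hd : Disjoint S T) (hS : S.card = a)
    (hT : T.card = b) : ∃ e : Fin (a + b) ↪ α, (∀ i, e i ∈ S ↔ (i : ℕ) < a) ∧
      (∀ i, e i ∈ T ↔ ¬ (i : ℕ) < a) ∧ ∀ x, x ∈ S ∨ x ∈ T → ∃ i, e i = x := by
  let eS := S.equivFinOfCardEq hS
  let eT := T.equivFinOfCardEq hT
  let g : Fin (a + b) → α := Fin.addCases (fun i => (eS.symm i : α)) fun i => (eT.symm i : α)
  have hl : ∀ i, g (Fin.castAdd b i) = eS.symm i := fun i => by simp [g]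
  have hr : ∀ i, g (Fin.natAdd a i) = eT.symm i := fun i => by simp [g]
  have hlS : ∀ i, g (Fin.castAdd b i) ∈ S := fun i => hl i ▸ (eS.symm i).2
  have hrT : ∀ i, g (Fin.natAdd a i) ∈ T := fun i => hr i ▸ (eT.symm i).2
  have hd' := Finset.disjoint_left.1 hd
  have hg : Function.Injective g := by
    intro i j hij
    induction i using Fin.addCases <;> induction j using Fin.addCases
    · simpa [hl, Subtype.ext_iff] using hij
    · exact absurd (hij ▸ hrT _) (hd' (hlS _))
    · exact absurd (hij ▸ hrT _) (hd' (hlS _))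
    · simpa [hr, Subtype.ext_iff] using hij
  refine ⟨⟨g, hg⟩, fun i => ?_, fun i => ?_, ?_⟩
  · change g i ∈ S ↔ _
    induction i using Fin.addCases with
    | left i => simp [hlS]
    | right i => simpa using fun h => hd' h (hrT i)
  · change g i ∈ T ↔ _
    induction i using Fin.addCases with
    | left i => simpa using hd' (hlS i)
    | right i => simp [hrT]
  · rintro x (hx | hx)
    · exact ⟨Fin.castAdd b (eS ⟨x, hx⟩), (hl _).trans (by simp)⟩
    · exact ⟨Fin.natAdd a (eT ⟨x, hx⟩), (hr _).trans (by simp)⟩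

theorem exists_map_eq_bicliqueOn {S T : Finset α} {a b : ℕ} (hd : Disjoint S T) (hS : S.card = a)
    (hT : T.card = b) : ∃ e : Fin (a + b) ↪ α, (bipFin a b).map e = bicliqueOn S T := by
  obtain ⟨e, h1, h2, h3⟩ := exists_embedding_add hd hS hT
  have hd' := Finset.disjoint_left.1 hd
  refine ⟨e, ?_⟩
  ext x y
  rw [SimpleGraph.map_adj]
  simp only [bicliqueOn, bipFin, bipAdj, bne_iff_ne, ne_eq, decide_eq_decide]
  constructor
  · rintro ⟨i, j, hij, rfl, rfl⟩
    have : i ≠ j := by rintro rfl; exact hij Iff.rfl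
    simp only [e.injective.eq_iff, h1, h2]
    tauto
  · rintro ⟨hxy, h⟩
    obtain ⟨i, rfl⟩ := h3 x (by tauto)
    obtain ⟨j, rfl⟩ := h3 y (by tauto)
    simp only [h1, h2] at h
    exact ⟨i, j, by tauto, rfl, rfl⟩

theorem exists_map_eq_joinOn {S T : Finset α} {a b : ℕ} (hd : Disjoint S T) (hS : S.card = a)
    (hT : T.card = b) : ∃ e : Fin (a + b) ↪ α, (joinFin a b).map e = joinOn S T := by
  obtain ⟨e, h1, h2, h3⟩ := exists_embedding_add hd hS hT
  refine ⟨e, ?_⟩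
  ext x y
  rw [SimpleGraph.map_adj]
  simp only [joinOn, joinFin, joinAdj, Bool.and_eq_true, bne_iff_ne, ne_eq, Bool.or_eq_true,
    decide_eq_true_eq, ← Fin.ext_iff]
  constructor
  · rintro ⟨i, j, hij, rfl, rfl⟩
    simp only [e.injective.eq_iff, h1, h2]
    tauto
  · rintro ⟨hxy, h⟩
    obtain ⟨i, rfl⟩ := h3 x (by tauto)
    obtain ⟨j, rfl⟩ := h3 y (by tauto)
    simp only [h1, h2, e.injective.eq_iff] at h hxy
    exact ⟨i, j, by tauto, rfl, rfl⟩

theorem exists_union_card {S : Finset α} [DecidableEq α] {k : ℕ} (h : k ≤ S.card) :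
    ∃ A N, S = A ∪ N ∧ Disjoint A N ∧ N.card = k ∧ A.card = S.card - k := by
  obtain ⟨N, hN, rfl⟩ := Finset.exists_subset_card_eq h
  exact ⟨S \ N, N, (Finset.sdiff_union_of_subset hN).symm, Finset.sdiff_disjoint, rfl,
    Finset.card_sdiff_of_subset hN⟩

variable {H : SimpleGraph β} {l a b : ℕ} {A N S T : Finset α}

theorem Full.of_card_le_one (hS : S.card ≤ 1) : Full (cliqueOn S ⊠ H) l :=
  .tensor_of_forall_not_adj fun x y h => h.1 (Finset.card_le_one.1 hS x h.2.1 y h.2.2)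

section Union

variable [DecidableEq α]

theorem Full.clique_union (hd : Disjoint A N) (hA : Full (cliqueOn A ⊠ H) l)
    (hN : Full (cliqueOn N ⊠ H) l) (hAN : Full (bicliqueOn N A ⊠ H) l) :
    Full (cliqueOn (A ∪ N) ⊠ H) l := by
  have hd' := Finset.disjoint_left.1 hd
  have hj : Full (joinOn N A ⊠ H) l := by
    refine hN.tensor_sup hAN (fun x y => ?_) fun x y => ?_ <;>
    · simp only [joinOn, cliqueOn, bicliqueOn]
      have := @hd' x
      have := @hd' y
      tauto
  refine hA.tensor_sup hj (fun x y => ?_) fun x y => ?_ <;>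
  · simp only [joinOn, cliqueOn, Finset.mem_union]
    have := @hd' x
    have := @hd' y
    tauto

theorem FullFrom.clique_union (hd : Disjoint A N) (hA : FullFrom (cliqueOn A ⊠ H) l a)
    (hN : FullFrom (cliqueOn N ⊠ H) l b) (hAN : Full (bicliqueOn N A ⊠ H) l) :
    FullFrom (cliqueOn (A ∪ N) ⊠ H) l (a + b) := by
  have hd' := Finset.disjoint_left.1 hd
  have hj : FullFrom (joinOn N A ⊠ H) l b := by
    refine hN.tensor_sup_full hAN (fun x y => ?_) fun x y => ?_ <;>
    · simp only [joinOn, cliqueOn, bicliqueOn]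
      have := @hd' x
      have := @hd' y
      tauto
  refine hA.tensor_sup hj (fun x y => ?_) fun x y => ?_ <;>
  · simp only [joinOn, cliqueOn, Finset.mem_union]
    have := @hd' x
    have := @hd' y
    tauto

/-- The edges joining `N` to `A` are divided between those to `S`, which are taken together with
the edges inside `N`, and those to `A \ S`. -/
theorem FullFrom.clique_union_join (hd : Disjoint A N) (hS : S ⊆ A)
    (hA : FullFrom (cliqueOn A ⊠ H) l a) (hN : FullFrom (joinOn N S ⊠ H) l b)
    (hAN : Full (bicliqueOn N (A \ S) ⊠ H) l) : FullFrom (cliqueOn (A ∪ N) ⊠ H) l (a + b) := by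
  have hd' := Finset.disjoint_left.1 hd
  have hj : FullFrom (joinOn N A ⊠ H) l b := by
    refine hN.tensor_sup_full hAN (fun x y => ?_) fun x y => ?_ <;>
    · simp only [joinOn, bicliqueOn, Finset.mem_sdiff]
      have := @hd' x
      have := @hd' y
      have := @hS x
      have := @hS y
      tauto
  refine hA.tensor_sup hj (fun x y => ?_) fun x y => ?_ <;>
  · simp only [joinOn, cliqueOn, Finset.mem_union]
    have := @hd' x
    have := @hd' y
    tauto

/-- The complete graph on `A ∪ N` consists of those on `A` and on `N` together with one point
of `A`, and of the edges between `N` and the other points of `A`. -/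
theorem Full.clique_union_insert {x : α} (hx : x ∈ A) (hd : Disjoint A N)
    (hA : Full (cliqueOn A ⊠ H) l) (hN : Full (cliqueOn (insert x N) ⊠ H) l)
    (hAN : Full (bicliqueOn N (A.erase x) ⊠ H) l) : Full (cliqueOn (A ∪ N) ⊠ H) l := by
  have hd' := Finset.disjoint_left.1 hd
  have hj : Full (joinOn N A ⊠ H) l := by
    refine hN.tensor_sup hAN (fun y z => ?_) fun y z => ?_ <;>
    · simp only [joinOn, cliqueOn, bicliqueOn, Finset.mem_insert, Finset.mem_erase]
      have := @hd' y
      have := @hd' z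
      by_cases h1 : y = x <;> by_cases h2 : z = x <;> subst_vars <;> tauto
  refine hA.tensor_sup hj (fun y z => ?_) fun y z => ?_ <;>
  · simp only [joinOn, cliqueOn, Finset.mem_union]
    have := @hd' y
    have := @hd' z
    tauto

theorem Full.biclique_union_right {T₁ T₂ : Finset α} (hST : Disjoint S (T₁ ∪ T₂))
    (hT : Disjoint T₁ T₂) (h₁ : Full (bicliqueOn S T₁ ⊠ H) l) (h₂ : Full (bicliqueOn S T₂ ⊠ H) l) :
    Full (bicliqueOn S (T₁ ∪ T₂) ⊠ H) l := by
  have hT' := Finset.disjoint_left.1 hT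
  have hST' := Finset.disjoint_left.1 hST
  simp only [Finset.mem_union] at hST'
  refine h₁.tensor_sup h₂ (fun x y => ?_) fun x y => ?_ <;>
  · simp only [bicliqueOn, Finset.mem_union]
    have := @hT' x
    have := @hT' y
    have := @hST' x
    have := @hST' y
    tauto

end Union

theorem Full.biclique_of_dvd_right
    (h : ∀ T : Finset α, Disjoint S T → T.card = b → Full (bicliqueOn S T ⊠ H) l)
    (hd : Disjoint S T) (hT : b ∣ T.card) : Full (bicliqueOn S T ⊠ H) l := by
  classical
  obtain ⟨c, hc⟩ := hT
  induction c generalizing T with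
  | zero =>
    obtain rfl : T = ∅ := by simpa using hc
    exact .tensor_of_forall_not_adj fun x y h => by simp [bicliqueOn] at h
  | succ c ih =>
    obtain ⟨A, N, rfl, hAN, hN, hA⟩ := exists_union_card (S := T) (k := b) (by rw [hc]; lia)
    have h1 := Finset.disjoint_union_right.1 hd
    refine .biclique_union_right hd hAN (ih h1.1 ?_) (h N h1.2 hN)
    rw [hA, hc, mul_add_one, Nat.add_sub_cancel]

theorem Full.biclique_of_dvd
    (h : ∀ S T : Finset α, Disjoint S T → S.card = a → T.card = b → Full (bicliqueOn S T ⊠ H) l)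
    (hd : Disjoint S T) (hS : a ∣ S.card) (hT : b ∣ T.card) : Full (bicliqueOn S T ⊠ H) l := by
  refine .biclique_of_dvd_right (fun T' hT' hb => ?_) hd hT
  rw [bicliqueOn_comm]
  refine .biclique_of_dvd_right (fun S' hS' ha => ?_) hT'.symm hS
  rw [bicliqueOn_comm]
  exact h S' T' hS'.symm ha hb

theorem Full.biclique_of_edge (h : ∀ U : Finset α, U.card = 2 → Full (cliqueOn U ⊠ H) l)
    (hd : Disjoint S T) : Full (bicliqueOn S T ⊠ H) l := by
  classical
  refine .biclique_of_dvd (a := 1) (b := 1) (fun S T hd hS hT => ?_) hd (one_dvd _) (one_dvd _)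
  obtain ⟨x, rfl⟩ := Finset.card_eq_one.1 hS
  obtain ⟨y, rfl⟩ := Finset.card_eq_one.1 hT
  have hxy : x ≠ y := by simpa using hd
  convert h {x, y} (Finset.card_pair hxy) using 2
  ext u v
  simp only [bicliqueOn, cliqueOn, Finset.mem_singleton, Finset.mem_insert]
  constructor
  · tauto
  · rintro ⟨huv, rfl | rfl, rfl | rfl⟩ <;> simp_all

theorem Full.clique_of_edge (h : ∀ U : Finset α, U.card = 2 → Full (cliqueOn U ⊠ H) l)
    (T : Finset α) : Full (cliqueOn T ⊠ H) l := by
  classical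
  induction T using Finset.induction_on with
  | empty => exact .of_card_le_one (by simp)
  | insert x T hx ih =>
    have hd : Disjoint T {x} := by simpa using hx
    rw [← Finset.union_singleton]
    exact .clique_union hd ih (.of_card_le_one (by simp)) (.biclique_of_edge h hd.symm)

end Graphs

/-! ### Even degrees -/

section Even

variable {α β : Type*} {H : SimpleGraph β} {l r : ℕ}
  {S : Finset α} {T U X Y : Finset β}

/-- The tensor product of `G` with a single edge is `Full`. Then so is its tensor product with any
finite graph, which is a union of edges. -/
def EdgeFull (β : Type*) {α : Type*} (G : SimpleGraph α) (l : ℕ) : Prop :=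
  ∀ U : Finset β, U.card = 2 → Full (G ⊠ cliqueOn U) l

theorem EdgeFull.clique {G : SimpleGraph α} (h : EdgeFull β G l) (T : Finset β) :
    Full (G ⊠ cliqueOn T) l :=
  (Full.clique_of_edge (fun U hU => (h U hU).swap) T).swap

theorem EdgeFull.biclique {G : SimpleGraph α} (h : EdgeFull β G l) (hd : Disjoint X Y) :
    Full (G ⊠ bicliqueOn X Y) l :=
  (Full.biclique_of_edge (fun U hU => (h U hU).swap) hd).swap

theorem edgeFull_biclique {B C : Finset α} (hd : Disjoint B C) (hB : 8 ∣ B.card)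
    (hC : 4 ∣ C.card) : EdgeFull β (bicliqueOn B C) 1 := fun _ hU =>
  .biclique_of_dvd (fun _ _ hd hB hC => full_bip_eight_four.tensor_map
    (exists_map_eq_bicliqueOn hd hB hC) (exists_map_eq_cliqueOn hU)) hd hB hC

/-- Adding `8` vertices at a time: `K_{n+8}` consists of `K_n`, `K_8` and the edges between them. -/
theorem full_clique_add_mul_eight_of_eight (hr : r % 4 = 0)
    (hbase : ∀ A : Finset α, A.card = r → Full (cliqueOn A ⊠ H) l)
    (h₈ : ∀ N : Finset α, N.card = 8 → Full (cliqueOn N ⊠ H) l)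
    (hb : ∀ B C : Finset α, Disjoint B C → 8 ∣ B.card → 4 ∣ C.card → Full (bicliqueOn B C ⊠ H) l)
    (c : ℕ) (hS : S.card = r + 8 * c) : Full (cliqueOn S ⊠ H) l := by
  classical
  induction c generalizing S with
  | zero => exact hbase S hS
  | succ c ih =>
    obtain ⟨A, N, rfl, hd, hN, hA⟩ := exists_union_card (S := S) (k := 8) (by omega)
    exact .clique_union hd (ih (by omega)) (h₈ N hN) (hb N A hd.symm (by omega) (by omega))

/-- Adding `8` vertices at a time: `K_{n+8}` consists of `K_n`, a `K_9` containing one vertex `x` of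
the `K_n`, and the edges between the new vertices and the old vertices other than `x`. -/
theorem full_clique_add_mul_eight_of_nine (hr : r % 4 = 1)
    (hbase : ∀ A : Finset α, A.card = r → Full (cliqueOn A ⊠ H) l)
    (h₉ : ∀ N : Finset α, N.card = 9 → Full (cliqueOn N ⊠ H) l)
    (hb : ∀ B C : Finset α, Disjoint B C → 8 ∣ B.card → 4 ∣ C.card → Full (bicliqueOn B C ⊠ H) l)
    (c : ℕ) (hS : S.card = r + 8 * c) : Full (cliqueOn S ⊠ H) l := by
  classical
  induction c generalizing S with
  | zero => exact hbase S hS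
  | succ c ih =>
    obtain ⟨A, N, rfl, hd, hN, hA⟩ := exists_union_card (S := S) (k := 8) (by omega)
    obtain ⟨x, hx⟩ : A.Nonempty := Finset.card_pos.1 (by omega)
    have hxN : x ∉ N := Finset.disjoint_left.1 hd hx
    have hA' : (A.erase x).card = A.card - 1 := Finset.card_erase_of_mem hx
    exact .clique_union_insert hx hd (ih (by omega))
      (h₉ _ (by rw [Finset.card_insert_of_notMem hxN, hN]))
      (hb N _ (hd.symm.mono_right (Finset.erase_subset _ _)) (by omega) (by omega))

theorem edgeFull_of_mod_eight_eq_one (hS : S.card % 8 = 1) : EdgeFull β (cliqueOn S) 1 :=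
  fun U hU => full_clique_add_mul_eight_of_nine (r := 1) (by norm_num)
    (fun _ hA => .of_card_le_one hA.le)
    (fun _ hN => full_nine.tensor_map (exists_map_eq_cliqueOn hN) (exists_map_eq_cliqueOn hU))
    (fun _ _ hd hB hC => edgeFull_biclique hd hB hC U hU) (S.card / 8) (by omega)

theorem full_star_of_mod_four_eq_one (hS : S.card % 4 = 1) (hd : Disjoint X Y) (hX : X.card = 1)
    (hY : Y.card = 2) : Full (cliqueOn S ⊠ bicliqueOn X Y) 1 := by
  rcases (by omega : S.card % 8 = 1 ∨ S.card % 8 = 5) with h | h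
  · exact (edgeFull_of_mod_eight_eq_one h).biclique hd
  · exact full_clique_add_mul_eight_of_nine (r := 5) (by norm_num)
      (fun _ hA => full_five_star.tensor_map (exists_map_eq_cliqueOn hA)
        (exists_map_eq_bicliqueOn hd hX hY))
      (fun _ hN => (edgeFull_of_mod_eight_eq_one (by omega)).biclique hd)
      (fun _ _ hd' hB hC => (edgeFull_biclique hd' hB hC).biclique hd) (S.card / 8) (by omega)

/-- A complete graph on four vertices consists of three paths with two edges. -/
theorem full_clique_four_of_star
    (h : ∀ B C : Finset α, Disjoint B C → B.card = 1 → C.card = 2 → Full (bicliqueOn B C ⊠ H) l)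
    (hS : S.card = 4) : Full (cliqueOn S ⊠ H) l := by
  classical
  obtain ⟨A, N, rfl, hd, hN, hA⟩ := exists_union_card (S := S) (k := 1) (by omega)
  obtain ⟨d, rfl⟩ := Finset.card_eq_one.1 hN
  obtain ⟨a, b, c, hab, hac, hbc, rfl⟩ := Finset.card_eq_three.1 (by omega : A.card = 3)
  simp only [Finset.disjoint_singleton_right, Finset.mem_insert, Finset.mem_singleton,
    not_or] at hd
  obtain ⟨hda, hdb, hdc⟩ := hd
  have key : ∀ x y, x ≠ y → d ≠ x → d ≠ y → Full (bicliqueOn {x} {y, d} ⊠ H) l :=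
    fun x y hxy hx hy => h _ _ (by simp [hxy, hx.symm]) (by simp) (Finset.card_pair hy.symm)
  have h₂ : Full ((bicliqueOn {a} {b, d} ⊔ bicliqueOn {b} {c, d}) ⊠ H) l := by
    refine (key a b hab hda hdb).tensor_sup (key b c hbc hdb hdc) (fun x y => Iff.rfl) fun x y => ?_
    simp only [bicliqueOn, Finset.mem_insert, Finset.mem_singleton]
    grind
  refine h₂.tensor_sup (key c a hac.symm hdc hda) (fun x y => ?_) fun x y => ?_ <;>
  · simp only [SimpleGraph.sup_adj, cliqueOn, bicliqueOn, Finset.mem_insert, Finset.mem_singleton,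
      Finset.mem_union]
    grind

/-- A complete graph with an even number of edges decomposes into paths with two edges. -/
theorem full_clique_of_star
    (h : ∀ B C : Finset α, Disjoint B C → B.card = 1 → C.card = 2 → Full (bicliqueOn B C ⊠ H) l)
    (hS : S.card % 4 = 0 ∨ S.card % 4 = 1) : Full (cliqueOn S ⊠ H) l := by
  classical
  induction hn : S.card using Nat.strong_induction_on generalizing S with
  | _ n ih =>
    by_cases h1 : n ≤ 1
    · exact .of_card_le_one (by omega)
    obtain ⟨A, N, rfl, hd, hN, hA⟩ := exists_union_card (S := S) (k := 4) (by omega)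
    refine .clique_union hd (ih A.card (by omega) (by omega) rfl) (full_clique_four_of_star h hN) ?_
    rw [bicliqueOn_comm]
    exact .biclique_of_dvd h hd (one_dvd _) (by omega)

theorem full_of_mod_four_eq_one (hS : S.card % 4 = 1) (hT : T.card % 4 = 0 ∨ T.card % 4 = 1) :
    Full (cliqueOn S ⊠ cliqueOn T) 1 :=
  (full_clique_of_star (fun _ _ hd hB hC => (full_star_of_mod_four_eq_one hS hd hB hC).swap)
    hT).swap

theorem full_cycle_of_eight_dvd (hS : 8 ∣ S.card) (hd : Disjoint X Y) (hX : 2 ∣ X.card)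
    (hY : 2 ∣ Y.card) : Full (cliqueOn S ⊠ bicliqueOn X Y) 1 := by
  refine (Full.biclique_of_dvd (fun X Y hd hX hY => Full.swap ?_) hd hX hY).swap
  exact full_clique_add_mul_eight_of_eight (r := 0) (by norm_num)
    (fun _ hA => .of_card_le_one (by omega))
    (fun _ hN => full_eight_cycle.tensor_map (exists_map_eq_cliqueOn hN)
      (exists_map_eq_bicliqueOn hd hX hY))
    (fun _ _ hd' hB hC => (edgeFull_biclique hd' hB hC).biclique hd) (S.card / 8) (by omega)

theorem full_three_of_eight_dvd (hS : 8 ∣ S.card) (hU : U.card = 3) :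
    Full (cliqueOn S ⊠ cliqueOn U) 1 :=
  full_clique_add_mul_eight_of_eight (r := 0) (by norm_num)
    (fun _ hA => .of_card_le_one (by omega))
    (fun _ hN => full_eight_three.tensor_map (exists_map_eq_cliqueOn hN)
      (exists_map_eq_cliqueOn hU))
    (fun _ _ hd' hB hC => (edgeFull_biclique hd' hB hC).clique U) (S.card / 8) (by omega)

/-- Adding two vertices to a complete graph on an odd number of vertices adds a triangle and cycles
of length `4`. -/
theorem full_of_eight_dvd (hT : 8 ∣ T.card) (hS : S.card % 2 = 1) :
    Full (cliqueOn S ⊠ cliqueOn T) 1 := by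
  classical
  induction hn : S.card using Nat.strong_induction_on generalizing S with
  | _ n ih =>
    by_cases h1 : n = 1
    · exact .of_card_le_one (by omega)
    obtain ⟨A, N, rfl, hd, hN, hA⟩ := exists_union_card (S := S) (k := 2) (by omega)
    obtain ⟨x, hx⟩ : A.Nonempty := Finset.card_pos.1 (by omega)
    have hxN : x ∉ N := Finset.disjoint_left.1 hd hx
    have hA' : (A.erase x).card = A.card - 1 := Finset.card_erase_of_mem hx
    exact .clique_union_insert hx hd (ih A.card (by omega) (by omega) rfl)
      (full_three_of_eight_dvd hT (by rw [Finset.card_insert_of_notMem hxN, hN])).swap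
      (full_cycle_of_eight_dvd hT (hd.symm.mono_right (Finset.erase_subset _ _)) (by omega)
        (by omega)).swap

/-- The exception `S.card = 4` is needed: paths of length `8` do not fit into the tensor product of
`K_4` with an edge. -/
theorem edgeFull_two (hS : S.card % 4 = 0 ∨ S.card % 4 = 1) (h4 : S.card ≠ 4) :
    EdgeFull β (cliqueOn S) 2 := by
  intro U hU
  have hU' := exists_map_eq_cliqueOn hU
  have hb (B C : Finset α) (hd : Disjoint B C) (hB : 8 ∣ B.card) (hC : 4 ∣ C.card) :
      Full (bicliqueOn B C ⊠ cliqueOn U) 2 :=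
    (edgeFull_biclique hd hB hC U hU).of_dvd (one_dvd _)
  have h8 (N : Finset α) (hN : N.card = 8) : Full (cliqueOn N ⊠ cliqueOn U) 2 :=
    full_eight.tensor_map (exists_map_eq_cliqueOn hN) hU'
  have h9 (N : Finset α) (hN : N.card = 9) : Full (cliqueOn N ⊠ cliqueOn U) 2 :=
    (edgeFull_of_mod_eight_eq_one (by omega) U hU).of_dvd (one_dvd _)
  rcases (by omega : S.card % 8 = 1 ∨ S.card % 8 = 5 ∨ S.card % 8 = 0 ∨
    S.card = 12 + 8 * ((S.card - 12) / 8)) with h | h | h | h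
  · exact (edgeFull_of_mod_eight_eq_one h U hU).of_dvd (one_dvd _)
  · exact full_clique_add_mul_eight_of_nine (r := 5) (by norm_num)
      (fun _ hA => full_five.tensor_map (exists_map_eq_cliqueOn hA) hU') h9 hb (S.card / 8)
      (by omega)
  · exact full_clique_add_mul_eight_of_eight (r := 0) (by norm_num)
      (fun _ hA => .of_card_le_one (by omega)) h8 hb (S.card / 8) (by omega)
  · exact full_clique_add_mul_eight_of_eight (r := 12) (by norm_num)
      (fun _ hA => full_twelve.tensor_map (exists_map_eq_cliqueOn hA) hU') h8 hb _ h

/-- For four vertices in one factor, the other factor is cut into paths with two edges and, if the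
number of its edges is odd, one triangle. -/
theorem full_four_two (hT : T.card = 4) (hS : 3 ≤ S.card) : Full (cliqueOn S ⊠ cliqueOn T) 2 := by
  classical
  have hT' := exists_map_eq_cliqueOn hT
  have hstar (B C : Finset α) (hd : Disjoint B C) (hB : B.card = 1) (hC : C.card = 2) :
      Full (bicliqueOn B C ⊠ cliqueOn T) 2 :=
    (full_four_star.tensor_map hT' (exists_map_eq_bicliqueOn hd hB hC)).swap
  have h3 (A : Finset α) (hA : A.card = 3) : Full (cliqueOn A ⊠ cliqueOn T) 2 :=
    (full_four_three.tensor_map hT' (exists_map_eq_cliqueOn hA)).swap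
  induction hn : S.card using Nat.strong_induction_on generalizing S with
  | _ n ih =>
    by_cases h1 : n % 4 = 0 ∨ n % 4 = 1
    · exact full_clique_of_star hstar (by omega)
    rcases (by omega : n = 3 ∨ n = 6 ∨ 7 ≤ n) with h | h | h
    · exact h3 S (by omega)
    · obtain ⟨A, N, rfl, hd, hN, hA⟩ := exists_union_card (S := S) (k := 3) (by omega)
      obtain ⟨x, hx⟩ : A.Nonempty := Finset.card_pos.1 (by omega)
      have hxN : x ∉ N := Finset.disjoint_left.1 hd hx
      have hA' : (A.erase x).card = A.card - 1 := Finset.card_erase_of_mem hx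
      exact .clique_union_insert hx hd (h3 A (by omega))
        (full_clique_four_of_star hstar (by rw [Finset.card_insert_of_notMem hxN, hN]))
        (.biclique_of_dvd hstar (hd.symm.mono_right (Finset.erase_subset _ _)) (one_dvd _)
          (by omega))
    · obtain ⟨A, N, rfl, hd, hN, hA⟩ := exists_union_card (S := S) (k := 4) (by omega)
      refine .clique_union hd (ih A.card (by omega) (by omega) rfl)
        (full_clique_four_of_star hstar hN) ?_
      rw [bicliqueOn_comm]
      exact .biclique_of_dvd hstar hd (one_dvd _) (by omega)

theorem full_biclique_four_fold {B C : Finset α} (hd : Disjoint B C) (hB : 4 ∣ B.card)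
    (hC : 5 ≤ C.card) (hC' : C.card ≤ 7) (hU : U.card = 2) :
    Full (bicliqueOn B C ⊠ cliqueOn U) 4 := by
  have hU' := exists_map_eq_cliqueOn hU
  refine .biclique_of_dvd (a := 4) (b := C.card) (fun B' C' hd' hB' hC' => ?_) hd hB dvd_rfl
  rcases (by omega : C.card = 5 ∨ C.card = 6 ∨ C.card = 7) with h | h | h <;> rw [h] at hC'
  · exact (full_bip_four_five.tensor_map (exists_map_eq_bicliqueOn hd' hB' hC') hU').of_dvd
      (by norm_num)
  · exact (full_bip_four_six.tensor_map (exists_map_eq_bicliqueOn hd' hB' hC') hU').of_dvd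
      (by norm_num)
  · exact (full_bip_four_seven.tensor_map (exists_map_eq_bicliqueOn hd' hB' hC') hU').of_dvd
      (by norm_num)

/-- The set `C` is cut into sets of size `4` and one set of size between `4` and `7`. -/
theorem full_biclique_eight_four_fold {B C : Finset α} (hd : Disjoint B C) (hB : B.card = 8)
    (hC : 4 ≤ C.card) (hU : U.card = 2) : Full (bicliqueOn B C ⊠ cliqueOn U) 4 := by
  classical
  induction hn : C.card using Nat.strong_induction_on generalizing C with
  | _ n ih =>
    rcases (by omega : n = 4 ∨ n ≤ 7 ∧ 5 ≤ n ∨ 8 ≤ n) with h | h | h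
    · exact (edgeFull_biclique hd (by omega) (by omega) U hU).of_dvd (one_dvd _)
    · exact full_biclique_four_fold hd (by omega) (by omega) (by omega) hU
    · obtain ⟨A, N, rfl, hd', hN, hA⟩ := exists_union_card (S := C) (k := 4) (by omega)
      have hd'' := Finset.disjoint_union_right.1 hd
      exact .biclique_union_right hd hd' (ih A.card (by omega) hd''.1 (by omega) rfl)
        ((edgeFull_biclique hd''.2 (by omega) (by omega) U hU).of_dvd (one_dvd _))

theorem edgeFull_four (hS : 5 ≤ S.card) : EdgeFull β (cliqueOn S) 4 := by
  classical
  intro U hU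
  have hU' := exists_map_eq_cliqueOn hU
  induction hn : S.card using Nat.strong_induction_on generalizing S with
  | _ n ih =>
    by_cases h1 : n % 4 = 0 ∨ n % 4 = 1
    · exact (edgeFull_two (by omega) (by omega) U hU).of_dvd (by norm_num)
    rcases (by omega : n = 6 ∨ n = 7 ∨ (n = 10 ∨ n = 11) ∨ 14 ≤ n) with h | h | h | h
    · exact full_six.tensor_map (exists_map_eq_cliqueOn (hn.trans h)) hU'
    · exact full_seven.tensor_map (exists_map_eq_cliqueOn (hn.trans h)) hU'
    · obtain ⟨A, N, rfl, hd, hN, hA⟩ := exists_union_card (S := S) (k := 4) (by omega)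
      obtain ⟨x, hx⟩ : A.Nonempty := Finset.card_pos.1 (by omega)
      have hxN : x ∉ N := Finset.disjoint_left.1 hd hx
      have hA' : (A.erase x).card = A.card - 1 := Finset.card_erase_of_mem hx
      have hN' : (insert x N).card = 5 := by rw [Finset.card_insert_of_notMem hxN, hN]
      exact .clique_union_insert hx hd (ih A.card (by omega) (by omega) rfl)
        ((edgeFull_two (by omega) (by omega) U hU).of_dvd (by norm_num))
        (full_biclique_four_fold (hd.symm.mono_right (Finset.erase_subset _ _)) (by omega)
          (by omega) (by omega) hU)
    · obtain ⟨A, N, rfl, hd, hN, hA⟩ := exists_union_card (S := S) (k := 8) (by omega)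
      obtain ⟨x, hx⟩ : A.Nonempty := Finset.card_pos.1 (by omega)
      have hxN : x ∉ N := Finset.disjoint_left.1 hd hx
      have hA' : (A.erase x).card = A.card - 1 := Finset.card_erase_of_mem hx
      have hN' : (insert x N).card = 9 := by rw [Finset.card_insert_of_notMem hxN, hN]
      exact .clique_union_insert hx hd (ih A.card (by omega) (by omega) rfl)
        ((edgeFull_of_mod_eight_eq_one (by omega) U hU).of_dvd (one_dvd _))
        (full_biclique_eight_four_fold (hd.symm.mono_right (Finset.erase_subset _ _)) hN
          (by omega) hU)

theorem full_two (hS : S.card % 4 = 0 ∨ S.card % 4 = 1) (hST : 9 ≤ S.card * T.card) :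
    Full (cliqueOn S ⊠ cliqueOn T) 2 := by
  by_cases h4 : S.card = 4
  · exact (full_four_two h4 (by rw [h4] at hST; omega)).swap
  · exact (edgeFull_two hS h4).clique T

theorem full_four (hST : 9 ≤ S.card * T.card) : Full (cliqueOn S ⊠ cliqueOn T) 4 := by
  by_cases hS : 5 ≤ S.card
  · exact (edgeFull_four hS).clique T
  by_cases hT : 5 ≤ T.card
  · exact ((edgeFull_four hT).clique S).swap
  by_cases hS4 : S.card % 4 = 0 ∨ S.card % 4 = 1
  · exact (full_two hS4 hST).of_dvd (by norm_num)
  by_cases hT4 : T.card % 4 = 0 ∨ T.card % 4 = 1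
  · exact (full_two hT4 (by rwa [mul_comm])).swap.of_dvd (by norm_num)
  have hS' : S.card = 2 ∨ S.card = 3 := by omega
  have hT' : T.card = 2 ∨ T.card = 3 := by omega
  rcases hS' with hS' | hS' <;> rcases hT' with hT' | hT' <;> rw [hS', hT'] at hST <;>
    first
    | omega
    | exact full_three_three.tensor_map (exists_map_eq_cliqueOn hS') (exists_map_eq_cliqueOn hT')

theorem exists_odd_two_mul {x : ℕ} (hx : x % 4 = 2 ∨ x % 4 = 3) :
    ∃ u, Odd u ∧ x * (x - 1) = 2 * u := by
  rcases hx with hx | hx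
  · refine ⟨x / 2 * (x - 1), (Nat.odd_iff.2 (by omega)).mul (Nat.odd_iff.2 (by omega)), ?_⟩
    rw [← mul_assoc, show 2 * (x / 2) = x by omega]
  · refine ⟨x * ((x - 1) / 2), (Nat.odd_iff.2 (by omega)).mul (Nat.odd_iff.2 (by omega)), ?_⟩
    rw [mul_left_comm, show 2 * ((x - 1) / 2) = x - 1 by omega]

theorem exists_odd_four_mul {x : ℕ} (hx : x % 8 = 4 ∨ x % 8 = 5) :
    ∃ u, Odd u ∧ x * (x - 1) = 4 * u := by
  rcases hx with hx | hx
  · refine ⟨x / 4 * (x - 1), (Nat.odd_iff.2 (by omega)).mul (Nat.odd_iff.2 (by omega)), ?_⟩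
    rw [← mul_assoc, show 4 * (x / 4) = x by omega]
  · refine ⟨x * ((x - 1) / 4), (Nat.odd_iff.2 (by omega)).mul (Nat.odd_iff.2 (by omega)), ?_⟩
    rw [mul_left_comm, show 4 * ((x - 1) / 4) = x - 1 by omega]

theorem not_sixteen_dvd {u v w N : ℕ} (hu : Odd u) (hv : Odd v) (hw : Odd w)
    (hN : N = 8 * (u * v * w)) : ¬ 16 ∣ N := by
  have := Nat.odd_iff.1 ((hu.mul hv).mul hw)
  omega

theorem full_of_odd_of_odd (hl : l % 2 = 1) (hS : S.card % 2 = 1)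
    (hdvd : 16 ∣ l * (T.card * (T.card - 1)) * (S.card * (S.card - 1))) :
    Full (cliqueOn S ⊠ cliqueOn T) l := by
  refine Full.of_dvd (l := 1) ?_ (one_dvd l)
  have hl' := Nat.odd_iff.2 hl
  rcases (by omega : S.card % 8 = 1 ∨ S.card % 8 = 5 ∨ S.card % 4 = 3) with h | h | h
  · exact (edgeFull_of_mod_eight_eq_one h).clique T
  · by_cases hT : T.card % 4 = 0 ∨ T.card % 4 = 1
    · exact full_of_mod_four_eq_one (by omega) hT
    · obtain ⟨u, hu, hu'⟩ := exists_odd_four_mul (.inr h)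
      obtain ⟨v, hv, hv'⟩ := exists_odd_two_mul (x := T.card) (by omega)
      rw [hu', hv'] at hdvd
      exact absurd hdvd (not_sixteen_dvd hl' hu hv (by ring))
  · obtain ⟨u, hu, hu'⟩ := exists_odd_two_mul (.inr h)
    rcases (by omega : T.card % 8 = 0 ∨ T.card % 8 = 1 ∨ (T.card % 4 = 2 ∨ T.card % 4 = 3) ∨
      (T.card % 8 = 4 ∨ T.card % 8 = 5)) with hT | hT | hT | hT
    · exact full_of_eight_dvd (by omega) hS
    · exact ((edgeFull_of_mod_eight_eq_one hT).clique S).swap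
    · obtain ⟨v, hv, hv'⟩ := exists_odd_two_mul hT
      rw [hu', hv'] at hdvd
      have hdvd : 8 * 2 ∣ 4 * (l * v * u) := by convert hdvd using 1; ring
      have := Nat.odd_iff.1 ((hl'.mul hv).mul hu)
      omega
    · obtain ⟨v, hv, hv'⟩ := exists_odd_four_mul hT
      rw [hu', hv'] at hdvd
      exact absurd hdvd (not_sixteen_dvd hl' hu hv (by ring))

/-- If all degrees are even, then it is sufficient that the number of edges, half of the number
below, is a multiple of `8`. -/
theorem full_of_dvd (hST : 9 ≤ S.card * T.card)
    (hdvd : 16 ∣ l * (T.card * (T.card - 1)) * (S.card * (S.card - 1)))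
    (heven : Even (l * (T.card - 1) * (S.card - 1))) : Full (cliqueOn S ⊠ cliqueOn T) l := by
  have hS : S.card ≠ 0 := by rintro h; simp [h] at hST
  have hT : T.card ≠ 0 := by rintro h; simp [h] at hST
  rcases (by omega : l % 4 = 0 ∨ l % 4 = 2 ∨ l % 2 = 1) with hl | hl | hl
  · exact (full_four hST).of_dvd (by omega)
  · by_cases hS4 : S.card % 4 = 0 ∨ S.card % 4 = 1
    · exact (full_two hS4 hST).of_dvd (by omega)
    by_cases hT4 : T.card % 4 = 0 ∨ T.card % 4 = 1
    · exact (full_two hT4 (by rwa [mul_comm])).swap.of_dvd (by omega)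
    obtain ⟨u, hu, hu'⟩ := exists_odd_two_mul (x := S.card) (by omega)
    obtain ⟨v, hv, hv'⟩ := exists_odd_two_mul (x := T.card) (by omega)
    obtain ⟨w, rfl⟩ : ∃ w, l = 2 * w := ⟨l / 2, by omega⟩
    rw [hu', hv'] at hdvd
    exact absurd hdvd (not_sixteen_dvd (Nat.odd_iff.2 (by omega : w % 2 = 1)) hu hv (by ring))
  · rw [Nat.even_mul, Nat.even_mul, Nat.even_iff, Nat.even_iff, Nat.even_iff] at heven
    rcases (by omega : S.card % 2 = 1 ∨ T.card % 2 = 1) with h | h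
    · exact full_of_odd_of_odd hl h hdvd
    · exact (full_of_odd_of_odd hl h (by rwa [mul_right_comm])).swap

end Even

/-! ### Odd degrees -/

section Odd

variable {α β : Type*} {S : Finset α} {T U : Finset β}

/-- The edges inside `8` new vertices are taken together with those to `8` of the old vertices. -/
theorem fullFrom_of_eight_dvd (hU : U.card = 2) (c : ℕ) (hS : S.card = 8 * (c + 2)) :
    FullFrom (cliqueOn S ⊠ cliqueOn U) 1 S.card := by
  classical
  have hU' := exists_map_eq_cliqueOn hU
  induction c generalizing S with
  | zero => exact hS ▸ fullFrom_sixteen.tensor_map (exists_map_eq_cliqueOn hS) hU'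
  | succ c ih =>
    obtain ⟨A, N, rfl, hd, hN, hA⟩ := exists_union_card (S := S) (k := 8) (by omega)
    obtain ⟨B, hB, hB8⟩ := Finset.exists_subset_card_eq (s := A) (n := 8) (by omega)
    have hAB := Finset.card_sdiff_of_subset hB
    rw [show (A ∪ N).card = A.card + 8 by omega]
    exact .clique_union_join hd hB (ih (by omega))
      (fullFrom_join_eight_eight.tensor_map
        (exists_map_eq_joinOn (hd.symm.mono_right hB) hN hB8) hU')
      (edgeFull_biclique (hd.symm.mono_right Finset.sdiff_subset) (by omega) (by omega) U hU)

/-- Adding two vertices to the first factor adds the product of `cliqueOn T` with an edge, and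
products with cycles of length `4`, which have even degrees. -/
theorem fullFrom_of_eight_dvd_of_even (hT : 8 ∣ T.card) (hT' : 16 ≤ T.card) (c : ℕ)
    (hS : S.card = 2 * (c + 1)) : FullFrom (cliqueOn S ⊠ cliqueOn T) 1 ((c + 1) * T.card) := by
  classical
  have key (N : Finset α) (hN : N.card = 2) : FullFrom (cliqueOn N ⊠ cliqueOn T) 1 T.card :=
    (fullFrom_of_eight_dvd hN (T.card / 8 - 2) (by omega)).swap
  induction c generalizing S with
  | zero => simpa using key S hS
  | succ c ih =>
    obtain ⟨A, N, rfl, hd, hN, hA⟩ := exists_union_card (S := S) (k := 2) (by omega)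
    rw [add_one_mul (c + 1)]
    exact .clique_union hd (ih (by omega)) (key N hN)
      (full_cycle_of_eight_dvd hT hd.symm (by omega) (by omega)).swap

/-- The product of `K_8` with an edge has `56` edges, too few for `8` paths. Hence the edge between
two new vertices of the first factor is taken together with the edges to two old vertices. -/
theorem fullFrom_eight (hT : T.card = 8) (c : ℕ) (hS : S.card = 2 * (c + 2)) :
    FullFrom (cliqueOn S ⊠ cliqueOn T) 1 (8 * (c + 2)) := by
  classical
  have hT' := exists_map_eq_cliqueOn hT
  induction c generalizing S with
  | zero => exact (fullFrom_eight_four.tensor_map hT' (exists_map_eq_cliqueOn hS)).swap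
  | succ c ih =>
    obtain ⟨A, N, rfl, hd, hN, hA⟩ := exists_union_card (S := S) (k := 2) (by omega)
    obtain ⟨B, hB, hB2⟩ := Finset.exists_subset_card_eq (s := A) (n := 2) (by omega)
    have hAB := Finset.card_sdiff_of_subset hB
    rw [show 8 * (c + 1 + 2) = 8 * (c + 2) + 8 by ring]
    exact .clique_union_join hd hB (ih (by omega))
      (fullFrom_eight_join.tensor_map hT'
        (exists_map_eq_joinOn (hd.symm.mono_right hB) hN hB2)).swap
      (full_cycle_of_eight_dvd (by omega) (hd.symm.mono_right Finset.sdiff_subset) (by omega)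
        (by omega)).swap

theorem fullFrom_four (hT : T.card = 4) (c : ℕ) (hS : S.card = 8 * c + 4) :
    FullFrom (cliqueOn S ⊠ cliqueOn T) 1 (2 * S.card) := by
  classical
  induction c generalizing S with
  | zero =>
    exact hS ▸ fullFrom_four_four.tensor_map (exists_map_eq_cliqueOn hS) (exists_map_eq_cliqueOn hT)
  | succ c ih =>
    obtain ⟨A, N, rfl, hd, hN, hA⟩ := exists_union_card (S := S) (k := 8) (by omega)
    rw [show 2 * (A ∪ N).card = 2 * A.card + 8 * (0 + 2) by omega]
    exact .clique_union hd (ih (by omega)) (fullFrom_eight hN 0 hT).swap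
      ((edgeFull_biclique hd.symm (by omega) (by omega)).clique T)

theorem fullFrom_of_mod_eight_eq_four (hT : T.card % 8 = 4) (c : ℕ) (hS : S.card = 8 * c + 4) :
    FullFrom (cliqueOn S ⊠ cliqueOn T) 1 ((4 * c + 2) * T.card) := by
  classical
  induction c generalizing S with
  | zero => exact (fullFrom_four hS (T.card / 8) (by omega)).swap
  | succ c ih =>
    obtain ⟨A, N, rfl, hd, hN, hA⟩ := exists_union_card (S := S) (k := 8) (by omega)
    rw [show (4 * (c + 1) + 2) * T.card = (4 * c + 2) * T.card + 8 * (T.card / 2 - 2 + 2) by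
      rw [show T.card / 2 - 2 + 2 = T.card / 2 by omega]
      nlinarith [show T.card = 2 * (T.card / 2) by omega]]
    exact .clique_union hd (ih (by omega)) (fullFrom_eight hN _ (by omega)).swap
      ((edgeFull_biclique hd.symm (by omega) (by omega)).clique T)

theorem fullFrom_one_of_eight_dvd (hS : S.card % 2 = 0) (hS0 : S.card ≠ 0) (hT : 8 ∣ T.card)
    (hT0 : T.card ≠ 0) (hex : ¬ (S.card = 2 ∧ T.card = 8)) :
    FullFrom (cliqueOn S ⊠ cliqueOn T) 1 (S.card * T.card / 2) := by
  have hhalf : S.card * T.card / 2 = S.card / 2 * T.card := by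
    rw [Nat.mul_div_right_comm (by omega)]
  by_cases h8 : T.card = 8
  · have := fullFrom_eight h8 (S.card / 2 - 2) (S := S) (by omega)
    rwa [show 8 * (S.card / 2 - 2 + 2) = S.card * T.card / 2 by rw [hhalf, h8]; omega] at this
  · have := fullFrom_of_eight_dvd_of_even hT (by omega) (S.card / 2 - 1) (S := S) (by omega)
    rwa [show S.card / 2 - 1 + 1 = S.card / 2 by omega, ← hhalf] at this

/-- If all degrees are odd, then it is sufficient that the number of edges, half of the number
below, is a multiple of `8`; exactly half as many paths as there are vertices are needed. -/
theorem fullFrom_of_dvd {l : ℕ} (hST : 9 ≤ S.card * T.card)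
    (hdvd : 16 ∣ l * (T.card * (T.card - 1)) * (S.card * (S.card - 1)))
    (hodd : Odd (l * (T.card - 1) * (S.card - 1)))
    (hex : ¬ (l = 1 ∧ ((S.card = 2 ∧ T.card = 8) ∨ (S.card = 8 ∧ T.card = 2)))) :
    FullFrom (cliqueOn S ⊠ cliqueOn T) l (S.card * T.card / 2) := by
  have hS0 : S.card ≠ 0 := by rintro h; simp [h] at hST
  have hT0 : T.card ≠ 0 := by rintro h; simp [h] at hST
  obtain ⟨hlT, hS1⟩ := Nat.odd_mul.1 hodd
  obtain ⟨hl, hT1⟩ := Nat.odd_mul.1 hlT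
  rw [Nat.odd_iff] at hl hT1 hS1
  have hdvd' : 16 ∣ T.card * S.card := by
    refine (Nat.Coprime.dvd_mul_right (n := l * (T.card - 1) * (S.card - 1)) ?_).1
      (by convert hdvd using 1; ring)
    exact Nat.Coprime.pow_left 4 (Nat.coprime_two_left.2 hodd)
  obtain ⟨i, hi⟩ : ∃ i, S.card = 2 * i := ⟨S.card / 2, by omega⟩
  obtain ⟨j, hj⟩ : ∃ j, T.card = 2 * j := ⟨T.card / 2, by omega⟩
  have hij : 4 ∣ j * i := by
    rw [hi, hj, show 2 * j * (2 * i) = 4 * (j * i) by ring] at hdvd'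
    omega
  have hcases : 8 ∣ T.card ∨ 8 ∣ S.card ∨ T.card % 8 = 4 ∧ S.card % 8 = 4 := by
    rcases Nat.even_or_odd i with ⟨i', rfl⟩ | hio
    · rcases Nat.even_or_odd j with ⟨j', rfl⟩ | hjo
      · omega
      · have := (Nat.Coprime.dvd_mul_left
          (Nat.Coprime.pow_left 2 (Nat.coprime_two_left.2 hjo) : Nat.Coprime (2 ^ 2) j)).1 hij
        omega
    · have := (Nat.Coprime.dvd_mul_right
          (Nat.Coprime.pow_left 2 (Nat.coprime_two_left.2 hio) : Nat.Coprime (2 ^ 2) i)).1 hij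
      omega
  have htwo : Full (cliqueOn S ⊠ cliqueOn T) 2 := by
    by_cases hS4 : S.card % 4 = 0
    · exact full_two (.inl hS4) hST
    · exact (full_two (by omega) (by rwa [mul_comm])).swap
  have hthree {l₀ : ℕ} (h : FullFrom (cliqueOn S ⊠ cliqueOn T) l₀ (S.card * T.card / 2))
      (hle : l₀ ≤ l) (hl₀ : l₀ % 2 = 1) :
      FullFrom (cliqueOn S ⊠ cliqueOn T) l (S.card * T.card / 2) := by
    have := h.add_full (htwo.of_dvd (l' := l - l₀) (by omega))
    rwa [Nat.add_sub_cancel' hle] at this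
  by_cases hA : S.card = 2 ∧ T.card = 8
  · refine hthree (l₀ := 3) ?_ (by omega) rfl
    rw [hA.1, hA.2]
    exact (fullFrom_eight_three_fold.tensor_map (exists_map_eq_cliqueOn hA.2)
      (exists_map_eq_cliqueOn hA.1)).swap
  by_cases hB : S.card = 8 ∧ T.card = 2
  · refine hthree (l₀ := 3) ?_ (by omega) rfl
    rw [hB.1, hB.2]
    exact fullFrom_eight_three_fold.tensor_map (exists_map_eq_cliqueOn hB.1)
      (exists_map_eq_cliqueOn hB.2)
  refine hthree (l₀ := 1) ?_ (by omega) rfl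
  rcases hcases with h | h | ⟨h, h'⟩
  · exact fullFrom_one_of_eight_dvd (by omega) hS0 h hT0 hA
  · rw [mul_comm]
    exact (fullFrom_one_of_eight_dvd (by omega) hT0 h hS0 (by tauto)).swap
  · have := fullFrom_of_mod_eight_eq_four h (S.card / 8) (S := S) (by omega)
    rwa [show 4 * (S.card / 8) + 2 = S.card / 2 by omega,
      ← Nat.mul_div_right_comm (by omega)] at this

end Odd

/-! ### Labelling parallel edges -/

theorem Decomposes.exists_families {w : Multiset (Sym2 V)} {p q : ℕ} (h : Decomposes w p q) :
    ∃ (v : Fin p → Fin 9 → V) (c : Fin q → Fin 8 → V), (∀ t, Function.Injective (v t)) ∧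
      (∀ t, Function.Injective (c t)) ∧
      w = ∑ t, pathEdges (v t) + ∑ t, cycleEdges (c t) := by
  induction h with
  | zero => exact ⟨Fin.elim0, Fin.elim0, fun t => t.elim0, fun t => t.elim0, by simp⟩
  | path u hu _ ih =>
    obtain ⟨v, c, hv, hc, rfl⟩ := ih
    refine ⟨Fin.cons u v, c, fun t => ?_, hc, by simp [Fin.sum_univ_succ, add_assoc]⟩
    cases t using Fin.cases with
    | zero => exact hu
    | succ t => exact hv t
  | cycle u hu _ ih =>
    obtain ⟨v, c, hv, hc, rfl⟩ := ih
    refine ⟨v, Fin.cons u c, hv, fun t => ?_, by simp [Fin.sum_univ_succ, add_left_comm]⟩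
    cases t using Fin.cases with
    | zero => exact hu
    | succ t => exact hc t

/-- The pairs `s i` distribute over the `l` parallel edges of the `l`-fold multigraph of `G` if each
edge of `G` occurs exactly `l` times among them. -/
theorem exists_label {X : Type*} [Fintype X] {G : SimpleGraph V} {l : ℕ} (s : X → Sym2 V)
    (hs : IsFold G l (Finset.univ.val.map s)) : ∃ f : X → Sym2 V × Fin l,
      Function.Injective f ∧ (∀ x, (f x).1 = s x) ∧ (∀ x, s x ∈ G.edgeSet) ∧
      ∀ e : Sym2 V × Fin l, e.1 ∈ G.edgeSet → e ∈ Set.range f := by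
  classical
  have hcard : ∀ e, Fintype.card {x // s x = e} = if e ∈ G.edgeSet then l else 0 := by
    intro e
    rw [← hs e, Multiset.count_map, Fintype.card_subtype]
    simp only [eq_comm (a := e)]
    rfl
  have hmem : ∀ x, s x ∈ G.edgeSet := by
    intro x
    by_contra hx
    have := hcard (s x)
    rw [if_neg hx, Fintype.card_eq_zero_iff] at this
    exact this.false ⟨x, rfl⟩
  have hequiv : ∀ e : G.edgeSet, Nonempty ({x // s x = e} ≃ Fin l) := fun e =>
    Fintype.card_eq.1 (by rw [hcard, if_pos e.2, Fintype.card_fin])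
  have hr : ∀ e : Sym2 V, ∃ r : X → Fin l, e ∈ G.edgeSet →
      (∀ x y, s x = e → s y = e → r x = r y → x = y) ∧ ∀ i, ∃ x, s x = e ∧ r x = i := by
    intro e
    by_cases he : e ∈ G.edgeSet
    · let g := (hequiv ⟨e, he⟩).some
      refine ⟨fun x => if h : s x = e then g ⟨x, h⟩ else (hequiv ⟨s x, hmem x⟩).some ⟨x, rfl⟩,
        fun _ => ⟨fun x y hx hy hxy => ?_, fun i => ⟨(g.symm i).1, (g.symm i).2, ?_⟩⟩⟩
      · simpa [hx, hy] using hxy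
      · refine (dif_pos (g.symm i).2).trans ?_
        exact g.apply_symm_apply i
    · exact ⟨fun x => (hequiv ⟨s x, hmem x⟩).some ⟨x, rfl⟩, fun h => absurd h he⟩
  choose r hr using hr
  refine ⟨fun x => (s x, r (s x) x), fun x y hxy => ?_, fun _ => rfl, hmem, ?_⟩
  · obtain ⟨h1, h2⟩ := Prod.ext_iff.1 hxy
    dsimp only at h1 h2
    rw [h1] at h2
    exact (hr _ (hmem y)).1 x y h1 rfl h2
  · rintro ⟨e, i⟩ he
    obtain ⟨x, rfl, rfl⟩ := (hr e he).2 i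
    exact ⟨x, rfl⟩

/-- The multigraph with vertex set `S` and edges `f i`, joining the pair `s i`. -/
def labelledGraph {β ι : Type*} (S : Set V) (f : ι → β) (s : ι → Sym2 V)
    (hf : Function.Injective f) (hs : ∀ i, ∀ x ∈ s i, x ∈ S) : Graph V β where
  vertexSet := S
  IsLink e x y := ∃ i, e = f i ∧ s(x, y) = s i
  isLink_symm := fun _ _ => ⟨fun _ _ ⟨i, h, h'⟩ => ⟨i, h, Sym2.eq_swap.trans h'⟩⟩
  eq_or_eq_of_isLink_of_isLink := by
    rintro e x y v w ⟨i, rfl, h⟩ ⟨j, hj, h'⟩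
    rw [← hf hj, ← h, Sym2.eq_iff] at h'
    tauto
  left_mem_of_isLink := fun _ _ _ ⟨i, _, h⟩ => hs i _ (h ▸ Sym2.mem_mk_left _ _)

theorem mem_edgeSet_labelledGraph {β ι : Type*} {S : Set V} {f : ι → β} {s : ι → Sym2 V}
    {hf : Function.Injective f} {hs : ∀ i, ∀ x ∈ s i, x ∈ S} {e : β} :
    e ∈ (labelledGraph S f s hf hs).edgeSet ↔ e ∈ Set.range f := by
  constructor
  · rintro ⟨_, _, i, rfl, _⟩
    exact ⟨i, rfl⟩
  · rintro ⟨i, rfl⟩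
    induction h : s i with
    | h x y => exact ⟨x, y, i, rfl, h.symm⟩

theorem Decomposes.hasPathCycleDecomposition {G : SimpleGraph V} {l p q : ℕ}
    {w : Multiset (Sym2 V)} (hw : IsFold G l w) (h : Decomposes w p q) :
    (G.parallelFold l).HasPathCycleDecomposition 8 p q := by
  obtain ⟨v, c, hv, hc, rfl⟩ := h.exists_families
  let s : Fin p ⊕ Fin q → Fin 8 → Sym2 V := Sum.elim
    (fun t i => s(v t i.castSucc, v t i.succ)) (fun t i => s(c t i, c t (finRotate 8 i)))
  let S : Fin p ⊕ Fin q → Set V := Sum.elim (fun t => Set.range (v t)) (fun t => Set.range (c t))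
  have hsum : ∑ t, pathEdges (v t) + ∑ t, cycleEdges (c t) =
      Finset.univ.val.map fun x : (Fin p ⊕ Fin q) × Fin 8 => s x.1 x.2 := by
    have : ∀ {X : Type} [Fintype X] (g : X → Sym2 V), Finset.univ.val.map g = ∑ x, {g x} :=
      fun g => by
        rw [Finset.sum_eq_multiset_sum,
          ← Function.comp_def (fun a : Sym2 V => ({a} : Multiset _)) g, ← Multiset.map_map,
          Multiset.sum_map_singleton]
    rw [this, Fintype.sum_prod_type, Fintype.sum_sum_type]
    simp only [pathEdges, cycleEdges, this]
    rfl
  rw [hsum] at hw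
  obtain ⟨f, hf, hfs, hsG, hsurj⟩ := exists_label _ hw
  have hS : ∀ t i, ∀ x ∈ s t i, x ∈ S t := by
    rintro (t | t) i x hx <;> rcases Sym2.mem_iff.1 hx with rfl | rfl <;> exact ⟨_, rfl⟩
  have hft : ∀ t, Function.Injective fun i => f (t, i) := fun t i j hij => by
    simpa using hf hij
  refine ⟨fun t => labelledGraph (S t) (fun i => f (t, i)) (s t) (hft t) (hS t), fun t => ?_,
    fun t => ?_, fun t => ?_, ?_, ?_⟩
  · refine ⟨Set.subset_univ _, ?_⟩
    rintro _ x y ⟨i, rfl, h⟩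
    have := hsG (t, i)
    dsimp only at this
    rw [← h] at this
    exact ⟨this, (hfs _).trans h.symm⟩
  · exact ⟨v t, fun i => f (.inl t, i), hv t, hft _, rfl, fun _ _ _ => Iff.rfl⟩
  · exact ⟨by norm_num, c t, fun i => f (.inr t, i), hc t, hft _, rfl, fun _ _ _ => Iff.rfl⟩
  · intro t t' htt'
    rw [Set.disjoint_left]
    intro e he he'
    obtain ⟨i, rfl⟩ := mem_edgeSet_labelledGraph.1 he
    obtain ⟨j, hj⟩ := mem_edgeSet_labelledGraph.1 he'
    exact htt' (congrArg Prod.fst (hf hj)).symm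
  · ext e
    simp only [Set.mem_iUnion, mem_edgeSet_labelledGraph]
    constructor
    · rintro ⟨t, i, rfl⟩
      have := hsG (t, i)
      have h' := hfs (t, i)
      dsimp only at this h'
      induction h : s t i with
      | h x y =>
        rw [h] at this h'
        exact ⟨x, y, this, h'⟩
    · rintro ⟨x, y, hxy, he⟩
      obtain ⟨⟨t, i⟩, rfl⟩ := hsurj e (by rw [he]; exact hxy)
      exact ⟨t, i, rfl⟩

/-! ### Counting edges and degrees -/

open Classical in
/-- In a decomposition with the paths from `a t` to `b t`, the degree of `x` has the parity of the
number of ends of paths at `x`. -/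
theorem exists_ends_of_hasPathCycleDecomposition [Fintype V] [DecidableEq V] {G : SimpleGraph V}
    {l p q : ℕ} (h : (G.parallelFold l).HasPathCycleDecomposition 8 p q) :
    8 * (p + q) = l * G.edgeFinset.card ∧ ∃ a b : Fin p → V, (∀ t, a t ≠ b t) ∧
      ∀ x, ∃ k, l * G.degree x + ∑ t, ((if a t = x then 1 else 0) + if b t = x then 1 else 0) =
        2 * k := by
  obtain ⟨H, hle, hpath, hcycle, hdisj, hunion⟩ := h
  choose v e hv he hV hlink using hpath
  choose _ c e' hc he' hV' hlink' using hcycle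
  let s : Fin p ⊕ Fin q → Fin 8 → Sym2 V := Sum.elim
    (fun t i => s(v t i.castSucc, v t i.succ)) (fun t i => s(c t i, c t (finRotate 8 i)))
  let f : (Fin p ⊕ Fin q) × Fin 8 → Sym2 V × Fin l := fun x =>
    Sum.elim (fun t => e t x.2) (fun t => e' t x.2) x.1
  have hmemH : ∀ y t, y ∈ (H t).edgeSet ↔ ∃ i, y = f (t, i) := by
    intro y t
    rw [(H t).edge_mem_iff_exists_isLink]
    rcases t with t | t
    · simp only [hlink]
      exact ⟨fun ⟨_, _, i, h, _⟩ => ⟨i, h⟩, fun ⟨i, h⟩ => ⟨_, _, i, h, rfl⟩⟩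
    · simp only [hlink']
      exact ⟨fun ⟨_, _, i, h, _⟩ => ⟨i, h⟩, fun ⟨i, h⟩ => ⟨_, _, i, h, rfl⟩⟩
  have hfs : ∀ t i, (f (t, i)).1 = s t i := by
    rintro (t | t) i
    · exact ((hle _).2 ((hlink t _ _ _).2 ⟨i, rfl, rfl⟩)).2
    · exact ((hle _).2 ((hlink' t _ _ _).2 ⟨i, rfl, rfl⟩)).2
  have hinj : Function.Injective f := by
    rintro ⟨t, i⟩ ⟨t', i'⟩ hij
    by_cases htt' : t = t'
    · subst htt'
      rcases t with t | t
      · exact congrArg _ (he t hij)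
      · exact congrArg _ (he' t hij)
    · exact (Set.disjoint_left.1 (hdisj htt') ((hmemH _ _).2 ⟨i, rfl⟩)
        ((hmemH _ _).2 ⟨i', hij⟩)).elim
  have himage : Finset.univ.image f = G.edgeFinset ×ˢ Finset.univ := by
    ext y
    have h1 : y ∈ Finset.univ.image f ↔ y ∈ (G.parallelFold l).edgeSet := by
      rw [← hunion, Set.mem_iUnion]
      simp only [hmemH, Finset.mem_image, Finset.mem_univ, true_and, Prod.exists]
      exact exists_congr fun t => exists_congr fun i => eq_comm
    rw [h1, Finset.mem_product, SimpleGraph.mem_edgeFinset]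
    simp only [Finset.mem_univ, and_true]
    constructor
    · rintro ⟨x, z, hxz, hy⟩
      rw [hy]
      exact hxz
    · intro hy
      induction hy' : y.1 with
      | h x z => exact ⟨x, z, by rwa [hy'] at hy, hy'⟩
  have hsum : ∀ φ : Sym2 V → ℕ, ∑ t, ∑ i, φ (s t i) = l * ∑ y ∈ G.edgeFinset, φ y := by
    intro φ
    have : ∑ x, φ (f x).1 = ∑ y ∈ G.edgeFinset ×ˢ (Finset.univ : Finset (Fin l)), φ y.1 := by
      rw [← himage, Finset.sum_image hinj.injOn]
    rw [Fintype.sum_prod_type] at this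
    simp only [hfs] at this
    rw [this, Finset.sum_product, Finset.mul_sum]
    simp
  constructor
  · have := hsum fun _ => 1
    simp at this
    lia
  refine ⟨fun t => v t 0, fun t => v t 8, fun t h => by simpa using hv t h, fun x => ?_⟩
  have hdeg := hsum fun y => if x ∈ y then 1 else 0
  rw [← Finset.card_filter, ← SimpleGraph.incidenceFinset_eq_filter,
    SimpleGraph.card_incidenceFinset_eq_degree] at hdeg
  have hmem : ∀ y z : V, y ≠ z → (if x ∈ s(y, z) then 1 else 0) =
      (if y = x then 1 else 0) + if z = x then 1 else 0 := by
    intro y z hyz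
    simp only [Sym2.mem_iff, eq_comm (a := x)]
    by_cases hy : y = x <;> by_cases hz : z = x <;> simp_all
  have hP : ∀ t, ∑ i, (if x ∈ s (.inl t) i then 1 else 0) +
      ((if v t 0 = x then 1 else 0) + if v t 8 = x then 1 else 0) =
        2 * ∑ i, if v t i = x then 1 else 0 := by
    intro t
    have : ∀ i : Fin 8, (if x ∈ s (.inl t) i then 1 else 0) =
        (if v t i.castSucc = x then 1 else 0) + if v t i.succ = x then 1 else 0 := fun i =>
      hmem _ _ fun h => by simpa [Fin.ext_iff] using hv t h
    simp only [this, Finset.sum_add_distrib]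
    have h1 := Fin.sum_univ_castSucc fun i => if v t i = x then 1 else 0
    have h2 := Fin.sum_univ_succ fun i => if v t i = x then 1 else 0
    have h3 : Fin.last 8 = 8 := rfl
    rw [h3] at h1
    omega
  have hC : ∀ t, ∑ i, (if x ∈ s (.inr t) i then 1 else 0) =
      2 * ∑ i, if c t i = x then 1 else 0 := by
    intro t
    have : ∀ i : Fin 8, (if x ∈ s (.inr t) i then 1 else 0) =
        (if c t i = x then 1 else 0) + if c t (finRotate 8 i) = x then 1 else 0 := fun i =>
      hmem _ _ fun h => by
        have hne : ∀ i : Fin 8, i ≠ finRotate 8 i := by decide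
        exact hne i (hc t h)
    simp only [this, Finset.sum_add_distrib,
      Equiv.sum_comp (finRotate 8) fun i => if c t i = x then 1 else 0]
    ring
  refine ⟨∑ t, ∑ i, (if v t i = x then 1 else 0) + ∑ t, ∑ i, (if c t i = x then 1 else 0), ?_⟩
  rw [← hdeg, Fintype.sum_sum_type, mul_add, Finset.mul_sum, Finset.mul_sum]
  simp only [← hP, ← hC]
  simp only [Finset.sum_add_distrib]
  ring

/-! ### The tensor product of complete graphs -/

theorem Full.exists_hasPathCycleDecomposition {V : Type*} {G : SimpleGraph V} {l : ℕ}
    (h : Full G l) : ∃ k, ∀ p ≤ k, p ≠ 1 →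
      (G.parallelFold l).HasPathCycleDecomposition 8 p (k - p) :=
  let ⟨_, hw, k, _, hk⟩ := h
  ⟨k, fun p hp hp1 => (hk p hp hp1).hasPathCycleDecomposition hw⟩

theorem FullFrom.exists_hasPathCycleDecomposition {V : Type*} {G : SimpleGraph V} {l a : ℕ}
    (h : FullFrom G l a) : ∃ k, a ≤ k ∧ ∀ p, a ≤ p → p ≤ k →
      (G.parallelFold l).HasPathCycleDecomposition 8 p (k - p) :=
  let ⟨_, hw, r, _, hk⟩ := h
  ⟨a + r, Nat.le_add_right a r, fun p hp hp1 => (hk p hp hp1).hasPathCycleDecomposition hw⟩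

theorem cliqueOn_univ (n : ℕ) :
    cliqueOn (Finset.univ : Finset (Fin n)) = SimpleGraph.completeGraph (Fin n) := by
  ext x y
  simp [cliqueOn, SimpleGraph.completeGraph]

open Classical in
theorem degree_tensorProduct_completeGraph {n m : ℕ} (x : Fin n × Fin m) :
    ((SimpleGraph.completeGraph (Fin n)).tensorProduct
      (SimpleGraph.completeGraph (Fin m))).degree x = (m - 1) * (n - 1) := by
  rw [← SimpleGraph.card_neighborFinset_eq_degree]
  have : ((SimpleGraph.completeGraph (Fin n)).tensorProduct
      (SimpleGraph.completeGraph (Fin m))).neighborFinset x =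
      Finset.univ.erase x.1 ×ˢ Finset.univ.erase x.2 := by
    ext y
    rw [SimpleGraph.mem_neighborFinset]
    simp [SimpleGraph.tensorProduct, eq_comm]
  rw [this, Finset.card_product, Finset.card_erase_of_mem (Finset.mem_univ _),
    Finset.card_erase_of_mem (Finset.mem_univ _)]
  simp [mul_comm]

open Classical in
theorem two_mul_card_edgeFinset (n m : ℕ) :
    2 * ((SimpleGraph.completeGraph (Fin n)).tensorProduct
      (SimpleGraph.completeGraph (Fin m))).edgeFinset.card = m * n * (m - 1) * (n - 1) := by
  rw [← SimpleGraph.sum_degrees_eq_twice_card_edges]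
  simp only [degree_tensorProduct_completeGraph, Finset.sum_const, Finset.card_univ,
    Fintype.card_prod, Fintype.card_fin, smul_eq_mul]
  ring

/-- The conditions on `p` and `q` are necessary, for all `n`, `m` and `l`. -/
theorem necessary {n m l p q : ℕ} (h : (((SimpleGraph.completeGraph (Fin n)).tensorProduct
    (SimpleGraph.completeGraph (Fin m))).parallelFold l).HasPathCycleDecomposition 8 p q) :
    8 * (p + q) = l * m * n * (m - 1) * (n - 1) / 2 ∧
      (Odd (l * (m - 1) * (n - 1)) → m * n ≤ 2 * p) ∧
      (Even (l * (m - 1) * (n - 1)) → p ≠ 1) := by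
  classical
  obtain ⟨hE, a, b, hab, hdeg⟩ := exists_ends_of_hasPathCycleDecomposition h
  simp only [degree_tensorProduct_completeGraph, ← mul_assoc] at hdeg
  refine ⟨?_, fun hodd => ?_, fun heven hp => ?_⟩
  · rw [hE, show l * m * n * (m - 1) * (n - 1) = l * (m * n * (m - 1) * (n - 1)) by ring,
      ← two_mul_card_edgeFinset, mul_left_comm, Nat.mul_div_cancel_left _ two_pos]
  · have hpos : ∀ x, 1 ≤ ∑ t, ((if a t = x then 1 else 0) + if b t = x then 1 else 0) := by
      intro x
      obtain ⟨k, hk⟩ := hdeg x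
      rw [Nat.odd_iff] at hodd
      omega
    have := Finset.sum_le_sum fun x (_ : x ∈ Finset.univ) => hpos x
    rw [Finset.sum_comm] at this
    simp only [Finset.sum_add_distrib, Finset.sum_ite_eq, Finset.mem_univ, if_true,
      Finset.sum_const, Finset.card_univ, Fintype.card_prod, Fintype.card_fin, smul_eq_mul,
      mul_one] at this
    linarith
  · subst hp
    obtain ⟨k, hk⟩ := hdeg (a 0)
    simp only [Fin.sum_univ_one, if_true, if_neg (hab 0).symm] at hk
    rw [Nat.even_iff] at heven
    omega

theorem sixteen_dvd {n m l : ℕ} (h : 8 ∣ l * m * n * (m - 1) * (n - 1) / 2) :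
    16 ∣ l * (m * (m - 1)) * (n * (n - 1)) := by
  classical
  have h2 := two_mul_card_edgeFinset n m
  rw [show l * m * n * (m - 1) * (n - 1) = l * (m * n * (m - 1) * (n - 1)) by ring, ← h2,
    mul_left_comm, Nat.mul_div_cancel_left _ two_pos] at h
  rw [show l * (m * (m - 1)) * (n * (n - 1)) = l * (m * n * (m - 1) * (n - 1)) by ring, ← h2,
    mul_left_comm]
  exact Nat.mul_dvd_mul_left 2 h

theorem exists_decompositions_of_even {n m l : ℕ} (hmn : 9 ≤ m * n)
    (hdvd : 8 ∣ l * m * n * (m - 1) * (n - 1) / 2) (h : Even (l * (m - 1) * (n - 1))) :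
    ∃ k, ∀ p ≤ k, p ≠ 1 → (((SimpleGraph.completeGraph (Fin n)).tensorProduct
      (SimpleGraph.completeGraph (Fin m))).parallelFold l).HasPathCycleDecomposition
        8 p (k - p) := by
  rw [← cliqueOn_univ, ← cliqueOn_univ]
  refine (full_of_dvd ?_ ?_ ?_).exists_hasPathCycleDecomposition <;>
    simp only [Finset.card_univ, Fintype.card_fin]
  exacts [by rwa [mul_comm], sixteen_dvd hdvd, h]

theorem exists_decompositions_of_odd {n m l : ℕ} (hmn : 9 ≤ m * n)
    (hex : ¬ (l = 1 ∧ ((n = 2 ∧ m = 8) ∨ (n = 8 ∧ m = 2))))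
    (hdvd : 8 ∣ l * m * n * (m - 1) * (n - 1) / 2) (h : Odd (l * (m - 1) * (n - 1))) :
    ∃ k, n * m / 2 ≤ k ∧ ∀ p, n * m / 2 ≤ p → p ≤ k →
      (((SimpleGraph.completeGraph (Fin n)).tensorProduct
      (SimpleGraph.completeGraph (Fin m))).parallelFold l).HasPathCycleDecomposition
        8 p (k - p) := by
  have := (fullFrom_of_dvd (l := l) (S := (Finset.univ : Finset (Fin n)))
    (T := (Finset.univ : Finset (Fin m))) ?_ ?_ ?_ ?_).exists_hasPathCycleDecomposition
  · simpa only [Finset.card_univ, Fintype.card_fin, cliqueOn_univ] using this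
  all_goals simp only [Finset.card_univ, Fintype.card_fin]
  exacts [by rwa [mul_comm], sixteen_dvd hdvd, h, hex]

end OctaDecomp

theorem mainTheorem1 (n m l : ℕ) (hl : 1 ≤ l) (hmn : 9 ≤ m * n)
    (hex : ¬ (l = 1 ∧ ((n = 2 ∧ m = 8) ∨ (n = 8 ∧ m = 2)))) :
    ((∃ p q : ℕ, (((SimpleGraph.completeGraph (Fin n)).tensorProduct
        (SimpleGraph.completeGraph (Fin m))).parallelFold l).HasPathCycleDecomposition 8 p q) ↔
      8 ∣ l * m * n * (m - 1) * (n - 1) / 2) ∧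
    (∀ p q : ℕ, (((SimpleGraph.completeGraph (Fin n)).tensorProduct
        (SimpleGraph.completeGraph (Fin m))).parallelFold l).HasPathCycleDecomposition 8 p q ↔
      8 * (p + q) = l * m * n * (m - 1) * (n - 1) / 2 ∧
      (Odd (l * (m - 1) * (n - 1)) → m * n ≤ 2 * p) ∧
      (Even (l * (m - 1) * (n - 1)) → p ≠ 1)) := by
  refine ⟨⟨fun ⟨p, q, h⟩ => ⟨p + q, (OctaDecomp.necessary h).1.symm⟩, fun hdvd => ?_⟩,
    fun p q => ⟨OctaDecomp.necessary, fun ⟨hE, hodd, heven⟩ => ?_⟩⟩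
  · rcases Nat.even_or_odd (l * (m - 1) * (n - 1)) with h | h
    · obtain ⟨k, hk⟩ := OctaDecomp.exists_decompositions_of_even hmn hdvd h
      exact ⟨_, _, hk 0 (Nat.zero_le _) zero_ne_one⟩
    · obtain ⟨k, hle, hk⟩ := OctaDecomp.exists_decompositions_of_odd hmn hex hdvd h
      exact ⟨_, _, hk k hle le_rfl⟩
  · have hdvd : 8 ∣ l * m * n * (m - 1) * (n - 1) / 2 := ⟨p + q, hE.symm⟩
    -- In both cases, counting edges in one of the decompositions gives `k = p + q`.
    rcases Nat.even_or_odd (l * (m - 1) * (n - 1)) with h | h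
    · obtain ⟨k, hk⟩ := OctaDecomp.exists_decompositions_of_even hmn hdvd h
      have := (OctaDecomp.necessary (hk 0 (Nat.zero_le _) zero_ne_one)).1
      have := hk p (by omega) (heven h)
      rwa [show k - p = q by omega] at this
    · obtain ⟨k, hle, hk⟩ := OctaDecomp.exists_decompositions_of_odd hmn hex hdvd h
      have := (OctaDecomp.necessary (hk k hle le_rfl)).1
      have hp := hodd h
      have := hk p (by rw [mul_comm n m]; omega) (by omega)
      rwa [show k - p = q by omega] at this
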